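/- Let $\mathbb{K}$ be a field of characteristic zero, $X$ a topological space and $\mathcal{O}_X$ a sheaf of commutative $\mathbb{K}$-algebras on $X$ (for example a sheaf of $\mathbb{K}$-algebras of continuous $\mathbb{K}$-valued functions). A Lie algebroid over $(X,\mathcal{O}_X)$ is an $\mathcal{O}_X$-module $\mathcal{L}$ which is a sheaf of $\mathbb{K}$-Lie algebras, with an anchor $\mathfrak{a}:\mathcal{L}\to \mathcal{D}er_{\mathbb{K}_X}(\mathcal{O}_X)$ that is $\mathcal{O}_X$-linear, a homomorphism of Lie algebras, and satisfies $[D,fD']=f[D,D']+\mathfrak{a}(D)(f)D'$. It is locally free if it is locally isomorphic, as an $\mathcal{O}_X$-module, to a direct sum (of possibly infinite rank) of copies of $\mathcal{O}_X$. Let $\mathscr{U}(\mathcal{O}_X,\mathcal{L})$ be its universal enveloping algebroid, the sheaf associated with $U\mapsto \mathcal{U}(\mathcal{O}_X(U),\mathcal{L}(U))$, with canonical map $\iota_{\mathcal{L}}:\mathcal{L}\to\mathscr{U}(\mathcal{O}_X,\mathcal{L})$, $D\mapsto\bar D$. Let $\mathscr{U}_{(n)}(\mathcal{O}_X,\mathcal{L})$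 be the subsheaf spanned locally by the sections $f\bar D_1\cdots\bar D_m$ with $m\le n$, put $\mathscr{U}_{(-1)}=0$, let $gr\,\mathscr{U}(\mathcal{O}_X,\mathcal{L})=\bigoplus_{n\ge 0}\mathscr{U}_{(n)}/\mathscr{U}_{(n-1)}$, and let $gr_n:\mathscr{U}_{(n)}(\mathcal{O}_X,\mathcal{L})\to gr\,\mathscr{U}(\mathcal{O}_X,\mathcal{L})$ be the canonical map onto the summand of degree $n$. Let $\mathcal{L}$ be a locally free Lie algebroid over $(X,\mathcal{O}_X)$ and $(\mathcal{L}',\phi)$ a locally free $\mathcal{L}$-Lie algebroid, that is, a locally free Lie algebroid $\mathcal{L}'$ over $(X,\mathcal{O}_X)$ with an $\mathcal{O}_X$-linear homomorphism $\phi:\mathcal{L}'\to\mathcal{L}$ of sheaves of Lie algebras that is compatible with the anchors. Let $\mathscr{U}(\phi):\mathscr{U}(\mathcal{O}_X,\mathcal{L}')\to\mathscr{U}(\mathcal{O}_X,\mathcal{L})$, $gr(\mathscr{U}(\phi))$ and $\tilde\phi:\mathcal{S}ym_{\mathcal{O}_X}(\mathcal{L}')\to\mathcal{S}ym_{\mathcal{O}_X}(\mathcal{L})$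 be the induced maps. 1. For $\mathcal{M}=\mathcal{L}'$ and for $\mathcal{M}=\mathcal{L}$ there is exactly one isomorphism of sheaves of graded $\mathcal{O}_X$-algebras $$\psi_{\mathcal{M}}: gr\,\mathscr{U}(\mathcal{O}_X,\mathcal{M})\to \mathcal{S}ym_{\mathcal{O}_X}(\mathcal{M})$$ whose inverse is the symmetrization map: for all $k\ge 0$ and all sections $D_1,\dots,D_k$ of $\mathcal{M}$ over an open set it sends $D_1\cdots D_k$ to $gr_k\bigl(\frac{1}{k!}\sum_{\sigma\in S_k}\bar D_{\sigma(1)}\cdots\bar D_{\sigma(k)}\bigr)$. 2. These PBW isomorphisms are compatible with $\phi$: $\tilde\phi\circ\psi_{\mathcal{L}'}=\psi_{\mathcal{L}}\circ gr(\mathscr{U}(\phi))$. 3. The maps $\iota_{\mathcal{L}'}$ and $\iota_{\mathcal{L}}$ are injective, $\mathscr{U}(\phi)\circ\iota_{\mathcal{L}'}=\iota_{\mathcal{L}}\circ\phi$, and $gr(\mathscr{U}(\phi))\circ gr_n=gr_n\circ\mathscr{U}(\phi)$ on $\mathscr{U}_{(n)}(\mathcal{O}_X,\mathcal{L}')$ for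 every $n\ge 0$. Consequently $\tilde\phi\circ\psi_{\mathcal{L}'}\circ gr_1\circ\iota_{\mathcal{L}'}=\psi_{\mathcal{L}}\circ gr_1\circ\iota_{\mathcal{L}}\circ\phi$. -/

import Mathlib

open CategoryTheory TopologicalSpace Opposite

universe u

set_option linter.unusedSectionVars false

noncomputable section

/-! ## The universal enveloping algebra of a Lie–Rinehart algebra -/

namespace LieRinehart

variable (K A L : Type u) [CommRing K] [CommRing A] [Algebra K A] [LieRing L] [LieAlgebra K L]
  [Module A L] [LieRingModule L A]

/-- The relations of the universal enveloping algebra of the `(K, A)`-Lie–Rinehart algebra `L`, on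
the free `K`-algebra on symbols `a ∈ A` and `x ∈ L`: the map from `A` is a homomorphism of
`K`-algebras, the map from `L` is additive and compatible with the bracket, and
`a · x = (a x)`, `x · a - a · x = x(a)`. -/
inductive EnvRel : FreeAlgebra K (A ⊕ L) → FreeAlgebra K (A ⊕ L) → Prop
  | scalar (k : K) : EnvRel (FreeAlgebra.ι K (Sum.inl (algebraMap K A k))) (algebraMap K _ k)
  | add_left (a b : A) : EnvRel (FreeAlgebra.ι K (Sum.inl (a + b)))
      (FreeAlgebra.ι K (Sum.inl a) + FreeAlgebra.ι K (Sum.inl b))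
  | mul_left (a b : A) : EnvRel (FreeAlgebra.ι K (Sum.inl (a * b)))
      (FreeAlgebra.ι K (Sum.inl a) * FreeAlgebra.ι K (Sum.inl b))
  | add_right (x y : L) : EnvRel (FreeAlgebra.ι K (Sum.inr (x + y)))
      (FreeAlgebra.ι K (Sum.inr x) + FreeAlgebra.ι K (Sum.inr y))
  | smul_right (a : A) (x : L) : EnvRel (FreeAlgebra.ι K (Sum.inr (a • x)))
      (FreeAlgebra.ι K (Sum.inl a) * FreeAlgebra.ι K (Sum.inr x))
  | lie (x y : L) : EnvRel (FreeAlgebra.ι K (Sum.inr ⁅x, y⁆))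
      (FreeAlgebra.ι K (Sum.inr x) * FreeAlgebra.ι K (Sum.inr y) -
        FreeAlgebra.ι K (Sum.inr y) * FreeAlgebra.ι K (Sum.inr x))
  | anchor (x : L) (a : A) : EnvRel (FreeAlgebra.ι K (Sum.inl ⁅x, a⁆))
      (FreeAlgebra.ι K (Sum.inr x) * FreeAlgebra.ι K (Sum.inl a) -
        FreeAlgebra.ι K (Sum.inl a) * FreeAlgebra.ι K (Sum.inr x))

/-- The universal enveloping algebra of the `(K, A)`-Lie–Rinehart algebra `L`. -/
def Env : Type u := RingQuot (EnvRel K A L)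

instance : Ring (Env K A L) := inferInstanceAs (Ring (RingQuot (EnvRel K A L)))

instance : Algebra K (Env K A L) := inferInstanceAs (Algebra K (RingQuot (EnvRel K A L)))

namespace Env

/-- The quotient map from the free algebra. -/
def mk : FreeAlgebra K (A ⊕ L) →ₐ[K] Env K A L := RingQuot.mkAlgHom K (EnvRel K A L)

variable {K A L} in
theorem mk_rel {p q : FreeAlgebra K (A ⊕ L)} (h : EnvRel K A L p q) : mk K A L p = mk K A L q :=
  RingQuot.mkAlgHom_rel K h

/-- The canonical algebra homomorphism `A → U(A, L)`. -/
def ofA : A →ₐ[K] Env K A L where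
  toFun a := mk K A L (FreeAlgebra.ι K (Sum.inl a))
  map_one' := by simpa using mk_rel (EnvRel.scalar (A := A) (L := L) (1 : K))
  map_mul' a b := by simpa using mk_rel (EnvRel.mul_left (K := K) (L := L) a b)
  map_zero' := by simpa using mk_rel (EnvRel.scalar (A := A) (L := L) (0 : K))
  map_add' a b := by simpa using mk_rel (EnvRel.add_left (K := K) (L := L) a b)
  commutes' k := by simpa using mk_rel (EnvRel.scalar (A := A) (L := L) k)

theorem ofA_apply (a : A) : ofA K A L a = mk K A L (FreeAlgebra.ι K (Sum.inl a)) := rfl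

/-- The canonical map `L → U(A, L)`. -/
def ofL [IsScalarTower K A L] : L →ₗ[K] Env K A L where
  toFun x := mk K A L (FreeAlgebra.ι K (Sum.inr x))
  map_add' x y := by simpa using mk_rel (EnvRel.add_right (K := K) (A := A) x y)
  map_smul' k x := by
    have h := mk_rel (EnvRel.smul_right (K := K) (algebraMap K A k) x)
    rw [algebraMap_smul, map_mul, mk_rel (EnvRel.scalar (A := A) (L := L) k)] at h
    simpa [Algebra.smul_def] using h

variable [IsScalarTower K A L]

theorem ofL_apply (x : L) : ofL K A L x = mk K A L (FreeAlgebra.ι K (Sum.inr x)) := rfl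

theorem ofL_smul (a : A) (x : L) : ofL K A L (a • x) = ofA K A L a * ofL K A L x := by
  simpa [ofL_apply, ofA_apply] using mk_rel (EnvRel.smul_right (K := K) a x)

theorem ofL_lie (x y : L) :
    ofL K A L ⁅x, y⁆ = ofL K A L x * ofL K A L y - ofL K A L y * ofL K A L x := by
  simpa [ofL_apply, ofA_apply] using mk_rel (EnvRel.lie (K := K) (A := A) x y)

theorem ofA_lie (x : L) (a : A) :
    ofA K A L ⁅x, a⁆ = ofL K A L x * ofA K A L a - ofA K A L a * ofL K A L x := by
  simpa [ofL_apply, ofA_apply] using mk_rel (EnvRel.anchor (K := K) x a)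

variable {K A L}

@[ext]
theorem hom_ext {B : Type*} [Ring B] [Algebra K B] {f g : Env K A L →ₐ[K] B}
    (hA : ∀ a, f (ofA K A L a) = g (ofA K A L a))
    (hL : ∀ x, f (ofL K A L x) = g (ofL K A L x)) : f = g := by
  refine RingQuot.ringQuot_ext' (s := EnvRel K A L) K f g (FreeAlgebra.hom_ext ?_)
  funext z
  rcases z with a | x
  · exact hA a
  · exact hL x

/-- The universal property of the universal enveloping algebra. -/
def lift {B : Type*} [Ring B] [Algebra K B] (f : A →ₐ[K] B) (g : L →+ B)
    (h_smul : ∀ a x, g (a • x) = f a * g x) (h_lie : ∀ x y, g ⁅x, y⁆ = g x * g y - g y * g x)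
    (h_anchor : ∀ x a, f ⁅x, a⁆ = g x * f a - f a * g x) : Env K A L →ₐ[K] B :=
  RingQuot.liftAlgHom (s := EnvRel K A L) K ⟨FreeAlgebra.lift K (Sum.elim f g), by
    intro p q h
    cases h <;> simp [h_smul, h_lie, h_anchor]⟩

section lift

variable {B : Type*} [Ring B] [Algebra K B] (f : A →ₐ[K] B) (g : L →+ B)
  (h_smul : ∀ a x, g (a • x) = f a * g x) (h_lie : ∀ x y, g ⁅x, y⁆ = g x * g y - g y * g x)
  (h_anchor : ∀ x a, f ⁅x, a⁆ = g x * f a - f a * g x)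

@[simp]
theorem lift_ofA (a : A) : lift f g h_smul h_lie h_anchor (ofA K A L a) = f a := by
  rw [ofA_apply]
  exact (RingQuot.liftAlgHom_mkAlgHom_apply K _ _ _).trans (by simp)

@[simp]
theorem lift_ofL (x : L) : lift f g h_smul h_lie h_anchor (ofL K A L x) = g x := by
  rw [ofL_apply]
  exact (RingQuot.liftAlgHom_mkAlgHom_apply K _ _ _).trans (by simp)

end lift

/-- Functoriality of the universal enveloping algebra for morphisms of Lie–Rinehart algebras. -/
def map {B M : Type u} [CommRing B] [Algebra K B] [LieRing M] [LieAlgebra K M] [Module B M]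
    [LieRingModule M B] [IsScalarTower K B M] {σ : A →ₐ[K] B}
    (F : LieRinehartAlgebra.Hom σ L M) : Env K A L →ₐ[K] Env K B M :=
  lift ((ofA K B M).comp σ) ((ofL K B M).toAddMonoidHom.comp F.toLieHom.toLinearMap.toAddMonoidHom)
    (fun a x => by simp [F.map_smul_apply, ofL_smul])
    (fun x y => by simp [ofL_lie])
    (fun x a => by simp [F.apply_lie, ofA_lie])

section map

variable {B M : Type u} [CommRing B] [Algebra K B] [LieRing M] [LieAlgebra K M] [Module B M]
    [LieRingModule M B] [IsScalarTower K B M] {σ : A →ₐ[K] B} (F : LieRinehartAlgebra.Hom σ L M)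

@[simp]
theorem map_ofA (a : A) : map F (ofA K A L a) = ofA K B M (σ a) :=
  lift_ofA _ _ _ _ _ a

@[simp]
theorem map_ofL (x : L) : map F (ofL K A L x) = ofL K B M (F x) :=
  lift_ofL _ _ _ _ _ x

end map

end Env

end LieRinehart
/-! ## Filtered algebras and their associated graded algebras -/

/-- An increasing multiplicative `ℕ`-filtration of a `K`-algebra by `K`-submodules. -/
structure AlgFiltration (K A : Type u) [CommRing K] [Ring A] [Algebra K A] where
  /-- The `n`-th step. -/
  step : ℕ → Submodule K A
  mono : ∀ n, step n ≤ step (n + 1)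
  one_mem : (1 : A) ∈ step 0
  mul_mem : ∀ {m n : ℕ} {a b : A}, a ∈ step m → b ∈ step n → a * b ∈ step (m + n)

namespace AlgFiltration

variable {K A B C : Type u} [CommRing K] [Ring A] [Algebra K A] [Ring B] [Algebra K B]
  [Ring C] [Algebra K C] (F : AlgFiltration K A) (G : AlgFiltration K B) (H : AlgFiltration K C)

/-- The step before the `n`-th one; the step before the `0`-th one is `0`. -/
def prev : ℕ → Submodule K A
  | 0 => ⊥
  | n + 1 => F.step n

theorem prev_mul_mem {m n : ℕ} {a b : A} (ha : a ∈ F.prev m) (hb : b ∈ F.step n) :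
    a * b ∈ F.prev (m + n) := by
  cases m with
  | zero =>
    have : a = 0 := by simpa [prev] using ha
    simp [this]
  | succ m =>
    have h : m + 1 + n = (m + n) + 1 := by omega
    rw [h]
    exact F.mul_mem ha hb

theorem mul_prev_mem {m n : ℕ} {a b : A} (ha : a ∈ F.step m) (hb : b ∈ F.prev n) :
    a * b ∈ F.prev (m + n) := by
  cases n with
  | zero =>
    have : b = 0 := by simpa [prev] using hb
    simp [this]
  | succ n => exact F.mul_mem ha hb

/-- The `n`-th graded piece `Fₙ / Fₙ₋₁`. -/
abbrev Piece (n : ℕ) : Type u := F.step n ⧸ (F.prev n).submoduleOf (F.step n)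

/-- The quotient map `Fₙ → Fₙ / Fₙ₋₁`. -/
def toPiece (n : ℕ) : F.step n →ₗ[K] F.Piece n := Submodule.mkQ _

theorem toPiece_surjective (n : ℕ) : Function.Surjective (F.toPiece n) :=
  Submodule.mkQ_surjective _

theorem toPiece_eq_iff {n : ℕ} (a b : F.step n) :
    F.toPiece n a = F.toPiece n b ↔ (a : A) - b ∈ F.prev n := by
  exact Submodule.Quotient.eq _

theorem mk_toPiece_congr {m n : ℕ} (h : m = n) (a : F.step m) (b : F.step n)
    (hab : (a : A) = b) :
    (GradedMonoid.mk m (F.toPiece m a) : GradedMonoid F.Piece) =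
      GradedMonoid.mk n (F.toPiece n b) := by
  subst h
  rw [Subtype.ext hab]

/-- The product `Fₘ × Fₙ → Fₘ₊ₙ / Fₘ₊ₙ₋₁`. -/
def preMul (m n : ℕ) : F.step m →ₗ[K] F.step n →ₗ[K] F.Piece (m + n) :=
  LinearMap.mk₂ K (fun a b => F.toPiece (m + n) ⟨a * b, F.mul_mem a.2 b.2⟩)
    (fun a a' b => by rw [← map_add]; congr 1; ext; simp [add_mul])
    (fun k a b => by rw [← map_smul]; congr 1; ext; simp)
    (fun a b b' => by rw [← map_add]; congr 1; ext; simp [mul_add])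
    (fun k a b => by rw [← map_smul]; congr 1; ext; simp)

/-- The product of graded pieces. -/
def pieceMul (m n : ℕ) : F.Piece m →ₗ[K] F.Piece n →ₗ[K] F.Piece (m + n) :=
  Submodule.liftQ _
    (LinearMap.flip (Submodule.liftQ _ (F.preMul m n).flip (by
      intro b hb
      ext a
      have : F.toPiece (m + n) ⟨a * b, F.mul_mem a.2 b.2⟩ = F.toPiece (m + n) 0 :=
        (F.toPiece_eq_iff _ _).2 (by simpa using F.mul_prev_mem a.2 hb)
      simpa [preMul] using this)))
    (by
      intro a ha
      refine LinearMap.ext fun b => ?_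
      obtain ⟨b, rfl⟩ := F.toPiece_surjective n b
      have : F.toPiece (m + n) ⟨a * b, F.mul_mem a.2 b.2⟩ = F.toPiece (m + n) 0 :=
        (F.toPiece_eq_iff _ _).2 (by simpa using F.prev_mul_mem ha b.2)
      simpa [preMul, toPiece] using this)

@[simp]
theorem pieceMul_toPiece {m n : ℕ} (a : F.step m) (b : F.step n) :
    F.pieceMul m n (F.toPiece m a) (F.toPiece n b) =
      F.toPiece (m + n) ⟨a * b, F.mul_mem a.2 b.2⟩ := rfl

instance : GradedMonoid.GMul F.Piece := ⟨fun {m n} a b => F.pieceMul m n a b⟩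

instance : GradedMonoid.GOne F.Piece := ⟨F.toPiece 0 ⟨1, F.one_mem⟩⟩

instance : DirectSum.GSemiring F.Piece where
  mul_zero a := map_zero _
  zero_mul b := LinearMap.map_zero₂ _ _
  mul_add a b c := map_add _ _ _
  add_mul a b c := LinearMap.map_add₂ _ _ _ _
  one_mul := by
    rintro ⟨n, a⟩
    obtain ⟨a, rfl⟩ := F.toPiece_surjective n a
    exact F.mk_toPiece_congr (zero_add n) _ _ (one_mul _)
  mul_one := by
    rintro ⟨n, a⟩
    obtain ⟨a, rfl⟩ := F.toPiece_surjective n a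
    exact F.mk_toPiece_congr (add_zero n) _ _ (mul_one _)
  mul_assoc := by
    rintro ⟨l, a⟩ ⟨m, b⟩ ⟨n, c⟩
    obtain ⟨a, rfl⟩ := F.toPiece_surjective l a
    obtain ⟨b, rfl⟩ := F.toPiece_surjective m b
    obtain ⟨c, rfl⟩ := F.toPiece_surjective n c
    exact F.mk_toPiece_congr (add_assoc l m n) _ _ (mul_assoc _ _ _)
  natCast k := k • F.toPiece 0 ⟨1, F.one_mem⟩
  natCast_zero := zero_nsmul _
  natCast_succ _ := succ_nsmul _ _

instance : DirectSum.GRing F.Piece where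
  intCast n := n • F.toPiece 0 ⟨1, F.one_mem⟩
  intCast_ofNat _ := natCast_zsmul _ _
  intCast_negSucc_ofNat _ := negSucc_zsmul _ _

theorem algebraMap_mem (k : K) : algebraMap K A k ∈ F.step 0 := by
  rw [Algebra.algebraMap_eq_smul_one]
  exact Submodule.smul_mem _ _ F.one_mem

instance : DirectSum.GAlgebra K F.Piece where
  toFun :=
    { toFun := fun k => F.toPiece 0 ⟨algebraMap K A k, F.algebraMap_mem k⟩
      map_zero' := by
        rw [← map_zero (F.toPiece 0)]
        congr 1
        ext
        simp
      map_add' := fun r s => by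
        rw [← map_add]
        congr 1
        ext
        simp }
  map_one := congrArg (F.toPiece 0) (Subtype.ext (map_one _))
  map_mul r s := F.mk_toPiece_congr (zero_add 0).symm _ _ (map_mul _ r s)
  commutes := by
    rintro r ⟨n, a⟩
    obtain ⟨a, rfl⟩ := F.toPiece_surjective n a
    exact F.mk_toPiece_congr (add_comm 0 n) _ _ (Algebra.commutes r (a : A))
  smul_def := by
    rintro r ⟨n, a⟩
    obtain ⟨a, rfl⟩ := F.toPiece_surjective n a
    exact F.mk_toPiece_congr (zero_add n).symm (r • a) _ (Algebra.smul_def r (a : A))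

/-- The associated graded algebra `⨁ₙ Fₙ / Fₙ₋₁`. -/
abbrev Gr : Type u := DirectSum ℕ F.Piece

instance : Ring F.Gr := DirectSum.ring F.Piece

/-- The class in degree `n` of an element of `Fₙ`. -/
def cls (n : ℕ) : F.step n →ₗ[K] F.Gr := (DirectSum.lof K ℕ F.Piece n).comp (F.toPiece n)

theorem cls_one : F.cls 0 ⟨1, F.one_mem⟩ = 1 := rfl

theorem cls_mul {m n : ℕ} (a : F.step m) (b : F.step n) :
    F.cls m a * F.cls n b = F.cls (m + n) ⟨a * b, F.mul_mem a.2 b.2⟩ :=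
  DirectSum.of_mul_of _ _

variable {F G H}

theorem gr_hom_ext {R : Type*} [Ring R] [Algebra K R] {f g : F.Gr →ₐ[K] R}
    (h : ∀ n a, f (F.cls n a) = g (F.cls n a)) : f = g := by
  refine DirectSum.algHom_ext' K _ fun n => ?_
  ext a
  exact h n a

variable (F G H)

/-- The map on graded pieces induced by a filtered algebra homomorphism. -/
def pieceMap (f : A →ₐ[K] B) (hf : ∀ n a, a ∈ F.step n → f a ∈ G.step n) (n : ℕ) :
    F.Piece n →ₗ[K] G.Piece n :=
  Submodule.mapQ _ _ (f.toLinearMap.restrict (hf n)) (by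
    intro a ha
    cases n with
    | zero =>
      have h0 : (a : A) = 0 := ha
      have h1 : f (a : A) = 0 := by rw [h0, map_zero]
      exact h1
    | succ n => exact hf n a ha)

/-- The homomorphism of associated graded algebras induced by a filtered algebra homomorphism. -/
def grMap (f : A →ₐ[K] B) (hf : ∀ n a, a ∈ F.step n → f a ∈ G.step n) : F.Gr →ₐ[K] G.Gr :=
  DirectSum.toAlgebra K F.Piece
    (fun n => (DirectSum.lof K ℕ G.Piece n).comp (pieceMap F G f hf n))
    (by
      have h : G.toPiece 0 ⟨f 1, hf 0 _ F.one_mem⟩ = G.toPiece 0 ⟨1, G.one_mem⟩ :=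
        congrArg (G.toPiece 0) (Subtype.ext (map_one f))
      exact congrArg (DirectSum.lof K ℕ G.Piece 0) h)
    (by
      intro m n a b
      obtain ⟨a, rfl⟩ := F.toPiece_surjective m a
      obtain ⟨b, rfl⟩ := F.toPiece_surjective n b
      refine Eq.trans ?_ (cls_mul G ⟨f a, hf m _ a.2⟩ ⟨f b, hf n _ b.2⟩).symm
      exact congrArg (G.cls (m + n)) (Subtype.ext (map_mul f (a : A) b)))

@[simp]
theorem grMap_cls (f : A →ₐ[K] B) (hf : ∀ n a, a ∈ F.step n → f a ∈ G.step n) (n : ℕ)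
    (a : F.step n) : grMap F G f hf (F.cls n a) = G.cls n ⟨f a, hf n a a.2⟩ :=
  DirectSum.toAddMonoid_of _ _ _

end AlgFiltration

/-! ## Symmetric algebras and semilinear maps -/

namespace SymmetricAlgebra

variable {K A B L M : Type u} [CommRing K] [CommRing A] [CommRing B] [Algebra K A] [Algebra K B]
  [AddCommGroup L] [Module K L] [Module A L] [IsScalarTower K A L]
  [AddCommGroup M] [Module K M] [Module B M] [IsScalarTower K B M]

theorem algHom_ext_base {R : Type*} [Ring R] [Algebra K R] {f g : SymmetricAlgebra A L →ₐ[K] R}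
    (hA : ∀ a, f (algebraMap A _ a) = g (algebraMap A _ a))
    (hL : ∀ x, f (ι A L x) = g (ι A L x)) : f = g := by
  refine AlgHom.ext fun s => ?_
  induction s using SymmetricAlgebra.induction with
  | algebraMap r => exact hA r
  | ι x => exact hL x
  | mul a b ha hb => rw [map_mul, map_mul, ha, hb]
  | add a b ha hb => rw [map_add, map_add, ha, hb]

/-- The homomorphism of symmetric algebras induced by a map that is semilinear along `σ`. -/
def mapSemi (σ : A →ₐ[K] B) (g : L →ₛₗ[σ.toRingHom] M) :
    SymmetricAlgebra A L →ₐ[K] SymmetricAlgebra B M :=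
  letI : Algebra A (SymmetricAlgebra B M) :=
    ((algebraMap B (SymmetricAlgebra B M)).comp σ.toRingHom).toAlgebra
  { (SymmetricAlgebra.lift (R := A) (M := L) (A := SymmetricAlgebra B M)
      { toFun := fun x => ι B M (g x)
        map_add' := fun x y => by rw [map_add, map_add]
        map_smul' := fun a x => by
          rw [map_smulₛₗ, map_smul, Algebra.smul_def]
          rfl }).toRingHom with
    commutes' := fun k => by
      rw [IsScalarTower.algebraMap_apply K A (SymmetricAlgebra A L),
        IsScalarTower.algebraMap_apply K B (SymmetricAlgebra B M), ← σ.commutes]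
      exact AlgHom.commutes (SymmetricAlgebra.lift (R := A) (M := L) (A := SymmetricAlgebra B M) _)
        _ }

@[simp]
theorem mapSemi_algebraMap (σ : A →ₐ[K] B) (g : L →ₛₗ[σ.toRingHom] M) (a : A) :
    mapSemi σ g (algebraMap A _ a) = algebraMap B _ (σ a) := by
  let _ : Algebra A (SymmetricAlgebra B M) :=
    ((algebraMap B (SymmetricAlgebra B M)).comp σ.toRingHom).toAlgebra
  exact AlgHom.commutes (SymmetricAlgebra.lift (R := A) (M := L) (A := SymmetricAlgebra B M) _) a

@[simp]
theorem mapSemi_ι (σ : A →ₐ[K] B) (g : L →ₛₗ[σ.toRingHom] M) (x : L) :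
    mapSemi σ g (ι A L x) = ι B M (g x) := by
  let _ : Algebra A (SymmetricAlgebra B M) :=
    ((algebraMap B (SymmetricAlgebra B M)).comp σ.toRingHom).toAlgebra
  exact SymmetricAlgebra.lift_ι_apply (R := A) (M := L) (A := SymmetricAlgebra B M) _ x

end SymmetricAlgebra

/-! ## Sheaves of algebras -/

section SheafAlg

variable {K : Type u} [Field K] {X : TopCat.{u}}

/-- Restriction of sections of a presheaf of (not necessarily commutative) `K`-algebras. -/
def algRes (F : (Opens X)ᵒᵖ ⥤ AlgCat.{u} K) {U V : Opens X} (h : V ≤ U) :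
    F.obj (op U) →ₐ[K] F.obj (op V) :=
  (F.map (homOfLE h).op).hom

theorem algRes_algRes (F : (Opens X)ᵒᵖ ⥤ AlgCat.{u} K) {U V W : Opens X} (h : V ≤ U)
    (h' : W ≤ V) (s : F.obj (op U)) :
    algRes F h' (algRes F h s) = algRes F (h'.trans h) s := by
  have := F.map_comp (homOfLE h).op (homOfLE h').op
  exact (congrArg (fun f => f.hom s) this).symm

theorem algRes_self (F : (Opens X)ᵒᵖ ⥤ AlgCat.{u} K) {U : Opens X} (s : F.obj (op U)) :
    algRes F le_rfl s = s :=
  congrArg (fun f => f.hom s) (F.map_id (op U))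

theorem algRes_naturality {F G : (Opens X)ᵒᵖ ⥤ AlgCat.{u} K} (α : F ⟶ G) {U V : Opens X}
    (h : V ≤ U) (s : F.obj (op U)) :
    algRes G h ((α.app (op U)).hom s) = (α.app (op V)).hom (algRes F h s) :=
  (congrArg (fun f => f.hom s) (α.naturality (homOfLE h).op)).symm

/-- A section lies locally in `S` if every point of its domain has a neighbourhood on which its
restriction lies in `S`. -/
def LocallyMem (F : (Opens X)ᵒᵖ ⥤ AlgCat.{u} K) (S : ∀ V : Opens X, Submodule K (F.obj (op V)))
    {U : Opens X} (s : F.obj (op U)) : Prop :=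
  ∀ x ∈ U, ∃ (V : Opens X) (h : V ≤ U), x ∈ V ∧ algRes F h s ∈ S V

/-- The sheaf associated with a presheaf of `K`-algebras. -/
abbrev sheafifyAlg (F : (Opens X)ᵒᵖ ⥤ AlgCat.{u} K) : X.Sheaf (AlgCat.{u} K) :=
  (presheafToSheaf (Opens.grothendieckTopology X) (AlgCat.{u} K)).obj F

/-- The canonical map from a presheaf of `K`-algebras to the associated sheaf. -/
def toSheafAlg (F : (Opens X)ᵒᵖ ⥤ AlgCat.{u} K) : F ⟶ (sheafifyAlg F).obj :=
  toSheafify (Opens.grothendieckTopology X) F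

/-- The morphism of associated sheaves induced by a morphism of presheaves. -/
def sheafifyAlgMap {F G : (Opens X)ᵒᵖ ⥤ AlgCat.{u} K} (α : F ⟶ G) :
    sheafifyAlg F ⟶ sheafifyAlg G :=
  (presheafToSheaf (Opens.grothendieckTopology X) (AlgCat.{u} K)).map α

theorem toSheafAlg_naturality {F G : (Opens X)ᵒᵖ ⥤ AlgCat.{u} K} (α : F ⟶ G) {U : Opens X}
    (s : F.obj (op U)) :
    ((sheafifyAlgMap α).hom.app (op U)).hom (((toSheafAlg F).app (op U)).hom s) =
      ((toSheafAlg G).app (op U)).hom ((α.app (op U)).hom s) := by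
  have h := toSheafify_naturality (Opens.grothendieckTopology X) α
  exact (congrArg (fun β => (β.app (op U)).hom s) h).symm

/-- The algebra of sections of the structure sheaf. -/
abbrev OSec (O : X.Sheaf (CommAlgCat.{u} K)) (U : Opens X) : Type u := O.obj.obj (op U)

/-- Restriction of sections of the structure sheaf. -/
def oRes (O : X.Sheaf (CommAlgCat.{u} K)) {U V : Opens X} (h : V ≤ U) :
    OSec O U →ₐ[K] OSec O V :=
  (O.obj.map (homOfLE h).op).hom

theorem oRes_oRes (O : X.Sheaf (CommAlgCat.{u} K)) {U V W : Opens X} (h : V ≤ U)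
    (h' : W ≤ V) (f : OSec O U) : oRes O h' (oRes O h f) = oRes O (h'.trans h) f := by
  have := O.obj.map_comp (homOfLE h).op (homOfLE h').op
  exact (congrArg (fun g => g.hom f) this).symm

theorem oRes_self (O : X.Sheaf (CommAlgCat.{u} K)) {U : Opens X} (f : OSec O U) :
    oRes O le_rfl f = f :=
  congrArg (fun g => g.hom f) (O.obj.map_id (op U))

end SheafAlg

/-! ## Lie algebroids -/

/-- A Lie algebroid over `(X, O)`: a sheaf of `K`-Lie algebras and `O`-modules `U ↦ sec U` with an
anchor (the action `⁅D, f⁆` of sections on functions by derivations) satisfying the Leibniz rule,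
that is, a sheaf of Lie–Rinehart algebras over the sheaf of commutative `K`-algebras `O`. -/
structure LieAlgebroid {K : Type u} [Field K] {X : TopCat.{u}}
    (O : X.Sheaf (CommAlgCat.{u} K)) where
  /-- Sections over an open set. -/
  sec : Opens X → Type u
  [lieRing : ∀ U, LieRing (sec U)]
  [lieAlgebra : ∀ U, LieAlgebra K (sec U)]
  [module : ∀ U, Module (OSec O U) (sec U)]
  [anchor : ∀ U, LieRingModule (sec U) (OSec O U)]
  [lieRinehartRing : ∀ U, LieRinehartRing (OSec O U) (sec U)]
  [lieRinehartAlgebra : ∀ U, LieRinehartAlgebra K (OSec O U) (sec U)]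
  /-- Restriction of sections. -/
  res : ∀ {U V : Opens X} (h : V ≤ U), LieRinehartAlgebra.Hom (oRes O h) (sec U) (sec V)
  res_self : ∀ {U : Opens X} (s : sec U), res le_rfl s = s
  res_res : ∀ {U V W : Opens X} (h : V ≤ U) (h' : W ≤ V) (s : sec U),
    res h' (res h s) = res (h'.trans h) s
  existsUnique_gluing : ∀ {ι : Type u} (V : ι → Opens X) (s : ∀ i, sec (V i)),
    (∀ i j, res (inf_le_left : V i ⊓ V j ≤ V i) (s i) =
      res (inf_le_right : V i ⊓ V j ≤ V j) (s j)) →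
    ∃! t : sec (iSup V), ∀ i, res (le_iSup V i) t = s i

namespace LieAlgebroid

open LieRinehart

attribute [instance] lieRing lieAlgebra module anchor lieRinehartRing lieRinehartAlgebra

variable {K : Type u} [Field K] {X : TopCat.{u}} {O : X.Sheaf (CommAlgCat.{u} K)}

/-- Morphisms of Lie algebroids over `(X, O)`: morphisms of sheaves that are `O`-linear, compatible
with the brackets, and compatible with the anchors. -/
structure Hom (L' L : LieAlgebroid O) where
  /-- The map on sections over an open set. -/
  app : ∀ U, LieRinehartAlgebra.Hom (AlgHom.id K (OSec O U)) (L'.sec U) (L.sec U)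
  naturality : ∀ {U V : Opens X} (h : V ≤ U) (s : L'.sec U), L.res h (app U s) = app V (L'.res h s)

/-- `L` is locally free as an `O`-module, of arbitrary (possibly infinite, possibly varying) rank:
every point has an open neighbourhood `U` with a family `e` of sections over `U` such that the
morphism from the direct sum of copies of the structure sheaf of `U` to `L` restricted to `U` given
by `e` is an isomorphism of sheaves. Injectivity is spelled out as linear independence over every
open `V ⊆ U`, surjectivity as every section being locally a finite linear combination. -/
def IsLocallyFree (L : LieAlgebroid O) : Prop :=
  ∀ x : X, ∃ U : Opens X, x ∈ U ∧ ∃ (I : Type u) (e : I → L.sec U),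
    (∀ (V : Opens X) (h : V ≤ U), LinearIndependent (OSec O V) fun i => L.res h (e i)) ∧
    ∀ (V : Opens X) (h : V ≤ U) (s : L.sec V), ∀ y ∈ V, ∃ (W : Opens X) (h' : W ≤ V), y ∈ W ∧
      L.res h' s ∈ Submodule.span (OSec O W) (Set.range fun i => L.res (h'.trans h) (e i))

variable (L : LieAlgebroid O)

/-! ### The universal enveloping algebroid -/

/-- The presheaf `U ↦ U(O(U), L(U))` of universal enveloping algebras. -/
def envPresheaf : (Opens X)ᵒᵖ ⥤ AlgCat.{u} K where
  obj U := AlgCat.of K (Env K (OSec O U.unop) (L.sec U.unop))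
  map f := AlgCat.ofHom (Env.map (L.res (leOfHom f.unop)))
  map_id U := by
    refine AlgCat.hom_ext _ (Env.hom_ext (fun a => ?_) fun x => ?_)
    · exact (Env.map_ofA _ a).trans (congrArg _ (oRes_self O a))
    · exact (Env.map_ofL _ x).trans (congrArg _ (L.res_self x))
  map_comp {U V W} f g := by
    refine AlgCat.hom_ext _ (Env.hom_ext (fun a => ?_) fun x => ?_)
    · refine (Env.map_ofA _ a).trans ?_
      refine Eq.trans ?_ (congrArg (Env.map (L.res (leOfHom g.unop)))
        (Env.map_ofA (L.res (leOfHom f.unop)) a)).symm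
      refine Eq.trans ?_ (Env.map_ofA _ _).symm
      exact congrArg _ (oRes_oRes O (leOfHom f.unop) (leOfHom g.unop) a).symm
    · refine (Env.map_ofL _ x).trans ?_
      refine Eq.trans ?_ (congrArg (Env.map (L.res (leOfHom g.unop)))
        (Env.map_ofL (L.res (leOfHom f.unop)) x)).symm
      refine Eq.trans ?_ (Env.map_ofL _ _).symm
      exact congrArg _ (L.res_res (leOfHom f.unop) (leOfHom g.unop) x).symm

/-- The universal enveloping algebroid of `L`. -/
def env : X.Sheaf (AlgCat.{u} K) := sheafifyAlg L.envPresheaf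

/-- Sections of the universal enveloping algebroid. -/
abbrev EnvSec (U : Opens X) : Type u := L.env.obj.obj (op U)

/-- The canonical map `O → U(O, L)`. -/
def envO (U : Opens X) : OSec O U →ₐ[K] L.EnvSec U :=
  ((toSheafAlg L.envPresheaf).app (op U)).hom.comp (Env.ofA K (OSec O U) (L.sec U))

/-- The canonical map `L → U(O, L)`. -/
def envι (U : Opens X) : L.sec U →ₗ[K] L.EnvSec U :=
  ((toSheafAlg L.envPresheaf).app (op U)).hom.toLinearMap.comp (Env.ofL K (OSec O U) (L.sec U))

theorem envι_smul {U : Opens X} (f : OSec O U) (D : L.sec U) :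
    L.envι U (f • D) = L.envO U f * L.envι U D := by
  refine Eq.trans (congrArg ((toSheafAlg L.envPresheaf).app (op U)).hom
    (Env.ofL_smul K (OSec O U) (L.sec U) f D)) (map_mul _ _ _)

theorem envι_mul_envO {U : Opens X} (D : L.sec U) (f : OSec O U) :
    L.envι U D * L.envO U f = L.envO U f * L.envι U D + L.envO U ⁅D, f⁆ := by
  have h := congrArg ((toSheafAlg L.envPresheaf).app (op U)).hom
    (Env.ofA_lie K (OSec O U) (L.sec U) D f)
  have h' : L.envO U ⁅D, f⁆ = L.envι U D * L.envO U f - L.envO U f * L.envι U D :=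
    h.trans ((map_sub _ _ _).trans (congrArg₂ _ (map_mul _ _ _) (map_mul _ _ _)))
  rw [h']
  abel

theorem algRes_envO {U V : Opens X} (h : V ≤ U) (f : OSec O U) :
    algRes L.env.obj h (L.envO U f) = L.envO V (oRes O h f) :=
  (algRes_naturality (toSheafAlg L.envPresheaf) h _).trans
    (congrArg ((toSheafAlg L.envPresheaf).app (op V)).hom (Env.map_ofA (L.res h) f))

theorem algRes_envι {U V : Opens X} (h : V ≤ U) (D : L.sec U) :
    algRes L.env.obj h (L.envι U D) = L.envι V (L.res h D) :=
  (algRes_naturality (toSheafAlg L.envPresheaf) h _).trans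
    (congrArg ((toSheafAlg L.envPresheaf).app (op V)).hom (Env.map_ofL (L.res h) D))

/-- The span of the sections `f D₁ ⋯ Dₘ` with `m ≤ n`. -/
def envSpan (n : ℕ) (U : Opens X) : Submodule K (L.EnvSec U) :=
  Submodule.span K {z | ∃ (f : OSec O U) (l : List (L.sec U)), l.length ≤ n ∧
    z = L.envO U f * (l.map (L.envι U)).prod}

theorem algRes_mem_envSpan {n : ℕ} {U V : Opens X} (h : V ≤ U) {s : L.EnvSec U}
    (hs : s ∈ L.envSpan n U) : algRes L.env.obj h s ∈ L.envSpan n V := by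
  induction hs using Submodule.span_induction with
  | mem z hz =>
    obtain ⟨f, l, hl, rfl⟩ := hz
    refine Submodule.subset_span ⟨oRes O h f, l.map (L.res h), by simpa using hl, ?_⟩
    rw [map_mul, algRes_envO, map_list_prod, List.map_map, List.map_map]
    congr 2
    exact List.map_congr_left fun D _ => L.algRes_envι h D
  | zero => rw [map_zero]; exact zero_mem _
  | add a b _ _ ha hb => rw [map_add]; exact add_mem ha hb
  | smul k a _ ha => rw [map_smul]; exact Submodule.smul_mem _ _ ha

theorem envSpan_mono {m n : ℕ} (h : m ≤ n) (U : Opens X) : L.envSpan m U ≤ L.envSpan n U :=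
  Submodule.span_mono fun _ ⟨f, l, hl, hz⟩ => ⟨f, l, hl.trans h, hz⟩

theorem envO_mul_mem_envSpan {n : ℕ} {U : Opens X} (f : OSec O U) {s : L.EnvSec U}
    (hs : s ∈ L.envSpan n U) : L.envO U f * s ∈ L.envSpan n U := by
  induction hs using Submodule.span_induction with
  | mem z hz =>
    obtain ⟨g, l, hl, rfl⟩ := hz
    refine Submodule.subset_span ⟨f * g, l, hl, ?_⟩
    rw [map_mul, mul_assoc]
  | zero => rw [mul_zero]; exact zero_mem _
  | add a b _ _ ha hb => rw [mul_add]; exact add_mem ha hb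
  | smul k a _ ha => rw [mul_smul_comm]; exact Submodule.smul_mem _ _ ha

theorem envι_mul_mem_envSpan {n : ℕ} {U : Opens X} (D : L.sec U) {s : L.EnvSec U}
    (hs : s ∈ L.envSpan n U) : L.envι U D * s ∈ L.envSpan (n + 1) U := by
  induction hs using Submodule.span_induction with
  | mem z hz =>
    obtain ⟨g, l, hl, rfl⟩ := hz
    rw [← mul_assoc, envι_mul_envO, add_mul]
    refine add_mem (Submodule.subset_span ⟨g, D :: l, by simpa using hl, ?_⟩)
      (Submodule.subset_span ⟨⁅D, g⁆, l, by omega, rfl⟩)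
    rw [List.map_cons, List.prod_cons, mul_assoc]
  | zero => rw [mul_zero]; exact zero_mem _
  | add a b _ _ ha hb => rw [mul_add]; exact add_mem ha hb
  | smul k a _ ha => rw [mul_smul_comm]; exact Submodule.smul_mem _ _ ha

theorem mul_mem_envSpan {m n : ℕ} {U : Opens X} {s t : L.EnvSec U}
    (hs : s ∈ L.envSpan m U) (ht : t ∈ L.envSpan n U) : s * t ∈ L.envSpan (m + n) U := by
  have key : ∀ l : List (L.sec U),
      (l.map (L.envι U)).prod * t ∈ L.envSpan (l.length + n) U := by
    intro l
    induction l with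
    | nil => simpa using ht
    | cons D l ih =>
      rw [List.map_cons, List.prod_cons, mul_assoc]
      exact L.envSpan_mono (by simp only [List.length_cons]; omega) U
        (L.envι_mul_mem_envSpan D ih)
  induction hs using Submodule.span_induction with
  | mem z hz =>
    obtain ⟨g, l, hl, rfl⟩ := hz
    rw [mul_assoc]
    exact L.envO_mul_mem_envSpan g (L.envSpan_mono (by omega) U (key l))
  | zero => rw [zero_mul]; exact zero_mem _
  | add a b _ _ ha hb => rw [add_mul]; exact add_mem ha hb
  | smul k a _ ha => rw [smul_mul_assoc]; exact Submodule.smul_mem _ _ ha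

/-- The canonical filtration of the universal enveloping algebroid: the `n`-th step consists of the
sections that are locally in the span of the `f D₁ ⋯ Dₘ` with `m ≤ n`. -/
def envFil (U : Opens X) : AlgFiltration K (L.EnvSec U) where
  step n :=
    { carrier := {s | LocallyMem L.env.obj (L.envSpan n) s}
      zero_mem' := fun x hx => ⟨U, le_rfl, hx, by rw [map_zero]; exact zero_mem _⟩
      add_mem' := fun {a b} ha hb x hx => by
        obtain ⟨V, hV, hxV, haV⟩ := ha x hx
        obtain ⟨W, hW, hxW, hbW⟩ := hb x hx
        refine ⟨V ⊓ W, inf_le_left.trans hV, ⟨hxV, hxW⟩, ?_⟩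
        rw [map_add]
        refine add_mem ?_ ?_
        · rw [← algRes_algRes _ hV inf_le_left]
          exact L.algRes_mem_envSpan _ haV
        · rw [← algRes_algRes _ hW inf_le_right]
          exact L.algRes_mem_envSpan _ hbW
      smul_mem' := fun k a ha x hx => by
        obtain ⟨V, hV, hxV, haV⟩ := ha x hx
        exact ⟨V, hV, hxV, by rw [map_smul]; exact Submodule.smul_mem _ _ haV⟩ }
  mono n s hs x hx := by
    obtain ⟨V, hV, hxV, hsV⟩ := hs x hx
    exact ⟨V, hV, hxV, L.envSpan_mono (Nat.le_succ n) V hsV⟩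
  one_mem x hx := ⟨U, le_rfl, hx, by
    rw [map_one]
    exact Submodule.subset_span ⟨1, [], le_rfl, by simp⟩⟩
  mul_mem {m n a b} ha hb x hx := by
    obtain ⟨V, hV, hxV, haV⟩ := ha x hx
    obtain ⟨W, hW, hxW, hbW⟩ := hb x hx
    refine ⟨V ⊓ W, inf_le_left.trans hV, ⟨hxV, hxW⟩, ?_⟩
    rw [map_mul]
    refine L.mul_mem_envSpan ?_ ?_
    · rw [← algRes_algRes _ hV inf_le_left]
      exact L.algRes_mem_envSpan _ haV
    · rw [← algRes_algRes _ hW inf_le_right]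
      exact L.algRes_mem_envSpan _ hbW

theorem mem_envFil {n : ℕ} {U : Opens X} {s : L.EnvSec U} :
    s ∈ (L.envFil U).step n ↔ LocallyMem L.env.obj (L.envSpan n) s := Iff.rfl

theorem mem_envFil_of_mem_envSpan {n : ℕ} {U : Opens X} {s : L.EnvSec U}
    (hs : s ∈ L.envSpan n U) : s ∈ (L.envFil U).step n :=
  fun _ hx => ⟨U, le_rfl, hx, L.algRes_mem_envSpan le_rfl hs⟩

theorem algRes_mem_envFil {n : ℕ} {U V : Opens X} (h : V ≤ U) {s : L.EnvSec U}
    (hs : s ∈ (L.envFil U).step n) : algRes L.env.obj h s ∈ (L.envFil V).step n := by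
  intro x hx
  obtain ⟨W, hW, hxW, hsW⟩ := hs x (h hx)
  refine ⟨V ⊓ W, inf_le_left, ⟨hx, hxW⟩, ?_⟩
  rw [algRes_algRes, ← algRes_algRes _ hW inf_le_right]
  exact L.algRes_mem_envSpan _ hsW

theorem envO_mem_envFil {U : Opens X} (f : OSec O U) : L.envO U f ∈ (L.envFil U).step 0 :=
  L.mem_envFil_of_mem_envSpan (Submodule.subset_span ⟨f, [], le_rfl, by simp⟩)

theorem prod_envι_mem_envFil {U : Opens X} (l : List (L.sec U)) :
    (l.map (L.envι U)).prod ∈ (L.envFil U).step l.length :=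
  L.mem_envFil_of_mem_envSpan (Submodule.subset_span ⟨1, l, le_rfl, by simp⟩)

theorem envι_mem_envFil {U : Opens X} (D : L.sec U) : L.envι U D ∈ (L.envFil U).step 1 := by
  simpa using L.prod_envι_mem_envFil [D]

/-! ### The associated graded sheaf -/

/-- The presheaf `U ↦ ⨁ₙ Uₙ(U) / Uₙ₋₁(U)`. -/
def grPresheaf : (Opens X)ᵒᵖ ⥤ AlgCat.{u} K where
  obj U := AlgCat.of K (L.envFil U.unop).Gr
  map f := AlgCat.ofHom (AlgFiltration.grMap _ _ (algRes L.env.obj (leOfHom f.unop))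
    fun _ _ => L.algRes_mem_envFil _)
  map_id U := by
    refine AlgCat.hom_ext _ (AlgFiltration.gr_hom_ext fun n a => ?_)
    refine (AlgFiltration.grMap_cls _ _ _ _ n a).trans ?_
    exact congrArg ((L.envFil U.unop).cls n) (Subtype.ext (algRes_self L.env.obj a.1))
  map_comp {U V W} f g := by
    refine AlgCat.hom_ext _ (AlgFiltration.gr_hom_ext fun n a => ?_)
    refine (AlgFiltration.grMap_cls _ _ _ _ n a).trans ?_
    refine Eq.trans ?_ (congrArg (AlgFiltration.grMap _ _ (algRes L.env.obj (leOfHom g.unop))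
      fun _ _ => L.algRes_mem_envFil _) (AlgFiltration.grMap_cls _ _ _ _ n a)).symm
    refine Eq.trans ?_ (AlgFiltration.grMap_cls _ _ _ _ n _).symm
    exact congrArg ((L.envFil W.unop).cls n)
      (Subtype.ext (algRes_algRes L.env.obj (leOfHom f.unop) (leOfHom g.unop) a.1).symm)

/-- The sheaf of graded algebras `gr U(O, L)`, the direct sum of the quotient sheaves
`Uₙ / Uₙ₋₁`. -/
def gr : X.Sheaf (AlgCat.{u} K) := sheafifyAlg L.grPresheaf

/-- Sections of `gr U(O, L)`. -/
abbrev GrSec (U : Opens X) : Type u := L.gr.obj.obj (op U)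

/-- The canonical map `Uₙ → Uₙ / Uₙ₋₁ → gr U(O, L)`. -/
def symbol (n : ℕ) (U : Opens X) : (L.envFil U).step n →ₗ[K] L.GrSec U :=
  ((toSheafAlg L.grPresheaf).app (op U)).hom.toLinearMap.comp ((L.envFil U).cls n)

/-- The structure map `O → gr U(O, L)`. -/
def grO (U : Opens X) (f : OSec O U) : L.GrSec U := L.symbol 0 U ⟨L.envO U f, L.envO_mem_envFil f⟩

/-- The homogeneous sections of degree `n` of `gr U(O, L)`, forming the subsheaf
`Uₙ / Uₙ₋₁`. -/
def IsGrHomogeneous (n : ℕ) {U : Opens X} (s : L.GrSec U) : Prop :=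
  LocallyMem L.gr.obj (fun V => LinearMap.range (L.symbol n V)) s

/-! ### The symmetric algebra -/

/-- The restriction map of `L` as a semilinear map. -/
def resSemi {U V : Opens X} (h : V ≤ U) : L.sec U →ₛₗ[(oRes O h).toRingHom] L.sec V :=
  (L.res h).toLinearMap'

/-- The presheaf `U ↦ Sym (L(U))` of symmetric algebras over `O(U)`. -/
def symPresheaf : (Opens X)ᵒᵖ ⥤ AlgCat.{u} K where
  obj U := AlgCat.of K (SymmetricAlgebra (OSec O U.unop) (L.sec U.unop))
  map f := AlgCat.ofHom (SymmetricAlgebra.mapSemi _ (L.resSemi (leOfHom f.unop)))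
  map_id U := by
    refine AlgCat.hom_ext _ (SymmetricAlgebra.algHom_ext_base (fun a => ?_) fun x => ?_)
    · exact (SymmetricAlgebra.mapSemi_algebraMap _ _ a).trans (congrArg _ (oRes_self O a))
    · exact (SymmetricAlgebra.mapSemi_ι _ _ x).trans (congrArg _ (L.res_self x))
  map_comp {U V W} f g := by
    refine AlgCat.hom_ext _ (SymmetricAlgebra.algHom_ext_base (fun a => ?_) fun x => ?_)
    · refine (SymmetricAlgebra.mapSemi_algebraMap _ _ a).trans ?_
      refine Eq.trans ?_ (congrArg (SymmetricAlgebra.mapSemi _ (L.resSemi (leOfHom g.unop)))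
        (SymmetricAlgebra.mapSemi_algebraMap _ (L.resSemi (leOfHom f.unop)) a)).symm
      refine Eq.trans ?_ (SymmetricAlgebra.mapSemi_algebraMap _ _ _).symm
      exact congrArg _ (oRes_oRes O (leOfHom f.unop) (leOfHom g.unop) a).symm
    · refine (SymmetricAlgebra.mapSemi_ι _ _ x).trans ?_
      refine Eq.trans ?_ (congrArg (SymmetricAlgebra.mapSemi _ (L.resSemi (leOfHom g.unop)))
        (SymmetricAlgebra.mapSemi_ι _ (L.resSemi (leOfHom f.unop)) x)).symm
      refine Eq.trans ?_ (SymmetricAlgebra.mapSemi_ι _ _ _).symm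
      exact congrArg _ (L.res_res (leOfHom f.unop) (leOfHom g.unop) x).symm

/-- The symmetric algebra of the `O`-module `L`, a sheaf of algebras. -/
def sym : X.Sheaf (AlgCat.{u} K) := sheafifyAlg L.symPresheaf

/-- Sections of the symmetric algebra. -/
abbrev SymSec (U : Opens X) : Type u := L.sym.obj.obj (op U)

/-- The canonical map `Sym (L(U)) → (Sym L)(U)`. -/
def toSym (U : Opens X) : SymmetricAlgebra (OSec O U) (L.sec U) →ₐ[K] L.SymSec U :=
  ((toSheafAlg L.symPresheaf).app (op U)).hom

/-- The structure map `O → Sym L`. -/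
def symO (U : Opens X) (f : OSec O U) : L.SymSec U := L.toSym U (algebraMap _ _ f)

/-- The `n`-th symmetric power of `L(U)` inside the symmetric algebra. -/
def symPow (n : ℕ) (U : Opens X) : Submodule K (SymmetricAlgebra (OSec O U) (L.sec U)) :=
  (LinearMap.range (SymmetricAlgebra.ι (OSec O U) (L.sec U)) ^ n).restrictScalars K

/-- The homogeneous sections of degree `n` of the symmetric algebra, forming the subsheaf
`Symⁿ L`. -/
def IsSymHomogeneous (n : ℕ) {U : Opens X} (s : L.SymSec U) : Prop :=
  LocallyMem L.sym.obj (fun V => (L.symPow n V).map (L.toSym V).toLinearMap) s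

/-! ### The PBW isomorphism -/

/-- The symmetrization `(1 / k!) ∑_σ D_{σ(1)} ⋯ D_{σ(k)}` in the universal enveloping algebroid. -/
def symmetrization {U : Opens X} {k : ℕ} (D : Fin k → L.sec U) : L.EnvSec U :=
  ((k.factorial : K)⁻¹) •
    ∑ σ : Equiv.Perm (Fin k), (List.ofFn fun i => L.envι U (D (σ i))).prod

theorem symmetrization_mem_envFil {U : Opens X} {k : ℕ} (D : Fin k → L.sec U) :
    L.symmetrization D ∈ (L.envFil U).step k := by
  refine Submodule.smul_mem _ _ (Submodule.sum_mem _ fun σ _ => ?_)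
  have h := L.prod_envι_mem_envFil (List.ofFn fun i => D (σ i))
  rw [List.length_ofFn, List.map_ofFn] at h
  exact h

/-- `ψ : gr U(O, L) ≅ Sym L` is the PBW isomorphism: an isomorphism of sheaves of graded
`O`-algebras whose inverse is the symmetrization map, sending `D₁ ⋯ Dₖ` to the class in
`Uₖ / Uₖ₋₁` of `(1 / k!) ∑_σ D_{σ(1)} ⋯ D_{σ(k)}`. -/
structure IsPBW (ψ : L.gr ≅ L.sym) : Prop where
  map_structure : ∀ (U : Opens X) (f : OSec O U),
    (ψ.hom.hom.app (op U)).hom (L.grO U f) = L.symO U f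
  homogeneous : ∀ (n : ℕ) (U : Opens X) (s : L.GrSec U),
    L.IsSymHomogeneous n ((ψ.hom.hom.app (op U)).hom s) ↔ L.IsGrHomogeneous n s
  inv_prod : ∀ (U : Opens X) (k : ℕ) (D : Fin k → L.sec U),
    (ψ.inv.hom.app (op U)).hom (L.toSym U (∏ i, SymmetricAlgebra.ι _ _ (D i))) =
      L.symbol k U ⟨L.symmetrization D, L.symmetrization_mem_envFil D⟩

/-! ### Functoriality -/

namespace Hom

variable {L} {L' : LieAlgebroid O} (φ : L'.Hom L)

/-- The morphism of presheaves of universal enveloping algebras induced by `φ`. -/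
def envPresheafMap : L'.envPresheaf ⟶ L.envPresheaf where
  app U := AlgCat.ofHom (Env.map (φ.app U.unop))
  naturality {U V} f := by
    refine AlgCat.hom_ext _ (Env.hom_ext (fun a => ?_) fun x => ?_)
    · refine (congrArg (Env.map (φ.app V.unop))
        (Env.map_ofA (L'.res (leOfHom f.unop)) a)).trans ?_
      refine Eq.trans ?_ (congrArg (Env.map (L.res (leOfHom f.unop)))
        (Env.map_ofA (φ.app U.unop) a)).symm
      exact (Env.map_ofA (φ.app V.unop) _).trans
        (Env.map_ofA (L.res (leOfHom f.unop)) a).symm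
    · refine (congrArg (Env.map (φ.app V.unop))
        (Env.map_ofL (L'.res (leOfHom f.unop)) x)).trans ?_
      refine Eq.trans ?_ (congrArg (Env.map (L.res (leOfHom f.unop)))
        (Env.map_ofL (φ.app U.unop) x)).symm
      refine (Env.map_ofL _ _).trans (Eq.trans ?_ (Env.map_ofL _ _).symm)
      exact congrArg _ (φ.naturality (leOfHom f.unop) x).symm

/-- The morphism `U(φ) : U(O, L') → U(O, L)`. -/
def env : L'.env ⟶ L.env := sheafifyAlgMap φ.envPresheafMap

/-- `U(φ)` on sections. -/
def envApp (U : Opens X) : L'.EnvSec U →ₐ[K] L.EnvSec U := (φ.env.hom.app (op U)).hom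

theorem envApp_envO {U : Opens X} (f : OSec O U) : φ.envApp U (L'.envO U f) = L.envO U f :=
  (toSheafAlg_naturality φ.envPresheafMap _).trans
    (congrArg ((toSheafAlg L.envPresheaf).app (op U)).hom (Env.map_ofA (φ.app U) f))

theorem envApp_envι {U : Opens X} (D : L'.sec U) :
    φ.envApp U (L'.envι U D) = L.envι U (φ.app U D) :=
  (toSheafAlg_naturality φ.envPresheafMap _).trans
    (congrArg ((toSheafAlg L.envPresheaf).app (op U)).hom (Env.map_ofL (φ.app U) D))

theorem algRes_envApp {U V : Opens X} (h : V ≤ U) (s : L'.EnvSec U) :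
    algRes L.env.obj h (φ.envApp U s) = φ.envApp V (algRes L'.env.obj h s) :=
  algRes_naturality φ.env.hom h s

theorem envApp_mem_envSpan {n : ℕ} {U : Opens X} {s : L'.EnvSec U} (hs : s ∈ L'.envSpan n U) :
    φ.envApp U s ∈ L.envSpan n U := by
  induction hs using Submodule.span_induction with
  | mem z hz =>
    obtain ⟨f, l, hl, rfl⟩ := hz
    refine Submodule.subset_span ⟨f, l.map (φ.app U), by simpa using hl, ?_⟩
    rw [map_mul, envApp_envO, map_list_prod, List.map_map, List.map_map]
    congr 2
    exact List.map_congr_left fun D _ => φ.envApp_envι D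
  | zero => rw [map_zero]; exact zero_mem _
  | add a b _ _ ha hb => rw [map_add]; exact add_mem ha hb
  | smul k a _ ha => rw [map_smul]; exact Submodule.smul_mem _ _ ha

theorem envApp_mem_envFil (U : Opens X) (n : ℕ) (s : L'.EnvSec U)
    (hs : s ∈ (L'.envFil U).step n) : φ.envApp U s ∈ (L.envFil U).step n := by
  intro x hx
  obtain ⟨V, hV, hxV, hsV⟩ := hs x hx
  refine ⟨V, hV, hxV, ?_⟩
  rw [algRes_envApp]
  exact φ.envApp_mem_envSpan hsV

/-- The morphism of presheaves of graded algebras induced by `U(φ)`. -/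
def grPresheafMap : L'.grPresheaf ⟶ L.grPresheaf where
  app U := AlgCat.ofHom (AlgFiltration.grMap _ _ (φ.envApp U.unop) (φ.envApp_mem_envFil U.unop))
  naturality {U V} f := by
    refine AlgCat.hom_ext _ (AlgFiltration.gr_hom_ext fun n a => ?_)
    refine (congrArg (AlgFiltration.grMap _ _ (φ.envApp V.unop) (φ.envApp_mem_envFil V.unop))
      (AlgFiltration.grMap_cls _ _ _ _ n a)).trans ?_
    refine Eq.trans ?_ (congrArg (AlgFiltration.grMap _ _ (algRes L.env.obj (leOfHom f.unop))
      fun _ _ => L.algRes_mem_envFil _) (AlgFiltration.grMap_cls _ _ _ _ n a)).symm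
    refine (AlgFiltration.grMap_cls _ _ _ _ n _).trans
      (Eq.trans ?_ (AlgFiltration.grMap_cls _ _ _ _ n _).symm)
    exact congrArg ((L.envFil V.unop).cls n)
      (Subtype.ext (φ.algRes_envApp (leOfHom f.unop) a.1).symm)

/-- The morphism `gr U(φ) : gr U(O, L') → gr U(O, L)`. -/
def gr : L'.gr ⟶ L.gr := sheafifyAlgMap φ.grPresheafMap

/-- `φ` on sections as a linear map. -/
def appSemi (U : Opens X) :
    L'.sec U →ₛₗ[(AlgHom.id K (OSec O U)).toRingHom] L.sec U :=
  (φ.app U).toLinearMap'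

/-- The morphism of presheaves of symmetric algebras induced by `φ`. -/
def symPresheafMap : L'.symPresheaf ⟶ L.symPresheaf where
  app U := AlgCat.ofHom (SymmetricAlgebra.mapSemi _ (φ.appSemi U.unop))
  naturality {U V} f := by
    refine AlgCat.hom_ext _ (SymmetricAlgebra.algHom_ext_base (fun a => ?_) fun x => ?_)
    · refine (congrArg (SymmetricAlgebra.mapSemi _ (φ.appSemi V.unop))
        (SymmetricAlgebra.mapSemi_algebraMap _ (L'.resSemi (leOfHom f.unop)) a)).trans ?_
      refine Eq.trans ?_ (congrArg (SymmetricAlgebra.mapSemi _ (L.resSemi (leOfHom f.unop)))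
        (SymmetricAlgebra.mapSemi_algebraMap _ (φ.appSemi U.unop) a)).symm
      exact (SymmetricAlgebra.mapSemi_algebraMap _ (φ.appSemi V.unop) _).trans
        (SymmetricAlgebra.mapSemi_algebraMap _ (L.resSemi (leOfHom f.unop)) a).symm
    · refine (congrArg (SymmetricAlgebra.mapSemi _ (φ.appSemi V.unop))
        (SymmetricAlgebra.mapSemi_ι _ (L'.resSemi (leOfHom f.unop)) x)).trans ?_
      refine Eq.trans ?_ (congrArg (SymmetricAlgebra.mapSemi _ (L.resSemi (leOfHom f.unop)))
        (SymmetricAlgebra.mapSemi_ι _ (φ.appSemi U.unop) x)).symm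
      refine (SymmetricAlgebra.mapSemi_ι _ (φ.appSemi V.unop) _).trans
        (Eq.trans ?_ (SymmetricAlgebra.mapSemi_ι _ (L.resSemi (leOfHom f.unop)) _).symm)
      exact congrArg _ (φ.naturality (leOfHom f.unop) x).symm

/-- The morphism `Sym φ : Sym L' → Sym L`. -/
def sym : L'.sym ⟶ L.sym := sheafifyAlgMap φ.symPresheafMap

end Hom

end LieAlgebroid

end

/-! The inverse of the PBW isomorphism is built first. In `gr` the classes of functions (degree 0)
and of sections (degree 1) commute, because their commutators `⁅D, f⁆` and `⁅D, E⁆` lie one step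
lower in the filtration. The universal property of the symmetric algebra therefore gives a morphism
of presheaves `symToGrPresheaf` from `Sym` to `gr`. It sends `D₁ ⋯ Dₖ` to the class of the product
in any order, hence also to the class of the average over all orders. Sheafification turns a locally
bijective morphism into an isomorphism (`isIso_sheafifyAlgMap`), so local surjectivity and local
injectivity remain. The first holds because the filtration is locally spanned by products.

Local injectivity is the substance and is checked at a point `x`. The stalk of `L` is a Lie–Rinehart
algebra over the stalk `A` of `O`, free on the germs of a local frame (`exists_basis_stalk`). For a
free Lie–Rinehart algebra, `L` is made to act on the polynomial ring over `A` in the basis so that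
`D` acts as multiplication by the linear form of `D` plus terms that do not raise the degree. The
action is forced by ordering the basis, and `respectsLie_mem` verifies compatibility with brackets
by induction on the degree, the Jacobi identity closing the last case. Applying the enveloping
algebra to the polynomial `1` recovers the leading term of every product
(`exists_principal_symbol`).

If the symmetrization of `t` vanishes, each homogeneous part of `t` lifts to an element of the
enveloping algebra lying in a lower filtration step. Its leading polynomial is then both homogeneous
of degree `n` and of degree less than `n`, hence zero (`polyGerm_eq_zero_of_symToGr_eq_zero`). Near
`x` the element `t` is a polynomial in the frame with finitely many coefficients, whose germs now
vanish; so `t` vanishes on a neighbourhood.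

Uniqueness and compatibility with `φ` are comparisons of algebra homomorphisms on generators.
Injectivity of `ι` is local injectivity in degree one, together with separatedness of `L`. -/

noncomputable section

/-! ## The action of a free Lie–Rinehart algebra on polynomials -/

namespace LieRinehart

open MvPolynomial Module

/-! ### Polynomials of bounded degree. -/

section degLT

variable (I A : Type*) [CommRing A]

/-- The polynomials of total degree smaller than `n`. -/
def degLT (n : ℕ) : Submodule A (MvPolynomial I A) :=
  Submodule.span A ((fun w => monomial w (1 : A)) '' {w | w.degree < n})

variable {I A}

theorem monomial_mem_degLT {n : ℕ} {w : I →₀ ℕ} (h : w.degree < n) (a : A) :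
    monomial w a ∈ degLT I A n := by
  have : monomial w a = a • monomial w (1 : A) := by rw [smul_monomial, smul_eq_mul, mul_one]
  rw [this]
  exact Submodule.smul_mem _ _ (Submodule.subset_span ⟨w, h, rfl⟩)

theorem degLT_mono {m n : ℕ} (h : m ≤ n) : degLT I A m ≤ degLT I A n :=
  Submodule.span_mono (Set.image_mono fun _ hw => lt_of_lt_of_le hw h)

/-- The strict bound matches the filtration: `degLT n` corresponds to the step before the `n`-th
one, which is also trivial for `n = 0`. -/
theorem degLT_zero : degLT I A 0 = ⊥ := by
  simp [degLT]

theorem coeff_eq_zero_of_mem_degLT {n : ℕ} {p : MvPolynomial I A} (hp : p ∈ degLT I A n)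
    {w : I →₀ ℕ} (hw : n ≤ w.degree) : coeff w p = 0 := by
  induction hp using Submodule.span_induction with
  | mem z hz =>
    obtain ⟨v, hv, rfl⟩ := hz
    have : v ≠ w := by
      rintro rfl
      exact absurd hv (not_lt.2 hw)
    classical exact (coeff_monomial _ _ _).trans (if_neg this)
  | zero => simp
  | add p q _ _ hp hq => simp [hp, hq]
  | smul a p _ hp => simp [hp]

theorem exists_mem_degLT (p : MvPolynomial I A) : ∃ n, p ∈ degLT I A n := by
  induction p using MvPolynomial.induction_on' with
  | monomial w a => exact ⟨w.degree + 1, monomial_mem_degLT (Nat.lt_succ_self _) a⟩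
  | add p q hp hq =>
    obtain ⟨m, hm⟩ := hp
    obtain ⟨n, hn⟩ := hq
    exact ⟨max m n, add_mem (degLT_mono (le_max_left _ _) hm) (degLT_mono (le_max_right _ _) hn)⟩

theorem X_mul_mem_degLT {n : ℕ} (i : I) {p : MvPolynomial I A} (hp : p ∈ degLT I A n) :
    X i * p ∈ degLT I A (n + 1) := by
  induction hp using Submodule.span_induction with
  | mem z hz =>
    obtain ⟨v, hv, rfl⟩ := hz
    simp only [X, monomial_mul, mul_one]
    refine monomial_mem_degLT ?_ _
    have hv' : v.degree < n := hv
    rw [map_add, Finsupp.degree_single]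
    omega
  | zero => simp
  | add p q _ _ hp hq => rw [mul_add]; exact add_mem hp hq
  | smul a p _ hp => rw [mul_smul_comm]; exact Submodule.smul_mem _ _ hp

end degLT

/-! ### Construction of the action of a free Lie–Rinehart algebra on polynomials. -/

section Action

variable {I A L : Type*} [CommRing A] [LieRing L] [Module A L] [LieRingModule L A]
  [LieRinehartRing A L]

/-- The action of `L` on the coefficients of polynomials. -/
def coeffAct (I : Type*) {A L : Type*} [CommRing A] [LieRing L] [LieRingModule L A] :
    L →+ MvPolynomial I A →+ MvPolynomial I A :=
  AddMonoidHom.mk' (fun D =>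
    ((basisMonomials I A).repr.symm.toLinearMap.toAddMonoidHom.comp
      (Finsupp.mapRange.addMonoidHom (LieRingModule.toEnd L A D))).comp
        (basisMonomials I A).repr.toLinearMap.toAddMonoidHom) fun D E => by
    refine AddMonoidHom.ext fun p => ?_
    refine Eq.trans (congrArg (basisMonomials I A).repr.symm ?_)
      (map_add (basisMonomials I A).repr.symm _ _)
    ext w
    exact add_lie D E _

theorem repr_coeffAct (D : L) (p : MvPolynomial I A) :
    (basisMonomials I A).repr (coeffAct I D p) =
      Finsupp.mapRange (LieRingModule.toEnd L A D) (map_zero _) ((basisMonomials I A).repr p) :=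
  (basisMonomials I A).repr.apply_symm_apply _

theorem coeffAct_smul_monomial (D : L) (a : A) (w : I →₀ ℕ) :
    coeffAct I D (a • monomial w (1 : A)) = ⁅D, a⁆ • monomial w (1 : A) := by
  apply (basisMonomials I A).repr.injective
  rw [repr_coeffAct, map_smul, map_smul, ← congrFun (coe_basisMonomials I A) w, Basis.repr_self]
  simp

theorem lie_one_eq_zero (D : L) : ⁅D, (1 : A)⁆ = 0 := by
  have h := LieRinehartRing.leibniz_mul_right D (1 : A) 1
  simpa using h

theorem coeffAct_monomial_one (D : L) (w : I →₀ ℕ) :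
    coeffAct I D (monomial w (1 : A)) = 0 := by
  have := coeffAct_smul_monomial D (1 : A) w
  rwa [one_smul, lie_one_eq_zero, zero_smul] at this

theorem induction_smul_monomial {motive : MvPolynomial I A → Prop}
    (smul : ∀ (a : A) w, motive (a • monomial w (1 : A)))
    (add : ∀ p q, motive p → motive q → motive (p + q)) (p : MvPolynomial I A) : motive p := by
  induction p using MvPolynomial.induction_on' with
  | monomial w a =>
    have := smul a w
    rwa [smul_monomial, smul_eq_mul, mul_one] at this
  | add p q hp hq => exact add p q hp hq

theorem coeffAct_smul (D : L) (a : A) (p : MvPolynomial I A) :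
    coeffAct I D (a • p) = a • coeffAct I D p + ⁅D, a⁆ • p := by
  induction p using induction_smul_monomial with
  | smul f w =>
    rw [smul_smul, coeffAct_smul_monomial, coeffAct_smul_monomial,
      LieRinehartRing.leibniz_mul_right, smul_eq_mul, add_smul, mul_smul, mul_smul]
  | add p q hp hq => rw [smul_add, map_add, map_add, hp, hq, smul_add, smul_add]; abel

theorem smul_coeffAct (D : L) (a : A) (p : MvPolynomial I A) :
    coeffAct I (a • D) p = a • coeffAct I D p := by
  induction p using induction_smul_monomial with
  | smul f w =>
    rw [coeffAct_smul_monomial, coeffAct_smul_monomial, LieRinehartRing.lie_smul_eq_mul, mul_smul]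
  | add p q hp hq => rw [map_add, map_add, hp, hq, smul_add]

theorem coeffAct_mem_degLT (D : L) {n : ℕ} {p : MvPolynomial I A} (hp : p ∈ degLT I A n) :
    coeffAct I D p ∈ degLT I A n := by
  induction hp using Submodule.span_induction with
  | mem z hz =>
    obtain ⟨v, hv, rfl⟩ := hz
    dsimp only
    rw [coeffAct_monomial_one]
    exact zero_mem _
  | zero => rw [map_zero]; exact zero_mem _
  | add p q _ _ hp hq => rw [map_add]; exact add_mem hp hq
  | smul a p hp' hp =>
    rw [coeffAct_smul]
    exact add_mem (Submodule.smul_mem _ _ hp) (Submodule.smul_mem _ _ hp')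

theorem basis_induction (b : Basis I A L) {motive : L → Prop} (zero : motive 0)
    (basis : ∀ i, motive (b i)) (add : ∀ D E, motive D → motive E → motive (D + E))
    (smul : ∀ (a : A) D, motive D → motive (a • D)) (D : L) : motive D := by
  have hD : D ∈ Submodule.span A (Set.range b) := b.span_eq ▸ Submodule.mem_top
  induction hD using Submodule.span_induction with
  | mem z hz => obtain ⟨i, rfl⟩ := hz; exact basis i
  | zero => exact zero
  | add D E _ _ hD hE => exact add D E hD hE
  | smul a D _ hD => exact smul a D hD

variable [LinearOrder I] (b : Basis I A L)

/-- Sections of `L` as linear polynomials. -/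
def linPoly : L →ₗ[A] MvPolynomial I A := b.constr A X

@[simp]
theorem linPoly_basis (i : I) : linPoly b (b i) = X i := b.constr_basis A X i

theorem linPoly_mul_mem_degLT {n : ℕ} (D : L) {p : MvPolynomial I A} (hp : p ∈ degLT I A n) :
    linPoly b D * p ∈ degLT I A (n + 1) := by
  induction D using basis_induction b with
  | zero => simp
  | basis i => simpa using X_mul_mem_degLT i hp
  | add D E hD hE => rw [map_add, add_mul]; exact add_mem hD hE
  | smul a D hD => rw [map_smul, smul_mul_assoc]; exact Submodule.smul_mem _ _ hD

/-- One step of the recursion that defines the action of the basis vector `b i` on the monomial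
`w`, in terms of an approximation `t`. -/
def actStep (t : L →ₗ[A] MvPolynomial I A →ₗ[A] MvPolynomial I A) (i : I) (w : I →₀ ℕ) :
    MvPolynomial I A :=
  open Classical in
  X i * monomial w (1 : A) +
    -- The value is forced. Let `j` be the least variable of `w` and `j < i`. Then `w` is `b j`
    -- applied to `v`, so `b i · w` has to be `b j · (b i · v) + ⁅b i, b j⁆ · v`. Writing `b i · v =
    -- X i * v + r`, the vector `b j` multiplies `X i * v` by `X j`, which gives back `X i * w`. On
    -- `r` the action is its `A`-linear part `t` plus the action on coefficients.
    if h : ∃ j ∈ w.support, j < i then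
      let j := w.support.min' ⟨h.choose, h.choose_spec.1⟩
      let v := w - Finsupp.single j 1
      let r := t (b i) (monomial v 1) - X i * monomial v (1 : A)
      t (b j) r + coeffAct I (b j) r + t ⁅b i, b j⁆ (monomial v 1)
    else 0

/-- Approximations to the action, the `n`-th one being correct on polynomials of degree at most
`n`. -/
def actApprox : ℕ → L →ₗ[A] MvPolynomial I A →ₗ[A] MvPolynomial I A
  | 0 => (LinearMap.mul A (MvPolynomial I A)).comp (linPoly b)
  | n + 1 => b.constr A fun i => (basisMonomials I A).constr A fun w =>
      actStep b (actApprox n) i w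

theorem actApprox_zero (D : L) (p : MvPolynomial I A) : actApprox b 0 D p = linPoly b D * p := rfl

theorem actApprox_succ (n : ℕ) (i : I) (w : I →₀ ℕ) :
    actApprox b (n + 1) (b i) (monomial w 1) = actStep b (actApprox b n) i w := by
  rw [actApprox, Basis.constr_basis, ← congrFun (coe_basisMonomials I A) w, Basis.constr_basis]

/-- The error term is `A`-bilinear in `D` and `p` and `degLT` is an `A`-submodule, so an estimate on
basis vectors and monomials is enough. -/
theorem sub_mem_degLT_of_monomial {t : L →ₗ[A] MvPolynomial I A →ₗ[A] MvPolynomial I A}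
    (h : ∀ i w, t (b i) (monomial w 1) - X i * monomial w 1 ∈ degLT I A (w.degree + 1))
    {n : ℕ} (D : L) {p : MvPolynomial I A} (hp : p ∈ degLT I A n) :
    t D p - linPoly b D * p ∈ degLT I A n := by
  induction hp using Submodule.span_induction with
  | mem z hz =>
    obtain ⟨w, hw, rfl⟩ := hz
    refine degLT_mono (Nat.succ_le_of_lt hw) ?_
    induction D using basis_induction b with
    | zero => simp
    | basis i => simpa using h i w
    | add D E hD hE =>
      have := add_mem hD hE
      simp only [map_add, LinearMap.add_apply, add_mul]
      convert this using 1
      abel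
    | smul a D hD =>
      rw [map_smul, map_smul, smul_mul_assoc, LinearMap.smul_apply, ← smul_sub]
      exact Submodule.smul_mem _ _ hD
  | zero => simp
  | add p q _ _ hp hq =>
    rw [map_add, mul_add, add_sub_add_comm]
    exact add_mem hp hq
  | smul a p _ hp =>
    rw [map_smul, mul_smul_comm, ← smul_sub]
    exact Submodule.smul_mem _ _ hp

theorem mem_degLT_of_sub {n : ℕ} {D : L} {p q : MvPolynomial I A} (hp : p ∈ degLT I A n)
    (h : q - linPoly b D * p ∈ degLT I A n) : q ∈ degLT I A (n + 1) := by
  rw [← sub_add_cancel q (linPoly b D * p)]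
  exact add_mem (degLT_mono (Nat.le_succ n) h) (linPoly_mul_mem_degLT b D hp)

theorem degree_sub_single {w : I →₀ ℕ} {j : I} (hj : j ∈ w.support) :
    (w - Finsupp.single j 1).degree + 1 = w.degree := by
  have h : w - Finsupp.single j 1 + Finsupp.single j 1 = w :=
    tsub_add_cancel_of_le (Finsupp.single_le_iff.2
      (Nat.one_le_iff_ne_zero.2 (Finsupp.mem_support_iff.1 hj)))
  conv_rhs => rw [← h]
  rw [map_add, Finsupp.degree_single]

/-- Both `r` and `v` have degree below that of `w`, and a single application of `t` raises the
degree by at most one; no correction term exceeds the degree of `w`. -/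
theorem actStep_sub_mem {t : L →ₗ[A] MvPolynomial I A →ₗ[A] MvPolynomial I A}
    (h : ∀ i w, t (b i) (monomial w 1) - X i * monomial w 1 ∈ degLT I A (w.degree + 1))
    (i : I) (w : I →₀ ℕ) :
    actStep b t i w - X i * monomial w 1 ∈ degLT I A (w.degree + 1) := by
  rw [actStep, add_sub_cancel_left]
  split_ifs with hw
  · have hj := degree_sub_single (w.support.min'_mem ⟨hw.choose, hw.choose_spec.1⟩)
    set j := w.support.min' ⟨hw.choose, hw.choose_spec.1⟩
    dsimp only
    set v := w - Finsupp.single j 1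
    have hr := h i v
    rw [hj] at hr
    refine add_mem (add_mem ?_ ?_) ?_
    · exact mem_degLT_of_sub b hr (sub_mem_degLT_of_monomial b h _ hr)
    · exact degLT_mono (Nat.le_succ _) (coeffAct_mem_degLT _ hr)
    · have hv : monomial v (1 : A) ∈ degLT I A w.degree := monomial_mem_degLT (by omega) _
      exact mem_degLT_of_sub b hv (sub_mem_degLT_of_monomial b h _ hv)
  · exact zero_mem _

theorem actApprox_sub_mem_monomial (n : ℕ) (i : I) (w : I →₀ ℕ) :
    actApprox b n (b i) (monomial w 1) - X i * monomial w 1 ∈ degLT I A (w.degree + 1) := by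
  induction n generalizing i w with
  | zero => rw [actApprox_zero]; simp
  | succ n ih => rw [actApprox_succ]; exact actStep_sub_mem b ih i w

/-- The recursion is well founded: the step at `w` evaluates the approximation only on `r` and `v`,
of degree below that of `w`. -/
theorem actStep_congr {s t : L →ₗ[A] MvPolynomial I A →ₗ[A] MvPolynomial I A}
    (hs : ∀ i w, s (b i) (monomial w 1) - X i * monomial w 1 ∈ degLT I A (w.degree + 1))
    (i : I) (w : I →₀ ℕ) (h : ∀ D, ∀ p ∈ degLT I A w.degree, s D p = t D p) :
    actStep b s i w = actStep b t i w := by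
  rw [actStep, actStep]
  congr 1
  split_ifs with hw
  · have hj := degree_sub_single (w.support.min'_mem ⟨hw.choose, hw.choose_spec.1⟩)
    set j := w.support.min' ⟨hw.choose, hw.choose_spec.1⟩
    dsimp only
    set v := w - Finsupp.single j 1
    have hv : monomial v (1 : A) ∈ degLT I A w.degree := monomial_mem_degLT (by omega) _
    have hr := hs i v
    rw [hj] at hr
    rw [h _ _ hr, h _ _ hv, h _ _ hv]
  · rfl

theorem eq_of_monomial {s t : L →ₗ[A] MvPolynomial I A →ₗ[A] MvPolynomial I A} {n : ℕ}
    (h : ∀ i w, w.degree < n → s (b i) (monomial w 1) = t (b i) (monomial w 1)) (D : L)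
    {p : MvPolynomial I A} (hp : p ∈ degLT I A n) : s D p = t D p := by
  induction hp using Submodule.span_induction with
  | mem z hz =>
    obtain ⟨w, hw, rfl⟩ := hz
    induction D using basis_induction b with
    | zero => simp
    | basis i => exact h i w hw
    | add D E hD hE => rw [map_add, map_add, LinearMap.add_apply, LinearMap.add_apply, hD, hE]
    | smul a D hD => rw [map_smul, map_smul, LinearMap.smul_apply, LinearMap.smul_apply, hD]
  | zero => simp
  | add p q _ _ hp hq => rw [map_add, map_add, hp, hq]
  | smul a p _ hp => rw [map_smul, map_smul, hp]

/-- The approximations stabilize degree by degree, since each step looks only at smaller degrees. In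
degree zero a monomial has no variables, so no correction occurs. -/
theorem actApprox_succ_eq (n : ℕ) (D : L) {p : MvPolynomial I A} (hp : p ∈ degLT I A (n + 1)) :
    actApprox b (n + 1) D p = actApprox b n D p := by
  induction n generalizing D p with
  | zero =>
    refine eq_of_monomial b (fun i w hw => ?_) D hp
    rw [actApprox_succ, actApprox_zero, linPoly_basis, actStep, dif_neg, add_zero]
    rintro ⟨j, hj, -⟩
    have := degree_sub_single hj
    omega
  | succ n ih =>
    refine eq_of_monomial b (fun i w hw => ?_) D hp
    rw [actApprox_succ, actApprox_succ]
    exact actStep_congr b (actApprox_sub_mem_monomial b _) i w fun D p hp =>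
      ih D (degLT_mono (Nat.le_of_lt_succ hw) hp)

theorem actApprox_eq_of_le {m n : ℕ} (h : m ≤ n) (D : L) {p : MvPolynomial I A}
    (hp : p ∈ degLT I A (m + 1)) : actApprox b n D p = actApprox b m D p := by
  induction n, h using Nat.le_induction with
  | base => rfl
  | succ n hmn ih => rw [actApprox_succ_eq b n D (degLT_mono (by omega) hp), ih]

/-- The `A`-bilinear part of the action of `L` on polynomials. -/
def actLin : L →ₗ[A] MvPolynomial I A →ₗ[A] MvPolynomial I A :=
  b.constr A fun i => (basisMonomials I A).constr A fun w =>
    actApprox b w.degree (b i) (monomial w 1)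

theorem actLin_basis (i : I) (w : I →₀ ℕ) :
    actLin b (b i) (monomial w 1) = actApprox b w.degree (b i) (monomial w 1) := by
  rw [actLin, Basis.constr_basis, ← congrFun (coe_basisMonomials I A) w, Basis.constr_basis]
  rfl

theorem actLin_sub_mem {n : ℕ} (D : L) {p : MvPolynomial I A} (hp : p ∈ degLT I A n) :
    actLin b D p - linPoly b D * p ∈ degLT I A n :=
  sub_mem_degLT_of_monomial b
    (fun i w => by rw [actLin_basis]; exact actApprox_sub_mem_monomial b _ i w) D hp

theorem actLin_eq_actApprox {n : ℕ} (D : L) {p : MvPolynomial I A} (hp : p ∈ degLT I A (n + 1)) :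
    actLin b D p = actApprox b n D p := by
  refine eq_of_monomial b (fun i w hw => ?_) D hp
  rw [actLin_basis]
  exact (actApprox_eq_of_le b (Nat.le_of_lt_succ hw) _ (monomial_mem_degLT (by omega) _)).symm

/-- The diagonal limit is a fixed point of the recursion: one more stage changes nothing at `w`, and
below the degree of `w` the limit agrees with the stage used there. -/
theorem actLin_basis_monomial (i : I) (w : I →₀ ℕ) :
    actLin b (b i) (monomial w 1) = actStep b (actLin b) i w := by
  rw [actLin_basis, ← actApprox_succ_eq b _ _ (monomial_mem_degLT (Nat.lt_succ_self _) _),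
    actApprox_succ]
  exact actStep_congr b (actApprox_sub_mem_monomial b _) i w fun D p hp =>
    (actLin_eq_actApprox b D (degLT_mono (Nat.le_succ _) hp)).symm

/-- The action of `L` on polynomials. -/
def polyAct : L →+ MvPolynomial I A →+ MvPolynomial I A :=
  AddMonoidHom.mk' (fun D => (actLin b D).toAddMonoidHom + coeffAct I D) fun D E => by
    refine AddMonoidHom.ext fun p => ?_
    simp only [map_add, AddMonoidHom.add_apply, LinearMap.toAddMonoidHom_coe, LinearMap.add_apply]
    abel

theorem polyAct_apply (D : L) (p : MvPolynomial I A) :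
    polyAct b D p = actLin b D p + coeffAct I D p := rfl

theorem polyAct_smul (D : L) (a : A) (p : MvPolynomial I A) :
    polyAct b D (a • p) = a • polyAct b D p + ⁅D, a⁆ • p := by
  rw [polyAct_apply, polyAct_apply, coeffAct_smul, map_smul, smul_add, add_assoc]

theorem smul_polyAct (D : L) (a : A) (p : MvPolynomial I A) :
    polyAct b (a • D) p = a • polyAct b D p := by
  rw [polyAct_apply, polyAct_apply, smul_coeffAct, map_smul, LinearMap.smul_apply, smul_add]

theorem polyAct_monomial_one (D : L) (w : I →₀ ℕ) :
    polyAct b D (monomial w 1) = actLin b D (monomial w 1) := by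
  rw [polyAct_apply, coeffAct_monomial_one, add_zero]

theorem polyAct_sub_mem {n : ℕ} (D : L) {p : MvPolynomial I A} (hp : p ∈ degLT I A n) :
    polyAct b D p - linPoly b D * p ∈ degLT I A n := by
  rw [polyAct_apply, add_sub_right_comm]
  exact add_mem (actLin_sub_mem b D hp) (coeffAct_mem_degLT D hp)

/-- A basis vector that comes before all variables of a monomial acts on it by multiplication. -/
theorem polyAct_of_low {i : I} {w : I →₀ ℕ} (h : ∀ k ∈ w.support, i ≤ k) :
    polyAct b (b i) (monomial w 1) = X i * monomial w 1 := by
  rw [polyAct_monomial_one, actLin_basis_monomial, actStep, dif_neg, add_zero]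
  rintro ⟨j, hj, hji⟩
  exact absurd (h j hj) (not_le.2 hji)

/-- This case of the bracket relation holds by construction, since it is the equation by which
`actStep` defines `b i` on the monomial `X j * w`. -/
theorem polyAct_basis_of_low {i j : I} {w : I →₀ ℕ} (h : ∀ k ∈ w.support, j ≤ k) (hji : j < i) :
    polyAct b (b i) (polyAct b (b j) (monomial w 1)) =
      polyAct b (b j) (polyAct b (b i) (monomial w 1)) + polyAct b ⁅b i, b j⁆ (monomial w 1) := by
  have hX : ∀ (k : I) (v : I →₀ ℕ), X k * monomial v (1 : A) = monomial (v + Finsupp.single k 1) 1 :=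
    fun k v => by rw [X, monomial_mul, one_mul, add_comm]
  have hmem : j ∈ (w + Finsupp.single j 1).support := by simp
  rw [polyAct_of_low b h, hX, polyAct_monomial_one, actLin_basis_monomial, actStep,
    dif_pos ⟨j, hmem, hji⟩]
  have hmin : (w + Finsupp.single j 1).support.min' ⟨_, hmem⟩ = j := by
    refine le_antisymm (Finset.min'_le _ _ hmem) (Finset.le_min' _ _ _ fun k hk => ?_)
    rcases Finset.mem_union.1 (Finsupp.support_add hk) with hk | hk
    · exact h k hk
    · exact (Finset.mem_singleton.1 (Finsupp.support_single_subset hk)).ge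
  dsimp only
  -- The linear part and the coefficient part on `r` recombine into the full action of `b j` on `b i
  -- · w - X i * w`; the subtracted term is computed in `hj`.
  rw [hmin, add_tsub_cancel_right, ← polyAct_apply, ← polyAct_monomial_one, ← polyAct_monomial_one,
    map_sub, hX, hX]
  have hj : polyAct b (b j) (monomial (w + Finsupp.single i 1) 1) =
      X j * monomial (w + Finsupp.single i 1) (1 : A) := by
    refine polyAct_of_low b fun k hk => ?_
    rcases Finset.mem_union.1 (Finsupp.support_add hk) with hk | hk
    · exact h k hk
    · exact hji.le.trans (Finset.mem_singleton.1 (Finsupp.support_single_subset hk)).ge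
  rw [hj, hX, add_right_comm w]
  abel

/-! ### Compatibility of the action with brackets. -/

/-- The action respects brackets on `p`. -/
def RespectsLie (D E : L) (p : MvPolynomial I A) : Prop :=
  polyAct b D (polyAct b E p) = polyAct b E (polyAct b D p) + polyAct b ⁅D, E⁆ p

variable {b}

theorem RespectsLie.symm {D E : L} {p : MvPolynomial I A} (h : RespectsLie b D E p) :
    RespectsLie b E D p := by
  rw [RespectsLie, ← lie_skew, map_neg, AddMonoidHom.neg_apply, h]
  abel

theorem RespectsLie.add_left {D D' E : L} {p : MvPolynomial I A} (h : RespectsLie b D E p)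
    (h' : RespectsLie b D' E p) : RespectsLie b (D + D') E p := by
  unfold RespectsLie at *
  rw [add_lie]
  simp only [map_add, AddMonoidHom.add_apply]
  rw [h, h']
  abel

theorem lie_smul_right (D E : L) (a : A) : ⁅a • D, E⁆ = a • ⁅D, E⁆ - ⁅E, a⁆ • D := by
  rw [← lie_skew, LieRinehartRing.leibniz_smul_right, ← lie_skew D E, smul_neg]
  abel

/-- The failure to respect brackets behaves like a curvature: it is `A`-linear in `D`, in `E` and,
by `RespectsLie.smul`, in `p`, because the derivative terms of the Leibniz rules cancel. Hence only
basis vectors and monomials need checking. -/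
theorem RespectsLie.smul_left {D E : L} {p : MvPolynomial I A} (a : A)
    (h : RespectsLie b D E p) : RespectsLie b (a • D) E p := by
  unfold RespectsLie at *
  rw [lie_smul_right, map_sub, AddMonoidHom.sub_apply, smul_polyAct, smul_polyAct, smul_polyAct,
    smul_polyAct, polyAct_smul, h, smul_add]
  abel

theorem RespectsLie.add {D E : L} {p q : MvPolynomial I A} (h : RespectsLie b D E p)
    (h' : RespectsLie b D E q) : RespectsLie b D E (p + q) := by
  unfold RespectsLie at *
  simp only [map_add]
  rw [h, h']
  abel

theorem RespectsLie.smul {D E : L} {p : MvPolynomial I A} (a : A)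
    (h : RespectsLie b D E p) : RespectsLie b D E (a • p) := by
  unfold RespectsLie at *
  simp only [polyAct_smul, map_add]
  -- The second-order terms in `a` cancel because the anchor respects brackets: `⁅⁅D, E⁆, a⁆` is the
  -- commutator of the two derivations applied to `a`.
  rw [h, lie_lie, sub_smul]
  simp only [smul_add]
  abel

variable (b)

theorem respectsLie_of_monomial {n : ℕ}
    (h : ∀ i j, ∀ w : I →₀ ℕ, w.degree < n → RespectsLie b (b i) (b j) (monomial w 1))
    (D E : L) {p : MvPolynomial I A} (hp : p ∈ degLT I A n) : RespectsLie b D E p := by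
  have zero_left : ∀ (E : L) (p : MvPolynomial I A), RespectsLie b 0 E p := fun E p => by
    simp [RespectsLie]
  induction hp using Submodule.span_induction with
  | mem z hz =>
    obtain ⟨w, hw, rfl⟩ := hz
    induction D using basis_induction b with
    | zero => exact zero_left _ _
    | basis i =>
      refine RespectsLie.symm ?_
      induction E using basis_induction b with
      | zero => exact zero_left _ _
      | basis j => exact h j i w hw
      | add D E hD hE => exact hD.add_left hE
      | smul a D hD => exact hD.smul_left a
    | add D E hD hE => exact hD.add_left hE
    | smul a D hD => exact hD.smul_left a
  | zero => simp [RespectsLie]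
  | add p q _ _ hp hq => exact hp.add hq
  | smul a p _ hp => exact hp.smul a

/-- Moves the lowest vector `b k` to the front of a threefold product. Subtracting the versions for
`i, j` and `j, i` cancels the mixed terms and leaves an expression governed by the Jacobi identity.
-/
theorem polyAct_three {n : ℕ} (ih : ∀ (D E : L), ∀ p ∈ degLT I A n, RespectsLie b D E p)
    {i j k : I} {w : I →₀ ℕ} (hw : w.degree < n) (hk : ∀ l ∈ w.support, k ≤ l) (hki : k < i)
    (hkj : k < j) :
    polyAct b (b i) (polyAct b (b j) (polyAct b (b k) (monomial w 1))) =
      polyAct b (b k) (polyAct b (b i) (polyAct b (b j) (monomial w 1))) +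
      polyAct b ⁅b i, b k⁆ (polyAct b (b j) (monomial w 1)) +
      polyAct b ⁅b j, b k⁆ (polyAct b (b i) (monomial w 1)) +
      polyAct b ⁅b i, ⁅b j, b k⁆⁆ (monomial w 1) := by
  have hq : monomial w (1 : A) ∈ degLT I A n := monomial_mem_degLT hw 1
  have h1 := ih (b j) (b k) _ hq
  have h2 : RespectsLie b (b i) (b k) (polyAct b (b j) (monomial w 1)) := by
    -- The polynomial `b j · w` may be too large for the induction hypothesis. Its part below the
    -- leading term `X j * w` is covered by it, and for `X j * w` itself the relation holds by
    -- construction because `k` lies below all its variables.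
    rw [← sub_add_cancel (polyAct b (b j) (monomial w 1)) (linPoly b (b j) * monomial w 1)]
    refine (ih _ _ _ (polyAct_sub_mem b _ hq)).add ?_
    rw [linPoly_basis, X, monomial_mul, one_mul]
    refine polyAct_basis_of_low b (fun l hl => ?_) hki
    rcases Finset.mem_union.1 (Finsupp.support_add hl) with hl | hl
    · exact hkj.le.trans (Finset.mem_singleton.1 (Finsupp.support_single_subset hl)).ge
    · exact hk l hl
  have h3 := ih (b i) ⁅b j, b k⁆ _ hq
  unfold RespectsLie at h1 h2 h3
  rw [h1, map_add, h2, h3]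
  abel

theorem respectsLie_mem (n : ℕ) : ∀ (D E : L), ∀ p ∈ degLT I A n, RespectsLie b D E p := by
  induction n with
  | zero =>
    intro D E p hp
    rw [degLT_zero, Submodule.mem_bot] at hp
    simp [RespectsLie, hp]
  | succ n ih =>
    intro D E p hp
    refine respectsLie_of_monomial b (fun i j w hw => ?_) D E hp
    -- If `i` or `j` precedes all variables of `w`, the smaller of the two does as well, and the
    -- relation holds by construction.
    by_cases hi : ∀ k ∈ w.support, i ≤ k
    · rcases lt_trichotomy i j with hij | rfl | hij
      · exact RespectsLie.symm (polyAct_basis_of_low b hi hij)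
      · simp [RespectsLie]
      · exact polyAct_basis_of_low b (fun k hk => hij.le.trans (hi k hk)) hij
    by_cases hj : ∀ k ∈ w.support, j ≤ k
    · rcases lt_trichotomy i j with hij | rfl | hij
      · exact RespectsLie.symm (polyAct_basis_of_low b (fun k hk => hij.le.trans (hj k hk)) hij)
      · simp [RespectsLie]
      · exact polyAct_basis_of_low b hj hij
    push Not at hi hj
    obtain ⟨k₁, hk₁, hi⟩ := hi
    obtain ⟨k₂, hk₂, hj⟩ := hj
    have hne : w.support.Nonempty := ⟨k₁, hk₁⟩
    have hmem := w.support.min'_mem hne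
    have hmin := fun l hl => w.support.min'_le l hl
    set k := w.support.min' hne
    have hki : k < i := (hmin _ hk₁).trans_lt hi
    have hkj : k < j := (hmin _ hk₂).trans_lt hj
    have hdeg := degree_sub_single hmem
    have hw' : w = w - Finsupp.single k 1 + Finsupp.single k 1 :=
      (tsub_add_cancel_of_le (Finsupp.single_le_iff.2
        (Nat.one_le_iff_ne_zero.2 (Finsupp.mem_support_iff.1 hmem)))).symm
    have hlow : ∀ l ∈ (w - Finsupp.single k 1).support, k ≤ l := fun l hl =>
      hmin l (Finsupp.support_mono tsub_le_self hl)
    set v := w - Finsupp.single k 1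
    have hv : monomial v (1 : A) ∈ degLT I A n := monomial_mem_degLT (by omega) 1
    -- In the remaining case the least variable `k` of `w` lies below `i` and `j`; splitting it off
    -- puts `v` in the range of the induction hypothesis.
    have hact : monomial w (1 : A) = polyAct b (b k) (monomial v 1) := by
      rw [polyAct_of_low b hlow, X, monomial_mul, one_mul, add_comm, ← hw']
    have h1 := polyAct_three b ih (i := i) (j := j) (by omega : v.degree < n) hlow hki hkj
    have h2 := polyAct_three b ih (i := j) (j := i) (by omega : v.degree < n) hlow hkj hki
    have h3 := ih (b i) (b j) _ hv
    have h4 := ih ⁅b i, b j⁆ (b k) _ hv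
    unfold RespectsLie at h3 h4 ⊢
    -- The terms with `⁅b i, b k⁆` and `⁅b j, b k⁆` occur on both sides. What is left is the
    -- relation for `b i, b j` on `v`, the one for `⁅b i, b j⁆, b k` on `v`, and the Jacobi
    -- identity.
    rw [hact, h1, h2, h3, h4, leibniz_lie (b i) (b j) (b k)]
    simp only [map_add, AddMonoidHom.add_apply]
    abel

theorem polyAct_lie (D E : L) (p : MvPolynomial I A) :
    polyAct b ⁅D, E⁆ p = polyAct b D (polyAct b E p) - polyAct b E (polyAct b D p) := by
  obtain ⟨n, hn⟩ := exists_mem_degLT p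
  rw [show polyAct b D (polyAct b E p) = _ from respectsLie_mem b n D E p hn]
  abel

end Action

/-! ### The representation of the enveloping algebra and principal symbols. -/

section Representation

variable {K A L : Type u} {I : Type*} [CommRing K] [CommRing A] [Algebra K A] [LieRing L]
  [LieAlgebra K L] [Module A L] [LieRingModule L A] [LieRinehartRing A L]
  [LieRinehartAlgebra K A L]

/-- The action of the universal enveloping algebra on polynomials in a basis. -/
def polyRep [LinearOrder I] (b : Basis I A L) : Env K A L →ₐ[K] Module.End K (MvPolynomial I A) :=
  Env.lift (Algebra.lsmul K K (MvPolynomial I A))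
    (AddMonoidHom.mk' (fun D =>
      { (polyAct b D) with
        map_smul' := fun k p => by
          have h := polyAct_smul b D (algebraMap K A k) p
          -- The anchor kills constants, so the Leibniz rule reduces to `K`-linearity.
          have h0 : ⁅D, algebraMap K A k⁆ = 0 := by
            rw [Algebra.algebraMap_eq_smul_one, lie_smul k D (1 : A), lie_one_eq_zero, smul_zero]
          simpa [h0] using h }) fun D E => by
        refine LinearMap.ext fun p => ?_
        exact congrArg (fun f : _ →+ _ => f p) (map_add (polyAct b) D E))
    (fun a D => LinearMap.ext fun p => smul_polyAct b D a p)
    (fun D E => LinearMap.ext fun p => polyAct_lie b D E p)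
    (fun D a => LinearMap.ext fun p => by
      refine Eq.trans ?_ (congrArg (· - a • polyAct b D p) (polyAct_smul b D a p)).symm
      exact (add_sub_cancel_left _ _).symm)

theorem polyRep_ofA [LinearOrder I] (b : Basis I A L) (a : A) (p : MvPolynomial I A) :
    polyRep (K := K) b (Env.ofA K A L a) p = a • p :=
  congrArg (fun f : Module.End K _ => f p) (Env.lift_ofA _ _ _ _ _ a)

theorem polyRep_ofL [LinearOrder I] (b : Basis I A L) (D : L) (p : MvPolynomial I A) :
    polyRep (K := K) b (Env.ofL K A L D) p = polyAct b D p :=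
  congrArg (fun f : Module.End K _ => f p) (Env.lift_ofL _ _ _ _ _ D)

/-- If `L` is free with basis `b`, the product `a D₁ ⋯ Dₙ` in the universal enveloping algebra
determines the polynomial `a D₁ ⋯ Dₙ` up to polynomials of smaller degree. -/
theorem exists_principal_symbol (K : Type u) [CommRing K] [Algebra K A] [LieAlgebra K L]
    [LieRinehartAlgebra K A L] (b : Basis I A L) :
    ∃ E : Env K A L →ₗ[K] MvPolynomial I A, ∀ (a : A) (l : List L),
      E (Env.ofA K A L a * (l.map (Env.ofL K A L)).prod) -
        a • (l.map (b.constr A (X : I → MvPolynomial I A))).prod ∈ degLT I A l.length ∧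
      E (Env.ofA K A L a * (l.map (Env.ofL K A L)).prod) ∈ degLT I A (l.length + 1) := by
  classical
  -- Any linear order on the basis serves: minima are only taken over finite supports.
  let _ : LinearOrder I := linearOrderOfSTO WellOrderingRel
  -- An element of the enveloping algebra is sent to its action on the polynomial `1`.
  refine ⟨(LinearMap.applyₗ (1 : MvPolynomial I A)).comp (polyRep b).toLinearMap, fun a l => ?_⟩
  have h1 : (1 : MvPolynomial I A) = monomial 0 1 := rfl
  have key : (l.map (b.constr A (X : I → MvPolynomial I A))).prod ∈ degLT I A (l.length + 1) ∧
      polyRep b (l.map (Env.ofL K A L)).prod 1 -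
        (l.map (b.constr A (X : I → MvPolynomial I A))).prod ∈ degLT I A l.length := by
    induction l with
    | nil =>
      simp only [List.map_nil, List.prod_nil, map_one, Module.End.one_apply, sub_self, zero_mem,
        and_true]
      exact monomial_mem_degLT (by simp) 1
    | cons D l ih =>
      simp only [List.map_cons, List.prod_cons, map_mul, Module.End.mul_apply, polyRep_ofL,
        List.length_cons]
      refine ⟨linPoly_mul_mem_degLT b D ih.1, ?_⟩
      set p := polyRep b (l.map (Env.ofL K A L)).prod 1
      have hp : p ∈ degLT I A (l.length + 1) := by
        rw [← sub_add_cancel p]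
        exact add_mem (degLT_mono (Nat.le_succ _) ih.2) ih.1
      -- Two errors: replacing the action of `D` by multiplication, and multiplying the error for
      -- the shorter product by a linear form. Both have degree at most the length of `l`.
      rw [← sub_add_sub_cancel _ (linPoly b D * p)]
      refine add_mem (polyAct_sub_mem b D hp) ?_
      change linPoly b D * p - linPoly b D * _ ∈ _
      rw [← mul_sub]
      exact linPoly_mul_mem_degLT b D ih.2
  have h : ∀ u : Env K A L, polyRep b (Env.ofA K A L a * u) (1 : MvPolynomial I A) =
      a • polyRep b u 1 := fun u => by
    rw [map_mul, Module.End.mul_apply, polyRep_ofA]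
  simp only [LinearMap.comp_apply, AlgHom.toLinearMap_apply, LinearMap.applyₗ_apply_apply, h]
  rw [← smul_sub]
  refine ⟨Submodule.smul_mem _ a key.2, Submodule.smul_mem _ a ?_⟩
  rw [← sub_add_cancel (polyRep b _ _)]
  exact add_mem (degLT_mono (Nat.le_succ _) key.2) key.1

theorem isHomogeneous_constr_X (b : Basis I A L) (D : L) :
    (b.constr A (X : I → MvPolynomial I A) D).IsHomogeneous 1 := by
  induction D using basis_induction b with
  | zero => rw [map_zero]; exact isHomogeneous_zero _ _ _
  | basis i => rw [Basis.constr_basis]; exact isHomogeneous_X A i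
  | add D E hD hE => rw [map_add]; exact hD.add hE
  | smul a D hD => rw [map_smul]; exact (homogeneousSubmodule I A 1).smul_mem a hD

theorem isHomogeneous_smul_prod_constr_X (b : Basis I A L) (a : A) (l : List L) :
    (a • (l.map (b.constr A (X : I → MvPolynomial I A))).prod).IsHomogeneous l.length := by
  refine (homogeneousSubmodule I A l.length).smul_mem a ?_
  induction l with
  | nil => exact isHomogeneous_one I A
  | cons D l ih =>
    rw [List.map_cons, List.prod_cons, List.length_cons, add_comm]
    exact (isHomogeneous_constr_X b D).mul ih

theorem eq_zero_of_isHomogeneous_of_mem_degLT {n : ℕ} {p : MvPolynomial I A}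
    (hp : p.IsHomogeneous n) (hp' : p ∈ degLT I A n) : p = 0 := by
  ext w
  rw [coeff_zero]
  by_contra h
  have hw : w.degree = n := by
    rw [Finsupp.degree_eq_weight_one]
    exact hp h
  exact h (coeff_eq_zero_of_mem_degLT hp' hw.ge)

end Representation

end LieRinehart


/-! ## Stalks of Lie algebroids -/

namespace LieAlgebroid

open LieRinehart Module

variable {K : Type u} [Field K] {X : TopCat.{u}} (O : X.Sheaf (CommAlgCat.{u} K))

/-- The open neighbourhoods of a point, ordered by reverse inclusion. -/
abbrev Nhd (x : X) : Type u := {W : (Opens X)ᵒᵈ // x ∈ OrderDual.ofDual W}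

namespace Nhd

variable {x : X}

/-- The underlying open set. -/
abbrev opens (i : Nhd x) : Opens X := OrderDual.ofDual i.1

theorem opens_le {i j : Nhd x} (h : i ≤ j) : j.opens ≤ i.opens := h

/-- A neighbourhood from an open set. -/
abbrev mk {U : Opens X} (h : x ∈ U) : Nhd x := ⟨OrderDual.toDual U, h⟩

instance : IsDirectedOrder (Nhd x) :=
  ⟨fun i j => ⟨mk (U := i.opens ⊓ j.opens) ⟨i.2, j.2⟩,
    (inf_le_left : i.opens ⊓ j.opens ≤ i.opens), (inf_le_right : i.opens ⊓ j.opens ≤ j.opens)⟩⟩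

instance : Nonempty (Nhd x) := ⟨mk (U := ⊤) trivial⟩

end Nhd

variable (x : X)

/-- Restriction of functions between neighbourhoods. -/
abbrev oTrans (i j : Nhd x) (h : i ≤ j) : OSec O i.opens →ₐ[K] OSec O j.opens :=
  oRes O (Nhd.opens_le h)

instance : DirectedSystem (fun i : Nhd x => OSec O i.opens) (oTrans O x · · ·) where
  map_self _ f := oRes_self O f
  map_map _ _ _ _ _ f := oRes_oRes O _ _ f

/-- The stalk of the structure sheaf. -/
def OStalk : Type u := DirectLimit (fun i : Nhd x => OSec O i.opens) (oTrans O x)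

instance : CommRing (OStalk O x) :=
  inferInstanceAs (CommRing (DirectLimit (fun i : Nhd x => OSec O i.opens) (oTrans O x)))

instance : Algebra K (OStalk O x) :=
  inferInstanceAs (Algebra K (DirectLimit (fun i : Nhd x => OSec O i.opens) (oTrans O x)))

variable {O} (L : LieAlgebroid O)

/-- Restriction of sections between neighbourhoods. -/
abbrev trans (i j : Nhd x) (h : i ≤ j) : L.sec i.opens →ₗ[K] L.sec j.opens :=
  (L.res (Nhd.opens_le h)).toLieHom.toLinearMap

instance : DirectedSystem (fun i : Nhd x => L.sec i.opens) (L.trans x · · ·) where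
  map_self _ f := L.res_self f
  map_map _ _ _ _ _ f := L.res_res _ _ f

/-- The stalk of a Lie algebroid. -/
def Stalk : Type u := DirectLimit (fun i : Nhd x => L.sec i.opens) (L.trans x)

instance : AddCommGroup (L.Stalk x) :=
  inferInstanceAs (AddCommGroup (DirectLimit (fun i : Nhd x => L.sec i.opens) (L.trans x)))

instance : Module K (L.Stalk x) :=
  inferInstanceAs (Module K (DirectLimit (fun i : Nhd x => L.sec i.opens) (L.trans x)))

theorem oRes_lie {U V : Opens X} (h : V ≤ U) (D : L.sec U) (f : OSec O U) :
    oRes O h ⁅D, f⁆ = ⁅L.res h D, oRes O h f⁆ :=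
  (L.res h).apply_lie f D

theorem res_smul {U V : Opens X} (h : V ≤ U) (f : OSec O U) (D : L.sec U) :
    L.res h (f • D) = oRes O h f • L.res h D :=
  (L.res h).map_smul_apply f D

instance : SMul (OStalk O x) (L.Stalk x) where
  smul := DirectLimit.map₂ (oTrans O x) (L.trans x) (L.trans x) (fun _ f D => f • D)
    fun _ _ _ f D => L.res_smul _ f D

instance : Bracket (L.Stalk x) (L.Stalk x) where
  bracket := DirectLimit.map₂ (L.trans x) (L.trans x) (L.trans x) (fun _ D E => ⁅D, E⁆)
    fun _ _ h D E => (L.res (Nhd.opens_le h)).toLieHom.map_lie D E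

instance : Bracket (L.Stalk x) (OStalk O x) where
  bracket := DirectLimit.map₂ (L.trans x) (oTrans O x) (oTrans O x) (fun _ D f => ⁅D, f⁆)
    fun _ _ h D f => L.oRes_lie (Nhd.opens_le h) D f

variable (O) in
/-- The germ of a function. -/
def oGerm (i : Nhd x) : OSec O i.opens →ₐ[K] OStalk O x where
  toFun f := (⟦⟨i, f⟩⟧ : DirectLimit (fun i : Nhd x => OSec O i.opens) (oTrans O x))
  map_one' := (DirectLimit.one_def (f := oTrans O x) i).symm
  map_mul' f g := (DirectLimit.mul_def (f := oTrans O x) i f g).symm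
  map_zero' := (DirectLimit.zero_def (f := oTrans O x) i).symm
  map_add' f g := (DirectLimit.add_def (f := oTrans O x) i f g).symm
  commutes' k := by
    rw [Algebra.algebraMap_eq_smul_one, Algebra.algebraMap_eq_smul_one]
    refine (DirectLimit.smul_def (f := oTrans O x) i _ k).symm.trans ?_
    exact congrArg (k • ·) (DirectLimit.one_def (f := oTrans O x) i).symm

/-- The germ of a section. -/
def germ (i : Nhd x) : L.sec i.opens →ₗ[K] L.Stalk x where
  toFun D := (⟦⟨i, D⟩⟧ : DirectLimit (fun i : Nhd x => L.sec i.opens) (L.trans x))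
  map_add' f g := (DirectLimit.add_def (f := L.trans x) i f g).symm
  map_smul' k f := (DirectLimit.smul_def (f := L.trans x) i f k).symm

variable {x}

theorem oGerm_res {i j : Nhd x} (h : i ≤ j) (f : OSec O i.opens) :
    oGerm O x j (oRes O (Nhd.opens_le h) f) = oGerm O x i f :=
  (DirectLimit.eq_of_le (F := fun i : Nhd x => OSec O i.opens) (f := oTrans O x) ⟨i, f⟩ j h).symm

theorem germ_res {i j : Nhd x} (h : i ≤ j) (D : L.sec i.opens) :
    L.germ x j (L.res (Nhd.opens_le h) D) = L.germ x i D :=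
  (DirectLimit.eq_of_le (F := fun i : Nhd x => L.sec i.opens) (f := L.trans x) ⟨i, D⟩ j h).symm

theorem exists_oRes_eq_zero {i : Nhd x} {f : OSec O i.opens} (h : oGerm O x i f = 0) :
    ∃ (j : Nhd x) (hij : i ≤ j), oRes O (Nhd.opens_le hij) f = 0 :=
  have ⟨j, hij, hf⟩ := (DirectLimit.exists_eq_zero (G := fun i : Nhd x => OSec O i.opens)
    (f := oTrans O x) ⟨i, f⟩).1 h
  ⟨j, hij, hf⟩

theorem exists_res_eq_zero {i : Nhd x} {D : L.sec i.opens} (h : L.germ x i D = 0) :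
    ∃ (j : Nhd x) (hij : i ≤ j), L.res (Nhd.opens_le hij) D = 0 :=
  have ⟨j, hij, hf⟩ := (DirectLimit.exists_eq_zero (G := fun i : Nhd x => L.sec i.opens)
    (f := L.trans x) ⟨i, D⟩).1 h
  ⟨j, hij, hf⟩

theorem exists_oGerm (i : Nhd x) (a : OStalk O x) :
    ∃ (j : Nhd x) (_ : i ≤ j) (f : OSec O j.opens), a = oGerm O x j f := by
  obtain ⟨k, f, rfl⟩ := DirectLimit.exists_eq_mk (oTrans O x) a
  obtain ⟨j, hij, hkj⟩ := exists_ge_ge i k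
  exact ⟨j, hij, oRes O (Nhd.opens_le hkj) f, (oGerm_res hkj f).symm⟩

theorem exists_germ (i : Nhd x) (a : L.Stalk x) :
    ∃ (j : Nhd x) (_ : i ≤ j) (D : L.sec j.opens), a = L.germ x j D := by
  obtain ⟨k, f, rfl⟩ := DirectLimit.exists_eq_mk (L.trans x) a
  obtain ⟨j, hij, hkj⟩ := exists_ge_ge i k
  exact ⟨j, hij, L.res (Nhd.opens_le hkj) f, (L.germ_res hkj f).symm⟩

/-- Two functions and three sections on a common neighbourhood suffice for every axiom of a
Lie–Rinehart algebra, so each axiom on stalks reduces to the same axiom on sections. Superfluous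
arguments are filled with `0`. -/
theorem exists_germs (a b : OStalk O x) (D E F : L.Stalk x) :
    ∃ (i : Nhd x) (f g : OSec O i.opens) (P Q R : L.sec i.opens), a = oGerm O x i f ∧
      b = oGerm O x i g ∧ D = L.germ x i P ∧ E = L.germ x i Q ∧ F = L.germ x i R := by
  obtain ⟨i₁, f, g, rfl, rfl⟩ := DirectLimit.exists_eq_mk₂ (oTrans O x) a b
  obtain ⟨i₂, P, Q, R, rfl, rfl, rfl⟩ := DirectLimit.exists_eq_mk₃ (L.trans x) D E F
  obtain ⟨j, h₁, h₂⟩ := exists_ge_ge i₁ i₂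
  exact ⟨j, oRes O (Nhd.opens_le h₁) f, oRes O (Nhd.opens_le h₁) g, L.res (Nhd.opens_le h₂) P,
    L.res (Nhd.opens_le h₂) Q, L.res (Nhd.opens_le h₂) R, (oGerm_res h₁ f).symm,
    (oGerm_res h₁ g).symm, (L.germ_res h₂ P).symm, (L.germ_res h₂ Q).symm, (L.germ_res h₂ R).symm⟩

theorem germ_smul (i : Nhd x) (f : OSec O i.opens) (D : L.sec i.opens) :
    oGerm O x i f • L.germ x i D = L.germ x i (f • D) :=
  DirectLimit.map₂_def (oTrans O x) (L.trans x) (L.trans x) (fun _ f D => f • D)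
    (fun _ _ _ f D => L.res_smul _ f D) i f D

theorem germ_lie (i : Nhd x) (D E : L.sec i.opens) :
    ⁅L.germ x i D, L.germ x i E⁆ = L.germ x i ⁅D, E⁆ :=
  DirectLimit.map₂_def (L.trans x) (L.trans x) (L.trans x) (fun _ D E => ⁅D, E⁆)
    (fun _ _ h D E => (L.res (Nhd.opens_le h)).toLieHom.map_lie D E) i D E

theorem oGerm_lie (i : Nhd x) (D : L.sec i.opens) (f : OSec O i.opens) :
    ⁅L.germ x i D, oGerm O x i f⁆ = oGerm O x i ⁅D, f⁆ :=
  DirectLimit.map₂_def (L.trans x) (oTrans O x) (oTrans O x) (fun _ D f => ⁅D, f⁆)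
    (fun _ _ h D f => L.oRes_lie (Nhd.opens_le h) D f) i D f

instance : Module (OStalk O x) (L.Stalk x) where
  one_smul D := by
    obtain ⟨i, -, -, D, -, -, -, -, rfl, -, -⟩ := L.exists_germs 0 0 D 0 0
    rw [← map_one (oGerm O x i), germ_smul, one_smul]
  mul_smul a b D := by
    obtain ⟨i, f, g, D, -, -, rfl, rfl, rfl, -, -⟩ := L.exists_germs a b D 0 0
    rw [← map_mul, germ_smul, germ_smul, germ_smul, mul_smul]
  smul_zero a := by
    obtain ⟨i, f, -, -, -, -, rfl, -, -, -, -⟩ := L.exists_germs a 0 0 0 0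
    rw [← map_zero (L.germ x i), germ_smul, smul_zero]
  smul_add a D E := by
    obtain ⟨i, f, -, D, E, -, rfl, -, rfl, rfl, -⟩ := L.exists_germs a 0 D E 0
    rw [← map_add, germ_smul, germ_smul, germ_smul, smul_add, map_add]
  add_smul a b D := by
    obtain ⟨i, f, g, D, -, -, rfl, rfl, rfl, -, -⟩ := L.exists_germs a b D 0 0
    rw [← map_add, germ_smul, germ_smul, germ_smul, add_smul, map_add]
  zero_smul D := by
    obtain ⟨i, -, -, D, -, -, -, -, rfl, -, -⟩ := L.exists_germs 0 0 D 0 0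
    rw [← map_zero (oGerm O x i), germ_smul, zero_smul, map_zero]

instance : LieRing (L.Stalk x) where
  add_lie D E F := by
    obtain ⟨i, -, -, D, E, F, -, -, rfl, rfl, rfl⟩ := L.exists_germs 0 0 D E F
    rw [← map_add, germ_lie, germ_lie, germ_lie, add_lie, map_add]
  lie_add D E F := by
    obtain ⟨i, -, -, D, E, F, -, -, rfl, rfl, rfl⟩ := L.exists_germs 0 0 D E F
    rw [← map_add, germ_lie, germ_lie, germ_lie, lie_add, map_add]
  lie_self D := by
    obtain ⟨i, -, -, D, -, -, -, -, rfl, -, -⟩ := L.exists_germs 0 0 D 0 0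
    rw [germ_lie, lie_self, map_zero]
  leibniz_lie D E F := by
    obtain ⟨i, -, -, D, E, F, -, -, rfl, rfl, rfl⟩ := L.exists_germs 0 0 D E F
    simp only [germ_lie]
    rw [leibniz_lie, map_add]

instance : LieAlgebra K (L.Stalk x) where
  lie_smul k D E := by
    obtain ⟨i, -, -, D, E, -, -, -, rfl, rfl, -⟩ := L.exists_germs 0 0 D E 0
    rw [← map_smul, germ_lie, germ_lie, lie_smul, map_smul]

instance : LieRingModule (L.Stalk x) (OStalk O x) where
  add_lie D E a := by
    obtain ⟨i, f, -, D, E, -, rfl, -, rfl, rfl, -⟩ := L.exists_germs a 0 D E 0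
    rw [← map_add, oGerm_lie, oGerm_lie, oGerm_lie, add_lie, map_add]
  lie_add D a b := by
    obtain ⟨i, f, g, D, -, -, rfl, rfl, rfl, -, -⟩ := L.exists_germs a b D 0 0
    rw [← map_add, oGerm_lie, oGerm_lie, oGerm_lie, lie_add, map_add]
  leibniz_lie D E a := by
    obtain ⟨i, f, -, D, E, -, rfl, -, rfl, rfl, -⟩ := L.exists_germs a 0 D E 0
    simp only [germ_lie, oGerm_lie]
    rw [leibniz_lie, map_add]

instance : LieRinehartRing (OStalk O x) (L.Stalk x) where
  lie_smul_eq_mul' a b D := by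
    obtain ⟨i, f, g, D, -, -, rfl, rfl, rfl, -, -⟩ := L.exists_germs a b D 0 0
    rw [germ_smul, oGerm_lie, oGerm_lie, LieRinehartRing.lie_smul_eq_mul, map_mul]
  leibniz_mul_right' D a b := by
    obtain ⟨i, f, g, D, -, -, rfl, rfl, rfl, -, -⟩ := L.exists_germs a b D 0 0
    rw [← map_mul, oGerm_lie, oGerm_lie, oGerm_lie, LieRinehartRing.leibniz_mul_right, map_add,
      map_mul, smul_eq_mul, smul_eq_mul, map_mul]
  leibniz_smul_right' D E a := by
    obtain ⟨i, f, -, D, E, -, rfl, -, rfl, rfl, -⟩ := L.exists_germs a 0 D E 0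
    rw [germ_smul, germ_lie, germ_lie, oGerm_lie, germ_smul, germ_smul,
      LieRinehartRing.leibniz_smul_right, map_add]

instance : LieRinehartAlgebra K (OStalk O x) (L.Stalk x) where
  smul_assoc k a D := by
    obtain ⟨i, f, -, D, -, -, rfl, -, rfl, -, -⟩ := L.exists_germs a 0 D 0 0
    rw [← map_smul (oGerm O x i) k f, germ_smul, germ_smul, smul_assoc, map_smul]
  smul_lie k D a := by
    obtain ⟨i, f, -, D, -, -, rfl, -, rfl, -, -⟩ := L.exists_germs a 0 D 0 0
    rw [← map_smul, oGerm_lie, oGerm_lie, smul_lie, map_smul]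
  lie_smul k D a := by
    obtain ⟨i, f, -, D, -, -, rfl, -, rfl, -, -⟩ := L.exists_germs a 0 D 0 0
    rw [← map_smul (oGerm O x i) k f, oGerm_lie, oGerm_lie, lie_smul k D f, map_smul]

variable (x) in
/-- Taking germs is a morphism of Lie–Rinehart algebras. -/
def germHom (i : Nhd x) : LieRinehartAlgebra.Hom (oGerm O x i) (L.sec i.opens) (L.Stalk x) where
  toLieHom := { L.germ x i with map_lie' := fun {D E} => (L.germ_lie i D E).symm }
  map_smul_apply' f D := (L.germ_smul i f D).symm
  apply_lie' f D := (L.oGerm_lie i D f).symm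

theorem germHom_apply (i : Nhd x) (D : L.sec i.opens) : L.germHom x i D = L.germ x i D := rfl

/-- Finitely many germs of functions are defined on a common neighbourhood. -/
theorem exists_finsupp_oGerm {J : Type*} (i : Nhd x) (l : J →₀ OStalk O x) :
    ∃ (j : Nhd x) (_ : i ≤ j) (m : J →₀ OSec O j.opens),
      l = m.mapRange (oGerm O x j) (map_zero _) := by
  classical
  induction l using Finsupp.induction_linear with
  | zero => exact ⟨i, le_rfl, 0, by simp⟩
  | add l₁ l₂ h₁ h₂ =>
    obtain ⟨j₁, hj₁, m₁, rfl⟩ := h₁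
    obtain ⟨j₂, hj₂, m₂, rfl⟩ := h₂
    obtain ⟨j, h₁, h₂⟩ := exists_ge_ge j₁ j₂
    refine ⟨j, hj₁.trans h₁, m₁.mapRange (oRes O (Nhd.opens_le h₁)) (map_zero _) +
      m₂.mapRange (oRes O (Nhd.opens_le h₂)) (map_zero _), ?_⟩
    ext y
    simp only [Finsupp.add_apply, Finsupp.mapRange_apply]
    rw [map_add, oGerm_res h₁, oGerm_res h₂]
  | single y a =>
    obtain ⟨j, hj, f, rfl⟩ := exists_oGerm i a
    exact ⟨j, hj, Finsupp.single y f, by simp⟩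

/-- Finitely many functions that vanish at the level of germs vanish on a common neighbourhood. -/
theorem exists_finsupp_oRes_eq_zero {J : Type*} (i : Nhd x) (l : J →₀ OSec O i.opens)
    (h : ∀ y, oGerm O x i (l y) = 0) :
    ∃ (j : Nhd x) (hij : i ≤ j), ∀ y, oRes O (Nhd.opens_le hij) (l y) = 0 := by
  classical
  have key : ∀ s : Finset J, ∃ (j : Nhd x) (hij : i ≤ j),
      ∀ y ∈ s, oRes O (Nhd.opens_le hij) (l y) = 0 := by
    intro s
    induction s using Finset.induction_on with
    | empty => exact ⟨i, le_rfl, by simp⟩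
    | insert y s _ ih =>
      obtain ⟨j₁, hj₁, h₁⟩ := ih
      obtain ⟨j₂, hj₂, h₂⟩ := exists_oRes_eq_zero (h y)
      obtain ⟨j, hk₁, hk₂⟩ := exists_ge_ge j₁ j₂
      refine ⟨j, hj₁.trans hk₁, fun z hz => ?_⟩
      rcases Finset.mem_insert.1 hz with rfl | hz
      · rw [← oRes_oRes O (Nhd.opens_le hj₂) (Nhd.opens_le hk₂), h₂, map_zero]
      · rw [← oRes_oRes O (Nhd.opens_le hj₁) (Nhd.opens_le hk₁), h₁ z hz, map_zero]
  obtain ⟨j, hij, hj⟩ := key l.support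
  refine ⟨j, hij, fun y => ?_⟩
  by_cases hy : y ∈ l.support
  · exact hj y hy
  · rw [Finsupp.notMem_support_iff.1 hy, map_zero]

/-- The germs of a local frame form a basis of the stalk. -/
theorem exists_basis_stalk {J : Type*} (i : Nhd x) (e : J → L.sec i.opens)
    (hli : ∀ (V : Opens X) (h : V ≤ i.opens),
      LinearIndependent (OSec O V) fun k => L.res h (e k))
    (hspan : ∀ (V : Opens X) (h : V ≤ i.opens) (s : L.sec V), ∀ y ∈ V,
      ∃ (W : Opens X) (h' : W ≤ V), y ∈ W ∧
        L.res h' s ∈ Submodule.span (OSec O W) (Set.range fun k => L.res (h'.trans h) (e k))) :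
    ∃ b : Basis J (OStalk O x) (L.Stalk x), ∀ k, b k = L.germ x i (e k) := by
  -- Linear combinations commute with germs; both halves of the basis property pass through this
  -- identity.
  have hcomb : ∀ (j : Nhd x) (hij : i ≤ j) (m : J →₀ OSec O j.opens),
      Finsupp.linearCombination (OStalk O x) (fun k => L.germ x i (e k))
        (m.mapRange (oGerm O x j) (map_zero _)) =
      L.germ x j (Finsupp.linearCombination (OSec O j.opens)
        (fun k => L.res (Nhd.opens_le hij) (e k)) m) := by
    intro j hij m
    induction m using Finsupp.induction_linear with
    | zero => simp
    | add l₁ l₂ h₁ h₂ =>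
      rw [Finsupp.mapRange_add (map_add (oGerm O x j)), map_add, map_add, map_add, h₁, h₂]
    | single y a =>
      rw [Finsupp.mapRange_single, Finsupp.linearCombination_single,
        Finsupp.linearCombination_single, ← germ_smul, germ_res (h := hij)]
  refine ⟨Basis.mk (v := fun k => L.germ x i (e k)) ?_ ?_, fun k => Basis.mk_apply _ _ k⟩
  · rw [linearIndependent_iff]
    intro l hl
    obtain ⟨j, hij, m, rfl⟩ := exists_finsupp_oGerm i l
    rw [hcomb j hij] at hl
    obtain ⟨j', hjj', h0⟩ := L.exists_res_eq_zero hl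
    -- A relation between germs becomes a relation of sections only after shrinking, which is why
    -- independence is needed over every smaller open set.
    have hm : m.mapRange (oRes O (Nhd.opens_le hjj')) (map_zero _) = 0 := by
      refine linearIndependent_iff.1 (hli j'.opens (Nhd.opens_le (hij.trans hjj'))) _ ?_
      rw [← h0]
      clear hl h0
      induction m using Finsupp.induction_linear with
      | zero => simp
      | add l₁ l₂ h₁ h₂ =>
        rw [Finsupp.mapRange_add (map_add (oRes O (Nhd.opens_le hjj'))), map_add, map_add, h₁, h₂,
          map_add]
      | single y a =>
        rw [Finsupp.mapRange_single, Finsupp.linearCombination_single,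
          Finsupp.linearCombination_single, res_smul, res_res]
    ext y
    have := DFunLike.congr_fun hm y
    rw [Finsupp.mapRange_apply] at this
    rw [Finsupp.mapRange_apply, ← oGerm_res hjj', this]
    simp
  · rintro D -
    obtain ⟨j, hij, D, rfl⟩ := L.exists_germ i D
    obtain ⟨W, hW, hxW, hD⟩ := hspan j.opens (Nhd.opens_le hij) D x j.2
    rw [← Finsupp.range_linearCombination] at hD
    obtain ⟨m, hm⟩ := hD
    have hjW : j ≤ Nhd.mk hxW := hW
    rw [← L.germ_res hjW D, ← Finsupp.range_linearCombination]
    exact ⟨m.mapRange (oGerm O x (Nhd.mk hxW)) (map_zero _),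
      (hcomb (Nhd.mk hxW) (hij.trans hjW) m).trans (congrArg (L.germ x (Nhd.mk hxW)) hm)⟩

end LieAlgebroid


/-! ## Homomorphisms out of symmetric algebras -/

namespace SymmetricAlgebra

section liftBase

variable {K A L C R : Type*} [CommRing K] [CommRing A] [Algebra K A]
  [AddCommGroup L] [Module K L] [Module A L] [IsScalarTower K A L]
  [CommRing C] [Algebra K C] [Ring R] [Algebra K R]

/-- The `K`-algebra homomorphism out of the symmetric algebra of the `A`-module `L` given by its
values on `A` and on `L`. -/
theorem exists_algHom (f : A →ₐ[K] C) (g : L →+ C) (h_smul : ∀ a x, g (a • x) = f a * g x) :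
    ∃ F : SymmetricAlgebra A L →ₐ[K] C,
      (∀ a, F (algebraMap A _ a) = f a) ∧ ∀ x, F (ι A L x) = g x := by
  -- With `C` made an `A`-algebra through `f`, the semilinear data become `A`-linear and the usual
  -- universal property applies.
  let _ : Algebra A C := f.toRingHom.toAlgebra
  let G : SymmetricAlgebra A L →ₐ[A] C := SymmetricAlgebra.lift
    { toFun := g
      map_add' := map_add g
      map_smul' := fun a x => (h_smul a x).trans (Algebra.smul_def (R := A) a (g x)).symm }
  have hA : ∀ a, G (algebraMap A _ a) = f a := G.commutes
  refine ⟨{ G.toRingHom with commutes' := fun k => ?_ }, hA, fun x => lift_ι_apply _ x⟩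
  rw [IsScalarTower.algebraMap_apply K A (SymmetricAlgebra A L)]
  exact (hA _).trans (f.commutes k)

/-- The `K`-algebra homomorphism out of the symmetric algebra of the `A`-module `L` given by
commuting values on `A` and on `L`. -/
theorem exists_algHom_of_commute (f : A →ₐ[K] R) (g : L →+ R)
    (h_smul : ∀ a x, g (a • x) = f a * g x) (hfg : ∀ a x, f a * g x = g x * f a)
    (hg : ∀ x y, g x * g y = g y * g x) :
    ∃ F : SymmetricAlgebra A L →ₐ[K] R,
      (∀ a, F (algebraMap A _ a) = f a) ∧ ∀ x, F (ι A L x) = g x := by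
  let S : Set R := Set.range f ∪ Set.range g
  have hS : ∀ p ∈ S, ∀ q ∈ S, p * q = q * p := by
    rintro _ (⟨a, rfl⟩ | ⟨x, rfl⟩) _ (⟨b, rfl⟩ | ⟨y, rfl⟩)
    · rw [← map_mul, mul_comm, map_mul]
    · exact hfg a y
    · exact (hfg b x).symm
    · exact hg x y
  -- The universal property requires a commutative target, and `R` need not be commutative. The
  -- subalgebra generated by the two images is, since its generators commute.
  let _ : CommRing (Algebra.adjoin K S) :=
    { (inferInstance : Ring (Algebra.adjoin K S)) with
      mul_comm := (Algebra.isMulCommutative_adjoin K hS).is_comm.comm }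
  obtain ⟨F, hF, hF'⟩ := exists_algHom (C := Algebra.adjoin K S)
    (f.codRestrict _ fun a => Algebra.subset_adjoin (Or.inl ⟨a, rfl⟩))
    (AddMonoidHom.mk' (fun x => ⟨g x, Algebra.subset_adjoin (Or.inr ⟨x, rfl⟩)⟩)
      fun x y => Subtype.ext (map_add g x y)) fun a x => Subtype.ext (h_smul a x)
  exact ⟨(Algebra.adjoin K S).val.comp F, fun a => congrArg Subtype.val (hF a),
    fun x => congrArg Subtype.val (hF' x)⟩

end liftBase

variable {A L : Type*} [CommRing A] [AddCommGroup L] [Module A L]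

/-- The square-zero extension of `A` by `L` is a commutative algebra containing `L`; lifting the
inclusion gives a left inverse up to an injection. -/
theorem ι_injective : Function.Injective (ι A L) := by
  let _ : Module Aᵐᵒᵖ L := Module.compHom L ((RingHom.id A).fromOpposite mul_comm)
  have : IsCentralScalar A L := ⟨fun _ _ => rfl⟩
  intro x y h
  have h' := congrArg (SymmetricAlgebra.lift (TrivSqZeroExt.inrHom A L)) h
  rw [lift_ι_apply, lift_ι_apply] at h'
  exact TrivSqZeroExt.inr_injective h'

/-- Supplies a decomposition into homogeneous parts. Uniqueness of the parts plays no role in the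
injectivity argument. -/
theorem iSup_range_ι_pow : ⨆ n : ℕ, LinearMap.range (ι A L) ^ n = ⊤ := by
  refine eq_top_iff.2 fun t _ => ?_
  induction t using SymmetricAlgebra.induction with
  | algebraMap r =>
    refine Submodule.mem_iSup_of_mem 0 ?_
    rw [pow_zero]
    exact Submodule.algebraMap_mem r
  | ι x =>
    refine Submodule.mem_iSup_of_mem 1 ?_
    rw [pow_one]
    exact ⟨x, rfl⟩
  | mul a b ha hb =>
    have h := Submodule.mul_mem_mul (ha trivial) (hb trivial)
    refine SetLike.le_def.1 ?_ h
    rw [Submodule.iSup_mul]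
    refine iSup_le fun m => ?_
    rw [Submodule.mul_iSup]
    refine iSup_le fun n => ?_
    rw [← pow_add]
    exact le_iSup (fun n : ℕ => LinearMap.range (ι A L) ^ n) (m + n)
  | add a b ha hb => exact add_mem (ha trivial) (hb trivial)

theorem range_ι_pow_induction {n : ℕ} {motive : SymmetricAlgebra A L → Prop}
    (prod : ∀ (a : A) (l : List L), l.length = n →
      motive (algebraMap A _ a * (l.map (ι A L)).prod))
    (add : ∀ s t, motive s → motive t → motive (s + t)) {t : SymmetricAlgebra A L}
    (ht : t ∈ LinearMap.range (ι A L) ^ n) : motive t := by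
  have hspan : LinearMap.range (ι A L) ^ n =
      Submodule.span A {s | ∃ l : List L, l.length = n ∧ s = (l.map (ι A L)).prod} := by
    rw [← Submodule.span_eq (LinearMap.range (ι A L)), Submodule.span_pow]
    congr 1
    ext s
    rw [Set.mem_pow]
    constructor
    · rintro ⟨f, rfl⟩
      choose g hg using fun i => (f i).2
      refine ⟨List.ofFn g, List.length_ofFn, ?_⟩
      rw [List.map_ofFn]
      congr 2
      funext i
      exact (hg i).symm
    · rintro ⟨l, rfl, rfl⟩
      refine ⟨fun i => ⟨ι A L (l.get i), l.get i, rfl⟩, ?_⟩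
      congr 1
      conv_rhs => rw [← List.ofFn_get l, List.map_ofFn]
      rfl
  rw [hspan] at ht
  -- The motive is not assumed stable under scalars, so the induction carries an arbitrary
  -- coefficient that absorbs them.
  have key : ∀ a : A, motive (algebraMap A _ a * t) := by
    induction ht using Submodule.span_induction with
    | mem s hs =>
      obtain ⟨l, hl, rfl⟩ := hs
      exact fun a => prod a l hl
    | zero =>
      intro a
      have := prod 0 (List.replicate n 0) (List.length_replicate ..)
      rw [map_zero, zero_mul] at this
      rwa [mul_zero]
    | add s t _ _ hs ht =>
      intro a
      rw [mul_add]
      exact add _ _ (hs a) (ht a)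
    | smul b s _ hs =>
      intro a
      rw [Algebra.smul_def, ← mul_assoc, ← map_mul]
      exact hs _
  simpa using key 1

end SymmetricAlgebra

/-! ## Sheaves associated with presheaves of algebras -/

section SheafAlg

variable {K : Type u} [Field K] {X : TopCat.{u}} {F G : (Opens X)ᵒᵖ ⥤ AlgCat.{u} K}

theorem exists_algRes_eq_of_toSheafAlg_eq {U : Opens X} {s t : F.obj (op U)}
    (h : ((toSheafAlg F).app (op U)).hom s = ((toSheafAlg F).app (op U)).hom t) {x : X}
    (hx : x ∈ U) : ∃ (V : Opens X) (hV : V ≤ U), x ∈ V ∧ algRes F hV s = algRes F hV t := by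
  have hinj : Presheaf.IsLocallyInjective (Opens.grothendieckTopology X) (toSheafAlg F) :=
    Presheaf.isLocallyInjective_toSheafify' _ _
  obtain ⟨V, f, hf, hxV⟩ := hinj.equalizerSieve_mem s t h x hx
  exact ⟨V, leOfHom f, hxV, hf⟩

/-- Sheafification inverts locally bijective morphisms. This reduces the PBW theorem to statements
about presheaf sections near a point. -/
theorem isIso_sheafifyAlgMap (α : F ⟶ G)
    (inj : ∀ (U : Opens X) (s : F.obj (op U)), (α.app (op U)).hom s = 0 → ∀ x ∈ U,
      ∃ (V : Opens X) (hV : V ≤ U), x ∈ V ∧ algRes F hV s = 0)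
    (surj : ∀ (U : Opens X) (s : G.obj (op U)), ∀ x ∈ U,
      ∃ (V : Opens X) (hV : V ≤ U) (t : F.obj (op V)), x ∈ V ∧
        (α.app (op V)).hom t = algRes G hV s) : IsIso (sheafifyAlgMap α) := by
  have : Presheaf.IsLocallyInjective (Opens.grothendieckTopology X) α := ⟨by
    intro U s t h x hx
    have h' : (α.app U).hom (s - t) = 0 := by
      rw [map_sub, sub_eq_zero]
      exact h
    obtain ⟨V, hV, hxV, hst⟩ := inj U.unop (s - t) h' x hx
    refine ⟨V, homOfLE hV, ?_, hxV⟩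
    rw [map_sub, sub_eq_zero] at hst
    exact hst⟩
  have : Presheaf.IsLocallySurjective (Opens.grothendieckTopology X) α := ⟨by
    intro U s x hx
    obtain ⟨V, hV, t, hxV, ht⟩ := surj U s x hx
    exact ⟨V, homOfLE hV, ⟨t, ht⟩, hxV⟩⟩
  exact (GrothendieckTopology.W_iff _ α).1 (GrothendieckTopology.W_of_isLocallyBijective _ α)

theorem sheafifyAlg_hom_ext {H : X.Sheaf (AlgCat.{u} K)} {α β : sheafifyAlg F ⟶ H}
    (h : ∀ (U : Opens X) (s : F.obj (op U)),
      (α.hom.app (op U)).hom (((toSheafAlg F).app (op U)).hom s) =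
        (β.hom.app (op U)).hom (((toSheafAlg F).app (op U)).hom s)) : α = β := by
  apply ObjectProperty.hom_ext
  refine sheafify_hom_ext (Opens.grothendieckTopology X) _ _ H.property ?_
  ext U s
  exact h U.unop s

end SheafAlg


/-! ## The symmetrization map -/

namespace AlgFiltration

variable {K A : Type u} [CommRing K] [Ring A] [Algebra K A] (F : AlgFiltration K A)

theorem cls_eq_of_sub_mem {m n : ℕ} (h : m = n) {a : F.step m} {b : F.step n}
    (hab : (a : A) - b ∈ F.prev m) : F.cls m a = F.cls n b := by
  subst h
  exact congrArg (DirectSum.lof K ℕ F.Piece m) ((F.toPiece_eq_iff a b).2 hab)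

theorem cls_congr {m n : ℕ} (h : m = n) {a : F.step m} {b : F.step n} (hab : (a : A) = b) :
    F.cls m a = F.cls n b :=
  F.cls_eq_of_sub_mem h (by rw [hab, sub_self]; exact zero_mem _)

theorem cls_eq_zero_of_mem {n : ℕ} {a : F.step n} (ha : (a : A) ∈ F.prev n) : F.cls n a = 0 := by
  rw [← map_zero (F.cls n)]
  exact F.cls_eq_of_sub_mem rfl (by simpa using ha)

/-- Projecting to the `n`-th summand isolates one class, and the kernel of the map to the `n`-th
piece is the previous step. -/
theorem mem_prev_of_sum_cls_eq_zero {s : Finset ℕ} {a : ∀ n, F.step n}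
    (h : ∑ n ∈ s, F.cls n (a n) = 0) {n : ℕ} (hn : n ∈ s) : (a n : A) ∈ F.prev n := by
  have h' := congrArg (DirectSum.component K ℕ F.Piece n) h
  rw [map_sum, map_zero, Finset.sum_eq_single n] at h'
  · have h0 : F.toPiece n (a n) = F.toPiece n 0 := by
      rw [map_zero, ← h']
      exact (DirectSum.component.lof_self K n (F.toPiece n (a n))).symm
    simpa using (F.toPiece_eq_iff _ _).1 h0
  · intro m _ hm
    exact (DirectSum.component.of _ _ _ _).trans (dif_neg hm)
  · exact fun hn' => absurd hn hn'

theorem step_mono {m n : ℕ} (h : m ≤ n) : F.step m ≤ F.step n :=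
  monotone_nat_of_le_succ F.mono h

theorem step_le_prev {m n : ℕ} (h : m < n) : F.step m ≤ F.prev n := by
  cases n with
  | zero => omega
  | succ n => exact F.step_mono (Nat.le_of_lt_succ h)

end AlgFiltration

namespace LieAlgebroid

open LieRinehart Module

variable {K : Type u} [Field K] {X : TopCat.{u}} {O : X.Sheaf (CommAlgCat.{u} K)}
  (L : LieAlgebroid O)

/-- The map `O(U) → gr U(O, L)(U)` before sheafification. -/
def clsO (U : Opens X) : OSec O U →ₐ[K] (L.envFil U).Gr :=
  AlgHom.ofLinearMap (((L.envFil U).cls 0).comp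
    ((L.envO U).toLinearMap.codRestrict _ L.envO_mem_envFil))
    ((L.envFil U).cls_congr rfl (map_one (L.envO U)))
    fun f g => ((L.envFil U).cls_congr rfl (map_mul (L.envO U) f g)).trans
      (AlgFiltration.cls_mul _ ⟨L.envO U f, L.envO_mem_envFil f⟩
        ⟨L.envO U g, L.envO_mem_envFil g⟩).symm

/-- The map `L(U) → gr U(O, L)(U)` before sheafification. -/
def clsι (U : Opens X) : L.sec U →ₗ[K] (L.envFil U).Gr :=
  ((L.envFil U).cls 1).comp ((L.envι U).codRestrict _ L.envι_mem_envFil)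

theorem clsO_apply {U : Opens X} (f : OSec O U) :
    L.clsO U f = (L.envFil U).cls 0 ⟨L.envO U f, L.envO_mem_envFil f⟩ := rfl

theorem clsι_apply {U : Opens X} (D : L.sec U) :
    L.clsι U D = (L.envFil U).cls 1 ⟨L.envι U D, L.envι_mem_envFil D⟩ := rfl

theorem envι_lie {U : Opens X} (D E : L.sec U) :
    L.envι U ⁅D, E⁆ = L.envι U D * L.envι U E - L.envι U E * L.envι U D :=
  (congrArg ((toSheafAlg L.envPresheaf).app (op U)).hom
    (Env.ofL_lie K (OSec O U) (L.sec U) D E)).trans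
    ((map_sub _ _ _).trans (congrArg₂ _ (map_mul _ _ _) (map_mul _ _ _)))

/-- The generators commute in `gr`: `f D - D f` is minus the function `⁅D, f⁆` and lies in step 0
rather than 1, while `D E - E D` is `⁅D, E⁆` and lies in step 1 rather than 2. -/
theorem exists_symToGr (U : Opens X) :
    ∃ F : SymmetricAlgebra (OSec O U) (L.sec U) →ₐ[K] (L.envFil U).Gr,
      (∀ f, F (algebraMap _ _ f) = L.clsO U f) ∧
        ∀ D, F (SymmetricAlgebra.ι _ _ D) = L.clsι U D := by
  refine SymmetricAlgebra.exists_algHom_of_commute (L.clsO U) (L.clsι U).toAddMonoidHom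
    (fun f D => ?_) (fun f D => ?_) fun D E => ?_
  · refine Eq.trans ?_ (AlgFiltration.cls_mul _ ⟨L.envO U f, _⟩ ⟨L.envι U D, _⟩).symm
    exact AlgFiltration.cls_congr _ rfl (L.envι_smul f D)
  · refine (AlgFiltration.cls_mul _ ⟨L.envO U f, _⟩ ⟨L.envι U D, _⟩).trans (Eq.trans ?_
      (AlgFiltration.cls_mul _ ⟨L.envι U D, _⟩ ⟨L.envO U f, _⟩).symm)
    refine AlgFiltration.cls_eq_of_sub_mem _ rfl ?_
    have h : L.envO U f * L.envι U D - L.envι U D * L.envO U f = -L.envO U ⁅D, f⁆ := by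
      rw [envι_mul_envO]
      abel
    exact h ▸ neg_mem (L.envO_mem_envFil _)
  · refine (AlgFiltration.cls_mul _ ⟨L.envι U D, _⟩ ⟨L.envι U E, _⟩).trans (Eq.trans ?_
      (AlgFiltration.cls_mul _ ⟨L.envι U E, _⟩ ⟨L.envι U D, _⟩).symm)
    exact AlgFiltration.cls_eq_of_sub_mem _ rfl (L.envι_lie D E ▸ L.envι_mem_envFil _)

/-- The symmetrization map `Sym (L(U)) → gr U(O, L)(U)` before sheafification. -/
def symToGr (U : Opens X) : SymmetricAlgebra (OSec O U) (L.sec U) →ₐ[K] (L.envFil U).Gr :=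
  (L.exists_symToGr U).choose

theorem symToGr_algebraMap {U : Opens X} (f : OSec O U) :
    L.symToGr U (algebraMap _ _ f) = L.clsO U f :=
  (L.exists_symToGr U).choose_spec.1 f

theorem symToGr_ι {U : Opens X} (D : L.sec U) :
    L.symToGr U (SymmetricAlgebra.ι _ _ D) = L.clsι U D :=
  (L.exists_symToGr U).choose_spec.2 D

theorem symToGr_prod {U : Opens X} (l : List (L.sec U)) :
    L.symToGr U (l.map (SymmetricAlgebra.ι (OSec O U) _)).prod =
      (L.envFil U).cls l.length ⟨(l.map (L.envι U)).prod, L.prod_envι_mem_envFil l⟩ := by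
  induction l with
  | nil => exact map_one _
  | cons D l ih =>
    rw [List.map_cons, List.prod_cons, map_mul, ih, symToGr_ι, clsι_apply, AlgFiltration.cls_mul]
    exact AlgFiltration.cls_congr _ (by rw [List.length_cons, add_comm]) (by simp)

theorem envO_mul_prod_mem_envFil {U : Opens X} (f : OSec O U) (l : List (L.sec U)) :
    L.envO U f * (l.map (L.envι U)).prod ∈ (L.envFil U).step l.length :=
  L.mem_envFil_of_mem_envSpan (Submodule.subset_span ⟨f, l, le_rfl, rfl⟩)

theorem symToGr_algebraMap_mul_prod {U : Opens X} (f : OSec O U) (l : List (L.sec U)) :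
    L.symToGr U (algebraMap _ _ f * (l.map (SymmetricAlgebra.ι (OSec O U) _)).prod) =
      (L.envFil U).cls l.length
        ⟨L.envO U f * (l.map (L.envι U)).prod, L.envO_mul_prod_mem_envFil f l⟩ := by
  rw [map_mul, symToGr_prod, symToGr_algebraMap, clsO_apply, AlgFiltration.cls_mul]
  exact AlgFiltration.cls_congr _ (zero_add _) rfl

/-- The symmetrization map as a morphism of presheaves. -/
def symToGrPresheaf : L.symPresheaf ⟶ L.grPresheaf where
  app U := AlgCat.ofHom (L.symToGr U.unop)
  naturality {U V} f := by
    refine AlgCat.hom_ext _ (SymmetricAlgebra.algHom_ext_base (fun a => ?_) fun D => ?_)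
    · refine (congrArg (L.symToGr V.unop) (SymmetricAlgebra.mapSemi_algebraMap _
        (L.resSemi (leOfHom f.unop)) a)).trans ((L.symToGr_algebraMap _).trans ?_)
      refine Eq.trans ?_ (congrArg (AlgFiltration.grMap _ _ (algRes L.env.obj (leOfHom f.unop))
        fun _ _ => L.algRes_mem_envFil _) (L.symToGr_algebraMap a)).symm
      refine Eq.trans ?_ (AlgFiltration.grMap_cls _ _ _ _ _ _).symm
      exact AlgFiltration.cls_congr _ rfl (L.algRes_envO (leOfHom f.unop) a).symm
    · refine (congrArg (L.symToGr V.unop) (SymmetricAlgebra.mapSemi_ι _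
        (L.resSemi (leOfHom f.unop)) D)).trans ((L.symToGr_ι _).trans ?_)
      refine Eq.trans ?_ (congrArg (AlgFiltration.grMap _ _ (algRes L.env.obj (leOfHom f.unop))
        fun _ _ => L.algRes_mem_envFil _) (L.symToGr_ι D)).symm
      refine Eq.trans ?_ (AlgFiltration.grMap_cls _ _ _ _ _ _).symm
      exact AlgFiltration.cls_congr _ rfl (L.algRes_envι (leOfHom f.unop) D).symm

theorem prod_mem_symPow {U : Opens X} (f : OSec O U) (l : List (L.sec U)) :
    algebraMap _ _ f * (l.map (SymmetricAlgebra.ι (OSec O U) _)).prod ∈ L.symPow l.length U := by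
  change _ ∈ LinearMap.range (SymmetricAlgebra.ι (OSec O U) (L.sec U)) ^ l.length
  rw [← Algebra.smul_def]
  refine Submodule.smul_mem _ _ ?_
  induction l with
  | nil => exact Submodule.one_le.1 (pow_zero _).ge
  | cons D l ih =>
    rw [List.map_cons, List.prod_cons, List.length_cons, pow_succ']
    exact Submodule.mul_mem_mul ⟨D, rfl⟩ ih

/-- Every element of the span of products of length at most `n` has the same class in degree `n` as
the image of a homogeneous element of the symmetric algebra. -/
theorem exists_symToGr_eq_cls {n : ℕ} {U : Opens X} {s : L.EnvSec U} (hs : s ∈ L.envSpan n U) :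
    ∃ t ∈ L.symPow n U,
      L.symToGr U t = (L.envFil U).cls n ⟨s, L.mem_envFil_of_mem_envSpan hs⟩ := by
  induction hs using Submodule.span_induction with
  | mem z hz =>
    obtain ⟨f, l, hl, rfl⟩ := hz
    rcases hl.eq_or_lt with rfl | hl
    · exact ⟨_, L.prod_mem_symPow f l, L.symToGr_algebraMap_mul_prod f l⟩
    -- A product of fewer than `n` sections already lies in an earlier step, so its class in degree
    -- `n` is zero.
    · refine ⟨0, zero_mem _, (map_zero _).trans (AlgFiltration.cls_eq_zero_of_mem _ ?_).symm⟩
      exact AlgFiltration.step_le_prev _ hl (L.envO_mul_prod_mem_envFil f l)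
  | zero => exact ⟨0, zero_mem _, (map_zero _).trans (map_zero _).symm⟩
  | add a b ha hb iha ihb =>
    obtain ⟨s, hs, hs'⟩ := iha
    obtain ⟨t, ht, ht'⟩ := ihb
    refine ⟨s + t, add_mem hs ht, ?_⟩
    rw [map_add, hs', ht', ← map_add]
    rfl
  | smul k a ha iha =>
    obtain ⟨s, hs, hs'⟩ := iha
    refine ⟨k • s, Submodule.smul_mem _ _ hs, ?_⟩
    rw [map_smul, hs', ← map_smul]
    rfl

theorem algRes_cls {U V : Opens X} (h : V ≤ U) {n : ℕ} (a : (L.envFil U).step n) :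
    algRes L.grPresheaf h ((L.envFil U).cls n a) =
      (L.envFil V).cls n ⟨algRes L.env.obj h a, L.algRes_mem_envFil h a.2⟩ :=
  AlgFiltration.grMap_cls _ _ _ _ n a

theorem algRes_symToGr {U V : Opens X} (h : V ≤ U)
    (t : SymmetricAlgebra (OSec O U) (L.sec U)) :
    algRes L.grPresheaf h (L.symToGr U t) = L.symToGr V (algRes L.symPresheaf h t) :=
  algRes_naturality L.symToGrPresheaf h t

theorem exists_symToGr_eq_algRes_cls {U : Opens X} {n : ℕ} (a : (L.envFil U).step n) {x : X}
    (hx : x ∈ U) : ∃ (V : Opens X) (hV : V ≤ U), x ∈ V ∧ ∃ t ∈ L.symPow n V,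
      L.symToGr V t = algRes L.grPresheaf hV ((L.envFil U).cls n a) := by
  obtain ⟨V, hV, hxV, ha⟩ := a.2 x hx
  obtain ⟨t, ht, ht'⟩ := L.exists_symToGr_eq_cls ha
  exact ⟨V, hV, hxV, t, ht, ht'.trans (L.algRes_cls hV a).symm⟩

/-- Local surjectivity. Membership in a filtration step is itself a local condition, so a preimage
exists only after shrinking; finitely many summands share a neighbourhood. -/
theorem exists_symToGr_eq_algRes (U : Opens X) (s : (L.envFil U).Gr) {x : X} (hx : x ∈ U) :
    ∃ (V : Opens X) (hV : V ≤ U) (t : SymmetricAlgebra (OSec O V) (L.sec V)), x ∈ V ∧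
      L.symToGr V t = algRes L.grPresheaf hV s := by
  induction s using DirectSum.induction_on with
  | zero => exact ⟨U, le_rfl, 0, hx, (map_zero _).trans (map_zero _).symm⟩
  | of n a =>
    obtain ⟨a, rfl⟩ := (L.envFil U).toPiece_surjective n a
    obtain ⟨V, hV, hxV, t, -, ht⟩ := L.exists_symToGr_eq_algRes_cls a hx
    exact ⟨V, hV, t, hxV, ht⟩
  | add a b iha ihb =>
    obtain ⟨V, hV, s, hxV, hs⟩ := iha
    obtain ⟨W, hW, t, hxW, ht⟩ := ihb
    refine ⟨V ⊓ W, inf_le_left.trans hV, algRes L.symPresheaf inf_le_left s +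
      algRes L.symPresheaf inf_le_right t, ⟨hxV, hxW⟩, ?_⟩
    refine (map_add (L.symToGr (V ⊓ W)) _ _).trans (Eq.trans ?_ (map_add _ _ _).symm)
    rw [← algRes_symToGr, ← algRes_symToGr, hs, ht]
    exact congrArg₂ _ (algRes_algRes L.grPresheaf _ _ _) (algRes_algRes L.grPresheaf _ _ _)

/-- The symmetric algebra is commutative, so all `k!` orderings of the product have the same class,
which therefore equals their average. Characteristic zero enters only here, to divide by `k!`. -/
theorem symToGr_prod_eq_symmetrization [CharZero K] {U : Opens X} {k : ℕ} (D : Fin k → L.sec U) :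
    L.symToGr U (∏ i, SymmetricAlgebra.ι _ _ (D i)) =
      (L.envFil U).cls k ⟨L.symmetrization D, L.symmetrization_mem_envFil D⟩ := by
  have hσ : ∀ σ : Equiv.Perm (Fin k), (List.ofFn fun i => L.envι U (D (σ i))).prod ∈
      (L.envFil U).step k := fun σ => by
    have h := L.prod_envι_mem_envFil (List.ofFn fun i => D (σ i))
    rwa [List.length_ofFn, List.map_ofFn] at h
  have h : ∀ σ : Equiv.Perm (Fin k), L.symToGr U (∏ i, SymmetricAlgebra.ι _ _ (D i)) =
      (L.envFil U).cls k ⟨_, hσ σ⟩ := by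
    intro σ
    rw [← Equiv.prod_comp σ, ← List.prod_ofFn]
    have := L.symToGr_prod (List.ofFn fun i => D (σ i))
    rw [List.map_ofFn] at this
    refine this.trans (AlgFiltration.cls_congr _ List.length_ofFn ?_)
    exact congrArg List.prod List.map_ofFn
  have hk : (k.factorial : K) ≠ 0 := Nat.cast_ne_zero.2 k.factorial_ne_zero
  have hsum : L.symToGr U (∏ i, SymmetricAlgebra.ι _ _ (D i)) =
      (k.factorial : K)⁻¹ • ∑ σ : Equiv.Perm (Fin k), (L.envFil U).cls k ⟨_, hσ σ⟩ := by
    rw [← Finset.sum_congr rfl fun σ _ => h σ, Finset.sum_const, Finset.card_univ,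
      Fintype.card_perm, Fintype.card_fin, ← Nat.cast_smul_eq_nsmul K, smul_smul,
      inv_mul_cancel₀ hk, one_smul]
  rw [hsum, ← map_sum, ← map_smul]
  refine AlgFiltration.cls_congr _ rfl ?_
  rw [Submodule.coe_smul, Submodule.coe_sum]
  rfl

end LieAlgebroid


/-! ## Local injectivity of the symmetrization map -/

namespace LieAlgebroid

open LieRinehart Module

variable {K : Type u} [Field K] {X : TopCat.{u}} {O : X.Sheaf (CommAlgCat.{u} K)}
  (L : LieAlgebroid O) {x : X} {J : Type u}

theorem algRes_sym_algebraMap {U V : Opens X} (h : V ≤ U) (f : OSec O U) :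
    algRes L.symPresheaf h (algebraMap (OSec O U) (SymmetricAlgebra (OSec O U) (L.sec U)) f) =
      algebraMap (OSec O V) (SymmetricAlgebra (OSec O V) (L.sec V)) (oRes O h f) :=
  SymmetricAlgebra.mapSemi_algebraMap _ (L.resSemi h) f

theorem algRes_sym_ι {U V : Opens X} (h : V ≤ U) (D : L.sec U) :
    algRes L.symPresheaf h (SymmetricAlgebra.ι (OSec O U) (L.sec U) D) =
      SymmetricAlgebra.ι (OSec O V) (L.sec V) (L.res h D) :=
  SymmetricAlgebra.mapSemi_ι _ (L.resSemi h) D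

/-- The canonical map `U(O(U), L(U)) → U(O, L)(U)`. -/
def toEnv (U : Opens X) : Env K (OSec O U) (L.sec U) →ₐ[K] L.EnvSec U :=
  ((toSheafAlg L.envPresheaf).app (op U)).hom

theorem toEnv_ofA_mul_prod {U : Opens X} (f : OSec O U) (l : List (L.sec U)) :
    L.toEnv U (Env.ofA K _ _ f * (l.map (Env.ofL K (OSec O U) (L.sec U))).prod) =
      L.envO U f * (l.map (L.envι U)).prod := by
  rw [map_mul, map_list_prod, List.map_map]
  rfl

/-! ### Germs of symmetric and enveloping algebra elements in a basis of the stalk. -/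

section Frame

variable {L} (b : Basis J (OStalk O x) (L.Stalk x))

theorem exists_polyGerm (i : Nhd x) :
    ∃ F : SymmetricAlgebra (OSec O i.opens) (L.sec i.opens) →ₐ[K] MvPolynomial J (OStalk O x),
      (∀ f, F (algebraMap _ _ f) = MvPolynomial.C (oGerm O x i f)) ∧
      ∀ D, F (SymmetricAlgebra.ι _ _ D) =
        b.constr (OStalk O x) (MvPolynomial.X : J → _) (L.germ x i D) :=
  SymmetricAlgebra.exists_algHom
    ((IsScalarTower.toAlgHom K (OStalk O x) (MvPolynomial J (OStalk O x))).comp (oGerm O x i))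
    ((b.constr (OStalk O x) (MvPolynomial.X : J → _)).toAddMonoidHom.comp
      (L.germ x i).toAddMonoidHom) fun f D => by
    refine (congrArg (b.constr (OStalk O x) (MvPolynomial.X : J → _))
      (L.germ_smul i f D).symm).trans ?_
    rw [map_smul, Algebra.smul_def]
    rfl

/-- The germ of an element of the symmetric algebra as a polynomial in a basis of the stalk. -/
def polyGerm (i : Nhd x) :
    SymmetricAlgebra (OSec O i.opens) (L.sec i.opens) →ₐ[K] MvPolynomial J (OStalk O x) :=
  (exists_polyGerm b i).choose

theorem polyGerm_algebraMap (i : Nhd x) (f : OSec O i.opens) :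
    polyGerm b i (algebraMap _ _ f) = MvPolynomial.C (oGerm O x i f) :=
  (exists_polyGerm b i).choose_spec.1 f

theorem polyGerm_ι (i : Nhd x) (D : L.sec i.opens) :
    polyGerm b i (SymmetricAlgebra.ι _ _ D) =
      b.constr (OStalk O x) (MvPolynomial.X : J → _) (L.germ x i D) :=
  (exists_polyGerm b i).choose_spec.2 D

theorem polyGerm_algRes {i j : Nhd x} (h : i ≤ j)
    (t : SymmetricAlgebra (OSec O i.opens) (L.sec i.opens)) :
    polyGerm b j (algRes L.symPresheaf (Nhd.opens_le h) t) = polyGerm b i t := by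
  have : (polyGerm b j).comp (algRes L.symPresheaf (Nhd.opens_le h)) = polyGerm b i := by
    refine SymmetricAlgebra.algHom_ext_base (fun f => ?_) fun D => ?_
    · refine (congrArg (polyGerm b j) (L.algRes_sym_algebraMap (Nhd.opens_le h) f)).trans ?_
      rw [polyGerm_algebraMap, polyGerm_algebraMap, oGerm_res h]
    · refine (congrArg (polyGerm b j) (L.algRes_sym_ι (Nhd.opens_le h) D)).trans ?_
      rw [polyGerm_ι, polyGerm_ι, L.germ_res h]
  exact DFunLike.congr_fun this t

theorem polyGerm_algebraMap_mul_prod (i : Nhd x) (f : OSec O i.opens)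
    (l : List (L.sec i.opens)) :
    polyGerm b i (algebraMap _ _ f * (l.map (SymmetricAlgebra.ι _ _)).prod) =
      oGerm O x i f • ((l.map (L.germ x i)).map
        (b.constr (OStalk O x) (MvPolynomial.X : J → MvPolynomial J (OStalk O x)))).prod := by
  rw [map_mul, map_list_prod, List.map_map, List.map_map, polyGerm_algebraMap,
    MvPolynomial.smul_eq_C_mul]
  congr 2
  exact List.map_congr_left fun D _ => polyGerm_ι b i D

variable (L x) in
/-- Germs of elements of the universal enveloping algebras. -/
def envGerm (i : Nhd x) : Env K (OSec O i.opens) (L.sec i.opens) →ₐ[K]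
    Env K (OStalk O x) (L.Stalk x) := Env.map (L.germHom x i)

theorem envGerm_algRes {i j : Nhd x} (h : i ≤ j) (c : Env K (OSec O i.opens) (L.sec i.opens)) :
    envGerm L x j (algRes L.envPresheaf (Nhd.opens_le h) c) = envGerm L x i c := by
  have : (envGerm L x j).comp (algRes L.envPresheaf (Nhd.opens_le h)) = envGerm L x i := by
    refine Env.hom_ext (fun f => ?_) fun D => ?_
    · refine (congrArg (envGerm L x j) (Env.map_ofA (L.res (Nhd.opens_le h)) f)).trans ?_
      refine (Env.map_ofA _ _).trans (Eq.trans ?_ (Env.map_ofA _ _).symm)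
      rw [oGerm_res h]
    · refine (congrArg (envGerm L x j) (Env.map_ofL (L.res (Nhd.opens_le h)) D)).trans ?_
      refine (Env.map_ofL _ _).trans (Eq.trans ?_ (Env.map_ofL _ _).symm)
      rw [germHom_apply, germHom_apply, L.germ_res h]
  exact DFunLike.congr_fun this c

theorem envGerm_ofA_mul_prod (i : Nhd x) (f : OSec O i.opens) (l : List (L.sec i.opens)) :
    envGerm L x i (Env.ofA K _ _ f * (l.map (Env.ofL K _ _)).prod) =
      Env.ofA K _ _ (oGerm O x i f) * ((l.map (L.germ x i)).map (Env.ofL K _ _)).prod := by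
  rw [map_mul, map_list_prod, List.map_map, List.map_map]
  refine congrArg₂ _ (Env.map_ofA _ _) (congrArg List.prod ?_)
  exact List.map_congr_left fun D _ => Env.map_ofL _ _

/-- Elements with the same image in the sheafification agree after restriction to a smaller
neighbourhood, and germs do not see the restriction. -/
theorem envGerm_eq_of_toEnv_eq {i : Nhd x} {c d : Env K (OSec O i.opens) (L.sec i.opens)}
    (h : L.toEnv i.opens c = L.toEnv i.opens d) : envGerm L x i c = envGerm L x i d := by
  obtain ⟨V, hV, hxV, hcd⟩ := exists_algRes_eq_of_toSheafAlg_eq h i.2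
  have hiV : i ≤ Nhd.mk hxV := hV
  rw [← envGerm_algRes hiV, ← envGerm_algRes hiV]
  exact congrArg _ hcd

/-! ### Comparison of the filtration with polynomial degree at a point. -/

variable {b} {E : Env K (OStalk O x) (L.Stalk x) →ₗ[K] MvPolynomial J (OStalk O x)}
  (hE : ∀ (a : OStalk O x) (l : List (L.Stalk x)),
    E (Env.ofA K _ _ a * (l.map (Env.ofL K _ _)).prod) -
        a • (l.map (b.constr (OStalk O x)
          (MvPolynomial.X : J → MvPolynomial J (OStalk O x)))).prod ∈ degLT J _ l.length ∧
      E (Env.ofA K _ _ a * (l.map (Env.ofL K _ _)).prod) ∈ degLT J _ (l.length + 1))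

include hE

/-- Each product is lifted to the enveloping algebra in the order in which it is written; the
principal symbol `E` recovers the original polynomial up to lower degree. Sums of lifts serve for
sums, so no canonical choice is needed. -/
theorem exists_env_of_mem_symPow {n : ℕ} {i : Nhd x}
    {t : SymmetricAlgebra (OSec O i.opens) (L.sec i.opens)} (ht : t ∈ L.symPow n i.opens) :
    ∃ (c : Env K (OSec O i.opens) (L.sec i.opens))
      (hc : L.toEnv i.opens c ∈ (L.envFil i.opens).step n),
      L.symToGr i.opens t = (L.envFil i.opens).cls n ⟨L.toEnv i.opens c, hc⟩ ∧
      E (envGerm L x i c) - polyGerm b i t ∈ degLT J (OStalk O x) n ∧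
      (polyGerm b i t).IsHomogeneous n := by
  refine SymmetricAlgebra.range_ι_pow_induction
    (motive := fun t => ∃ (c : Env K (OSec O i.opens) (L.sec i.opens))
      (hc : L.toEnv i.opens c ∈ (L.envFil i.opens).step n),
      L.symToGr i.opens t = (L.envFil i.opens).cls n ⟨L.toEnv i.opens c, hc⟩ ∧
      E (envGerm L x i c) - polyGerm b i t ∈ degLT J (OStalk O x) n ∧
      (polyGerm b i t).IsHomogeneous n)
    (fun f l hl => ?_) (fun s t hs ht => ?_) ht
  · subst hl
    refine ⟨Env.ofA K _ _ f * (l.map (Env.ofL K _ _)).prod, ?_, ?_, ?_, ?_⟩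
    · rw [toEnv_ofA_mul_prod]
      exact L.envO_mul_prod_mem_envFil f l
    · rw [symToGr_algebraMap_mul_prod]
      exact AlgFiltration.cls_congr _ rfl (L.toEnv_ofA_mul_prod f l).symm
    · rw [envGerm_ofA_mul_prod, polyGerm_algebraMap_mul_prod]
      simpa using (hE (oGerm O x i f) (l.map (L.germ x i))).1
    · rw [polyGerm_algebraMap_mul_prod]
      simpa using isHomogeneous_smul_prod_constr_X b (oGerm O x i f) (l.map (L.germ x i))
  · obtain ⟨c, hc, hc₁, hc₂, hc₃⟩ := hs
    obtain ⟨d, hd, hd₁, hd₂, hd₃⟩ := ht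
    refine ⟨c + d, by rw [map_add]; exact add_mem hc hd, ?_, ?_, ?_⟩
    · rw [map_add, hc₁, hd₁, ← map_add]
      exact AlgFiltration.cls_congr _ rfl (map_add _ _ _).symm
    · rw [map_add, map_add, map_add, add_sub_add_comm]
      exact add_mem hc₂ hd₂
    · rw [map_add]
      exact hc₃.add hd₃

theorem exists_env_of_mem_envSpan {n : ℕ} {i : Nhd x} {s : L.EnvSec i.opens}
    (hs : s ∈ L.envSpan n i.opens) :
    ∃ c : Env K (OSec O i.opens) (L.sec i.opens), L.toEnv i.opens c = s ∧
      E (envGerm L x i c) ∈ degLT J (OStalk O x) (n + 1) := by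
  induction hs using Submodule.span_induction with
  | mem z hz =>
    obtain ⟨f, l, hl, rfl⟩ := hz
    refine ⟨_, L.toEnv_ofA_mul_prod f l, ?_⟩
    rw [envGerm_ofA_mul_prod]
    exact degLT_mono (by simpa using hl) (hE (oGerm O x i f) (l.map (L.germ x i))).2
  | zero => exact ⟨0, map_zero _, by rw [map_zero, map_zero]; exact zero_mem _⟩
  | add a a' _ _ ha ha' =>
    obtain ⟨c, hc, hc'⟩ := ha
    obtain ⟨d, hd, hd'⟩ := ha'
    refine ⟨c + d, by rw [map_add, hc, hd], ?_⟩
    rw [map_add, map_add]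
    exact add_mem hc' hd'
  | smul k a _ ha =>
    obtain ⟨c, hc, hc'⟩ := ha
    refine ⟨k • c, by rw [map_smul, hc], ?_⟩
    -- The spaces `degLT` are modules over the stalk, so a scalar of `K` is first read as a germ.
    rw [map_smul, map_smul, ← algebraMap_smul (OStalk O x) k (E (envGerm L x i c))]
    exact Submodule.smul_mem _ _ hc'

/-- Near `x` the section of `c` is a sum of short products and thus has some lift of small degree.
The germs of two lifts coincide, so the bound passes to `c`. -/
theorem envGerm_mem_degLT {n : ℕ} {i : Nhd x} {c : Env K (OSec O i.opens) (L.sec i.opens)}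
    (hc : L.toEnv i.opens c ∈ (L.envFil i.opens).prev n) :
    E (envGerm L x i c) ∈ degLT J (OStalk O x) n := by
  cases n with
  | zero =>
    have h0 : L.toEnv i.opens c = L.toEnv i.opens 0 := by
      rw [map_zero]
      exact hc
    rw [envGerm_eq_of_toEnv_eq h0, map_zero, map_zero]
    exact zero_mem _
  | succ n =>
    obtain ⟨V, hV, hxV, hcV⟩ := hc x i.2
    have hiV : i ≤ Nhd.mk hxV := hV
    obtain ⟨d, hd, hd'⟩ := exists_env_of_mem_envSpan (i := Nhd.mk hxV) hE hcV
    have h : L.toEnv (Nhd.mk hxV).opens (algRes L.envPresheaf hV c) =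
        L.toEnv (Nhd.mk hxV).opens d :=
      (algRes_naturality (toSheafAlg L.envPresheaf) hV c).symm.trans hd.symm
    rw [← envGerm_algRes hiV]
    exact (envGerm_eq_of_toEnv_eq h).symm ▸ hd'

/-- In each degree `n` the lift `c n` falls into the previous step, so `E` of its germ has degree
below `n`. It differs from the `n`-th polynomial by terms of degree below `n`, and that polynomial
is homogeneous of degree `n`, hence zero. -/
theorem polyGerm_eq_zero_of_symToGr_eq_zero {i : Nhd x}
    {t : SymmetricAlgebra (OSec O i.opens) (L.sec i.opens)} (ht : L.symToGr i.opens t = 0) :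
    polyGerm b i t = 0 := by
  have htop : t ∈ ⨆ n, LinearMap.range (SymmetricAlgebra.ι (OSec O i.opens) (L.sec i.opens)) ^ n :=
    by rw [SymmetricAlgebra.iSup_range_ι_pow]; exact Submodule.mem_top
  obtain ⟨p, hp, rfl⟩ := (Submodule.mem_iSup_iff_exists_finsupp
    (fun n => LinearMap.range (SymmetricAlgebra.ι (OSec O i.opens) (L.sec i.opens)) ^ n) t).1 htop
  choose c hc hc₁ hc₂ hc₃ using fun n => exists_env_of_mem_symPow (n := n) (i := i) hE (hp n)
  have hsum : ∑ n ∈ p.support, (L.envFil i.opens).cls n ⟨L.toEnv i.opens (c n), hc n⟩ = 0 := by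
    rw [← ht, Finsupp.sum, map_sum]
    exact Finset.sum_congr rfl fun n _ => (hc₁ n).symm
  rw [Finsupp.sum, map_sum]
  refine Finset.sum_eq_zero fun n hn => ?_
  have h := envGerm_mem_degLT hE (AlgFiltration.mem_prev_of_sum_cls_eq_zero _ hsum hn)
  refine eq_zero_of_isHomogeneous_of_mem_degLT (hc₃ n) ?_
  simpa using sub_mem h (hc₂ n)

/-! ### Elements of the symmetric algebra as polynomials in a local frame. -/

omit hE

variable {i₀ : Nhd x} (e : J → L.sec i₀.opens)

/-- Polynomials in a local frame as elements of the symmetric algebra. -/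
def frameMap {i : Nhd x} (h : i₀ ≤ i) : MvPolynomial J (OSec O i.opens) →ₐ[OSec O i.opens]
    SymmetricAlgebra (OSec O i.opens) (L.sec i.opens) :=
  MvPolynomial.aeval fun k => SymmetricAlgebra.ι _ _ (L.res (Nhd.opens_le h) (e k))

theorem frameMap_C {i : Nhd x} (h : i₀ ≤ i) (f : OSec O i.opens) :
    frameMap e h (MvPolynomial.C f) = algebraMap _ _ f :=
  MvPolynomial.aeval_C _ f

theorem frameMap_X {i : Nhd x} (h : i₀ ≤ i) (k : J) :
    frameMap e h (MvPolynomial.X k) =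
      SymmetricAlgebra.ι _ _ (L.res (Nhd.opens_le h) (e k)) :=
  MvPolynomial.aeval_X _ k

theorem algRes_frameMap {i j : Nhd x} (h : i₀ ≤ i) (hij : i ≤ j)
    (q : MvPolynomial J (OSec O i.opens)) :
    algRes L.symPresheaf (Nhd.opens_le hij) (frameMap e h q) =
      frameMap e (h.trans hij) (MvPolynomial.map (oRes O (Nhd.opens_le hij)).toRingHom q) := by
  induction q using MvPolynomial.induction_on with
  | C f =>
    rw [MvPolynomial.map_C, frameMap_C, frameMap_C]
    exact L.algRes_sym_algebraMap _ f
  | add p q hp hq =>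
    rw [map_add, map_add, map_add, ← hp, ← hq]
    exact map_add (algRes L.symPresheaf (Nhd.opens_le hij)) _ _
  | mul_X p k hp =>
    rw [map_mul, map_mul, map_mul, ← hp, MvPolynomial.map_X, frameMap_X, frameMap_X]
    refine (map_mul (algRes L.symPresheaf (Nhd.opens_le hij)) _ _).trans (congrArg (_ * ·) ?_)
    refine (L.algRes_sym_ι _ _).trans ?_
    rw [res_res]

theorem polyGerm_frameMap (hb : ∀ k, b k = L.germ x i₀ (e k)) {i : Nhd x} (h : i₀ ≤ i)
    (q : MvPolynomial J (OSec O i.opens)) :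
    polyGerm b i (frameMap e h q) = MvPolynomial.map (oGerm O x i).toRingHom q := by
  induction q using MvPolynomial.induction_on with
  | C f => rw [frameMap_C, polyGerm_algebraMap, MvPolynomial.map_C]; rfl
  | add p q hp hq => rw [map_add, map_add, map_add, hp, hq]
  | mul_X p k hp =>
    rw [map_mul, map_mul, map_mul, hp, MvPolynomial.map_X, frameMap_X, polyGerm_ι, L.germ_res h,
      ← hb, Basis.constr_basis]

theorem exists_frameMap_eq_ι {i : Nhd x} (h : i₀ ≤ i) {D : L.sec i.opens}
    (hD : D ∈ Submodule.span (OSec O i.opens)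
      (Set.range fun k => L.res (Nhd.opens_le h) (e k))) :
    ∃ q, SymmetricAlgebra.ι (OSec O i.opens) (L.sec i.opens) D = frameMap e h q := by
  induction hD using Submodule.span_induction with
  | mem z hz =>
    obtain ⟨k, rfl⟩ := hz
    exact ⟨MvPolynomial.X k, (frameMap_X e h k).symm⟩
  | zero => exact ⟨0, by rw [map_zero, map_zero]⟩
  | add s t _ _ hs ht =>
    obtain ⟨p, hp⟩ := hs
    obtain ⟨q, hq⟩ := ht
    exact ⟨p + q, by rw [map_add, map_add, hp, hq]⟩
  | smul f s _ hs =>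
    obtain ⟨p, hp⟩ := hs
    exact ⟨f • p, by rw [map_smul, map_smul, hp]⟩

/-- Only finitely many sections occur in `t`, so after shrinking finitely often all of them are
combinations of the frame. -/
theorem exists_frameMap_eq (hspan : ∀ (V : Opens X) (h : V ≤ i₀.opens) (s : L.sec V), ∀ y ∈ V,
      ∃ (W : Opens X) (h' : W ≤ V), y ∈ W ∧
        L.res h' s ∈ Submodule.span (OSec O W) (Set.range fun k => L.res (h'.trans h) (e k)))
    {i : Nhd x} (h : i₀ ≤ i) (t : SymmetricAlgebra (OSec O i.opens) (L.sec i.opens)) :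
    ∃ (j : Nhd x) (hij : i ≤ j) (q : MvPolynomial J (OSec O j.opens)),
      algRes L.symPresheaf (Nhd.opens_le hij) t = frameMap e (h.trans hij) q := by
  have join : ∀ s t : SymmetricAlgebra (OSec O i.opens) (L.sec i.opens),
      (∃ (j : Nhd x) (hij : i ≤ j) (q : MvPolynomial J (OSec O j.opens)),
        algRes L.symPresheaf (Nhd.opens_le hij) s = frameMap e (h.trans hij) q) →
      (∃ (j : Nhd x) (hij : i ≤ j) (q : MvPolynomial J (OSec O j.opens)),
        algRes L.symPresheaf (Nhd.opens_le hij) t = frameMap e (h.trans hij) q) →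
      ∃ (j : Nhd x) (hij : i ≤ j) (p q : MvPolynomial J (OSec O j.opens)),
        algRes L.symPresheaf (Nhd.opens_le hij) s = frameMap e (h.trans hij) p ∧
        algRes L.symPresheaf (Nhd.opens_le hij) t = frameMap e (h.trans hij) q := by
    rintro s t ⟨j₁, h₁, p, hp⟩ ⟨j₂, h₂, q, hq⟩
    obtain ⟨j, hj₁, hj₂⟩ := exists_ge_ge j₁ j₂
    refine ⟨j, h₁.trans hj₁, MvPolynomial.map (oRes O (Nhd.opens_le hj₁)).toRingHom p,
      MvPolynomial.map (oRes O (Nhd.opens_le hj₂)).toRingHom q, ?_, ?_⟩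
    · rw [← algRes_frameMap e (h.trans h₁) hj₁, ← hp]
      exact (algRes_algRes L.symPresheaf (Nhd.opens_le h₁) (Nhd.opens_le hj₁) s).symm
    · rw [← algRes_frameMap e (h.trans h₂) hj₂, ← hq]
      exact (algRes_algRes L.symPresheaf (Nhd.opens_le h₂) (Nhd.opens_le hj₂) t).symm
  induction t using SymmetricAlgebra.induction with
  | algebraMap f =>
    refine ⟨i, le_rfl, MvPolynomial.C f, ?_⟩
    rw [frameMap_C]
    exact (L.algRes_sym_algebraMap _ f).trans (congrArg _ (oRes_self O f))
  | ι D =>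
    obtain ⟨W, hW, hxW, hD⟩ := hspan i.opens (Nhd.opens_le h) D x i.2
    have hiW : i ≤ Nhd.mk hxW := hW
    obtain ⟨q, hq⟩ := exists_frameMap_eq_ι (i := Nhd.mk hxW) e (h.trans hiW) hD
    exact ⟨Nhd.mk hxW, hiW, q, (L.algRes_sym_ι hW D).trans hq⟩
  | mul s t hs ht =>
    obtain ⟨j, hij, p, q, hp, hq⟩ := join s t hs ht
    refine ⟨j, hij, p * q, ?_⟩
    rw [map_mul, ← hp, ← hq]
    exact map_mul (algRes L.symPresheaf (Nhd.opens_le hij)) s t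
  | add s t hs ht =>
    obtain ⟨j, hij, p, q, hp, hq⟩ := join s t hs ht
    refine ⟨j, hij, p + q, ?_⟩
    rw [map_add, ← hp, ← hq]
    exact map_add (algRes L.symPresheaf (Nhd.opens_le hij)) s t

theorem exists_map_oRes_eq_zero {i : Nhd x} {q : MvPolynomial J (OSec O i.opens)}
    (hq : MvPolynomial.map (oGerm O x i).toRingHom q = 0) :
    ∃ (j : Nhd x) (hij : i ≤ j),
      MvPolynomial.map (oRes O (Nhd.opens_le hij)).toRingHom q = 0 := by
  obtain ⟨j, hij, hj⟩ := exists_finsupp_oRes_eq_zero i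
    ((MvPolynomial.basisMonomials J (OSec O i.opens)).repr q) fun w => by
      have := congrArg (MvPolynomial.coeff w) hq
      rwa [MvPolynomial.coeff_map, MvPolynomial.coeff_zero] at this
  refine ⟨j, hij, MvPolynomial.ext _ _ fun w => ?_⟩
  rw [MvPolynomial.coeff_map, MvPolynomial.coeff_zero]
  exact hj w

end Frame

/-- The symmetrization map of a locally free Lie algebroid is locally injective. -/
theorem exists_algRes_eq_zero_of_symToGr_eq_zero (hL : L.IsLocallyFree) {U : Opens X}
    {t : SymmetricAlgebra (OSec O U) (L.sec U)} (ht : L.symToGr U t = 0) {x : X} (hx : x ∈ U) :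
    ∃ (V : Opens X) (hV : V ≤ U), x ∈ V ∧ algRes L.symPresheaf hV t = 0 := by
  obtain ⟨U₀, hx₀, J, e, hli, hspan⟩ := hL x
  let i₀ : Nhd x := Nhd.mk hx₀
  obtain ⟨b, hb⟩ := L.exists_basis_stalk i₀ e hli hspan
  obtain ⟨E, hE⟩ := exists_principal_symbol K b
  have hpoly := polyGerm_eq_zero_of_symToGr_eq_zero hE (i := Nhd.mk hx) ht
  obtain ⟨i, hi₀, hi⟩ := exists_ge_ge i₀ (Nhd.mk hx)
  obtain ⟨j, hij, q, hq⟩ := exists_frameMap_eq (i₀ := i₀) e hspan hi₀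
    (algRes L.symPresheaf (Nhd.opens_le hi) t)
  -- Since `b` consists of the germs of the frame, the polynomial attached to the stalk has the
  -- germs of the coefficients of `q` as its coefficients; all of them vanish.
  have hq0 : MvPolynomial.map (oGerm O x j).toRingHom q = 0 := by
    rw [← polyGerm_frameMap (b := b) (i₀ := i₀) e hb (hi₀.trans hij), ← hq]
    exact (polyGerm_algRes b hij _).trans ((polyGerm_algRes b hi t).trans hpoly)
  obtain ⟨k, hjk, hk⟩ := exists_map_oRes_eq_zero hq0
  refine ⟨k.opens, Nhd.opens_le (hi.trans (hij.trans hjk)), k.2, ?_⟩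
  have h := algRes_frameMap (i₀ := i₀) e (hi₀.trans hij) hjk q
  rw [hk, map_zero, ← hq] at h
  refine Eq.trans ?_ h
  refine ((algRes_algRes L.symPresheaf (Nhd.opens_le hij) (Nhd.opens_le hjk) _).trans ?_).symm
  exact algRes_algRes L.symPresheaf (Nhd.opens_le hi) (Nhd.opens_le (hij.trans hjk)) t

end LieAlgebroid


/-! ## The PBW isomorphism -/

namespace LieAlgebroid

open LieRinehart

variable {K : Type u} [Field K] {X : TopCat.{u}} {O : X.Sheaf (CommAlgCat.{u} K)}
  (L : LieAlgebroid O)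

theorem app_hom_inv {F G : X.Sheaf (AlgCat.{u} K)} (ψ : F ≅ G) {U : Opens X}
    (s : G.obj.obj (op U)) :
    (ψ.hom.hom.app (op U)).hom ((ψ.inv.hom.app (op U)).hom s) = s :=
  congrArg (fun f : G ⟶ G => (f.hom.app (op U)).hom s) ψ.inv_hom_id

theorem app_inv_hom {F G : X.Sheaf (AlgCat.{u} K)} (ψ : F ≅ G) {U : Opens X}
    (s : F.obj.obj (op U)) :
    (ψ.inv.hom.app (op U)).hom ((ψ.hom.hom.app (op U)).hom s) = s :=
  congrArg (fun f : F ⟶ F => (f.hom.app (op U)).hom s) ψ.hom_inv_id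

/-- The canonical map from the presheaf to the sheaf of graded algebras. -/
def toGr (U : Opens X) : (L.envFil U).Gr →ₐ[K] L.GrSec U :=
  ((toSheafAlg L.grPresheaf).app (op U)).hom

theorem toGr_cls {n : ℕ} {U : Opens X} (a : (L.envFil U).step n) :
    L.toGr U ((L.envFil U).cls n a) = L.symbol n U a := rfl

theorem algRes_toGr {U V : Opens X} (h : V ≤ U) (s : (L.envFil U).Gr) :
    algRes L.gr.obj h (L.toGr U s) = L.toGr V (algRes L.grPresheaf h s) :=
  algRes_naturality (toSheafAlg L.grPresheaf) h s

/-- The symmetrization map as a morphism of sheaves. -/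
def symToGrMap : L.sym ⟶ L.gr := sheafifyAlgMap L.symToGrPresheaf

theorem symToGrMap_toSym {U : Opens X} (t : SymmetricAlgebra (OSec O U) (L.sec U)) :
    (L.symToGrMap.hom.app (op U)).hom (L.toSym U t) = L.toGr U (L.symToGr U t) :=
  toSheafAlg_naturality L.symToGrPresheaf t

theorem isIso_symToGrMap (hL : L.IsLocallyFree) : IsIso L.symToGrMap :=
  isIso_sheafifyAlgMap L.symToGrPresheaf
    (fun _ _ ht _ hx => L.exists_algRes_eq_zero_of_symToGr_eq_zero hL ht hx)
    (fun U s _ hx => L.exists_symToGr_eq_algRes U s hx)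

theorem exists_cls_eq_symToGr {n : ℕ} {U : Opens X}
    {t : SymmetricAlgebra (OSec O U) (L.sec U)} (ht : t ∈ L.symPow n U) :
    ∃ a, L.symToGr U t = (L.envFil U).cls n a := by
  refine SymmetricAlgebra.range_ι_pow_induction
    (motive := fun t => ∃ a, L.symToGr U t = (L.envFil U).cls n a)
    (fun f l hl => ?_) (fun s t hs ht => ?_) ht
  · subst hl
    exact ⟨_, L.symToGr_algebraMap_mul_prod f l⟩
  · obtain ⟨a, ha⟩ := hs
    obtain ⟨b, hb⟩ := ht
    exact ⟨a + b, by rw [map_add, map_add, ha, hb]⟩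

variable {L}

/-- Both directions of homogeneity are local. Symmetrization maps the `n`-th symmetric power to
classes of degree `n`, and every such class has, locally, a preimage in that power. -/
theorem isPBW_of_inv_eq [CharZero K] {ψ : L.gr ≅ L.sym} (h : ψ.inv = L.symToGrMap) :
    L.IsPBW ψ := by
  have hinv : ∀ {U : Opens X} (t : SymmetricAlgebra (OSec O U) (L.sec U)),
      (ψ.inv.hom.app (op U)).hom (L.toSym U t) = L.toGr U (L.symToGr U t) := fun t => by
    rw [h, symToGrMap_toSym]
  have hhom : ∀ {U : Opens X} (t : SymmetricAlgebra (OSec O U) (L.sec U)),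
      (ψ.hom.hom.app (op U)).hom (L.toGr U (L.symToGr U t)) = L.toSym U t := fun t => by
    rw [← hinv, app_hom_inv]
  refine ⟨fun U f => ?_, fun n U s => ⟨fun hs x hx => ?_, fun hs x hx => ?_⟩, fun U k D => ?_⟩
  · have := hhom (algebraMap _ (SymmetricAlgebra (OSec O U) (L.sec U)) f)
    rw [symToGr_algebraMap] at this
    exact this
  · obtain ⟨V, hV, hxV, t, ht, hst⟩ := hs x hx
    obtain ⟨a, ha⟩ := L.exists_cls_eq_symToGr ht
    refine ⟨V, hV, hxV, a, ?_⟩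
    have h1 := hinv t
    rw [ha, toGr_cls] at h1
    rw [← h1, ← app_inv_hom ψ (algRes L.gr.obj hV s), ← algRes_naturality ψ.hom.hom hV s, ← hst]
    rfl
  · obtain ⟨V, hV, hxV, a, ha⟩ := hs x hx
    obtain ⟨W, hW, hxW, t, ht, hta⟩ := L.exists_symToGr_eq_algRes_cls a hxV
    refine ⟨W, hW.trans hV, hxW, t, ht, ?_⟩
    rw [algRes_naturality ψ.hom.hom, ← algRes_algRes L.gr.obj hV hW, ← ha, ← toGr_cls,
      algRes_toGr, ← hta, hhom]
    rfl
  · rw [hinv, symToGr_prod_eq_symmetrization, toGr_cls]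

/-- The inverse is a morphism of sheaves of algebras, hence fixed by its values on `O` and on `L`.
The structure maps give the former, the symmetrization formula with `k = 1` the latter. -/
theorem IsPBW.inv_eq [CharZero K] {ψ : L.gr ≅ L.sym} (h : L.IsPBW ψ) :
    ψ.inv = L.symToGrMap := by
  refine sheafifyAlg_hom_ext fun U t => ?_
  have : (ψ.inv.hom.app (op U)).hom.comp (L.toSym U) = (L.toGr U).comp (L.symToGr U) := by
    refine SymmetricAlgebra.algHom_ext_base (fun f => ?_) fun D => ?_
    · have h1 := congrArg (ψ.inv.hom.app (op U)).hom (h.map_structure U f)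
      rw [app_inv_hom] at h1
      refine h1.symm.trans ?_
      rw [AlgHom.comp_apply, symToGr_algebraMap]
      rfl
    · have h1 := h.inv_prod U 1 fun _ => D
      rw [← toGr_cls, ← symToGr_prod_eq_symmetrization] at h1
      simpa using h1
  exact (DFunLike.congr_fun this t).trans (L.symToGrMap_toSym t).symm

theorem existsUnique_isPBW [CharZero K] (hL : L.IsLocallyFree) :
    ∃! ψ : L.gr ≅ L.sym, L.IsPBW ψ := by
  have := L.isIso_symToGrMap hL
  refine ⟨(asIso L.symToGrMap).symm, isPBW_of_inv_eq rfl, fun ψ hψ => ?_⟩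
  have h : ψ.symm = asIso L.symToGrMap := Iso.ext hψ.inv_eq
  exact congrArg Iso.symm h

/-! ### Injectivity of the canonical map. -/

theorem res_eq_zero_separated {U : Opens X} {D : L.sec U}
    (h : ∀ x ∈ U, ∃ (V : Opens X) (hV : V ≤ U), x ∈ V ∧ L.res hV D = 0) : D = 0 := by
  choose V hV hxV hD using fun x : U => h x.1 x.2
  have hU : U ≤ iSup V := fun x hx => Opens.mem_iSup.2 ⟨⟨x, hx⟩, hxV ⟨x, hx⟩⟩
  obtain ⟨t, -, ht⟩ := L.existsUnique_gluing V (fun _ => 0) fun i j => by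
    rw [map_zero, map_zero]
  have h0 : L.res (iSup_le hV) D = 0 :=
    (ht _ fun i => (L.res_res _ _ D).trans (hD i)).trans (ht 0 fun i => map_zero _).symm
  -- The open sets `U` and `iSup V` coincide; restricting to the supremum and back avoids transport
  -- along the equality.
  rw [← L.res_self D, ← L.res_res (iSup_le hV) hU, h0, map_zero]

/-- If the image of `D` vanishes, so does its class in degree one, which is the symmetrization of
`D`. By local injectivity `D` vanishes locally in `Sym`, and `L` embeds in its symmetric algebra
over each open set. -/
theorem envι_injective (hL : L.IsLocallyFree) (U : Opens X) : Function.Injective (L.envι U) := by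
  refine (injective_iff_map_eq_zero _).2 fun D hD => res_eq_zero_separated fun x hx => ?_
  have h : L.symToGr U (SymmetricAlgebra.ι _ _ D) = 0 := by
    rw [symToGr_ι, clsι_apply]
    refine AlgFiltration.cls_eq_zero_of_mem _ ?_
    change L.envι U D ∈ _
    rw [hD]
    exact zero_mem _
  obtain ⟨V, hV, hxV, h0⟩ := L.exists_algRes_eq_zero_of_symToGr_eq_zero hL h hx
  refine ⟨V, hV, hxV, SymmetricAlgebra.ι_injective (A := OSec O V) ?_⟩
  rw [map_zero]
  exact (L.algRes_sym_ι hV D).symm.trans h0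

/-! ### Compatibility with morphisms of Lie algebroids. -/

namespace Hom

variable {L' : LieAlgebroid O} (φ : L'.Hom L)

theorem gr_symbol (n : ℕ) (U : Opens X) (s : (L'.envFil U).step n) :
    (φ.gr.hom.app (op U)).hom (L'.symbol n U s) =
      L.symbol n U ⟨φ.envApp U s, φ.envApp_mem_envFil U n s s.2⟩ :=
  (toSheafAlg_naturality φ.grPresheafMap _).trans
    (congrArg ((toSheafAlg L.grPresheaf).app (op U)).hom (AlgFiltration.grMap_cls _ _ _ _ n s))

/-- Two algebra homomorphisms out of a symmetric algebra, compared on functions and on sections;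
naturality of symmetrization needs no computation with products. -/
theorem symPresheafMap_comp_symToGrPresheaf :
    φ.symPresheafMap ≫ L.symToGrPresheaf = L'.symToGrPresheaf ≫ φ.grPresheafMap := by
  ext U : 2
  refine AlgCat.hom_ext _ (SymmetricAlgebra.algHom_ext_base (fun f => ?_) fun D => ?_)
  · refine (congrArg (L.symToGr U.unop)
      (SymmetricAlgebra.mapSemi_algebraMap _ (φ.appSemi U.unop) f)).trans ?_
    refine (L.symToGr_algebraMap _).trans (Eq.trans ?_
      (congrArg (φ.grPresheafMap.app U).hom (L'.symToGr_algebraMap f)).symm)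
    refine Eq.trans ?_ (AlgFiltration.grMap_cls _ _ _ _ _ _).symm
    exact AlgFiltration.cls_congr _ rfl (φ.envApp_envO f).symm
  · refine (congrArg (L.symToGr U.unop)
      (SymmetricAlgebra.mapSemi_ι _ (φ.appSemi U.unop) D)).trans ?_
    refine (L.symToGr_ι _).trans (Eq.trans ?_
      (congrArg (φ.grPresheafMap.app U).hom (L'.symToGr_ι D)).symm)
    refine Eq.trans ?_ (AlgFiltration.grMap_cls _ _ _ _ _ _).symm
    exact AlgFiltration.cls_congr _ rfl (φ.envApp_envι D).symm

theorem sym_comp_symToGrMap : φ.sym ≫ L.symToGrMap = L'.symToGrMap ≫ φ.gr := by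
  have h := congrArg sheafifyAlgMap φ.symPresheafMap_comp_symToGrPresheaf
  unfold sheafifyAlgMap at h
  rw [Functor.map_comp, Functor.map_comp] at h
  exact h

end Hom

end LieAlgebroid

end

theorem mainTheorem5 {K : Type u} [Field K] [CharZero K] {X : TopCat.{u}}
    (O : X.Sheaf (CommAlgCat.{u} K)) (L L' : LieAlgebroid O) (φ : L'.Hom L)
    (hL : L.IsLocallyFree) (hL' : L'.IsLocallyFree) :
    -- the PBW isomorphisms exist and are determined by the symmetrization formula
    (∃! ψ' : L'.gr ≅ L'.sym, L'.IsPBW ψ') ∧ (∃! ψ : L.gr ≅ L.sym, L.IsPBW ψ) ∧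
    -- they are compatible with the maps induced by `φ`
    (∀ (ψ' : L'.gr ≅ L'.sym) (ψ : L.gr ≅ L.sym), L'.IsPBW ψ' → L.IsPBW ψ →
      ψ'.hom ≫ φ.sym = φ.gr ≫ ψ.hom ∧
      -- the outer rectangle of the diagram that starts with `φ : L' → L`
      ∀ (U : Opens X) (D : L'.sec U),
        (φ.sym.hom.app (op U)).hom ((ψ'.hom.hom.app (op U)).hom
            (L'.symbol 1 U ⟨L'.envι U D, L'.envι_mem_envFil D⟩)) =
          (ψ.hom.hom.app (op U)).hom
            (L.symbol 1 U ⟨L.envι U (φ.app U D), L.envι_mem_envFil (φ.app U D)⟩)) ∧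
    -- the canonical maps to the universal enveloping algebroids are embeddings
    (∀ U : Opens X, Function.Injective (L'.envι U)) ∧
    (∀ U : Opens X, Function.Injective (L.envι U)) ∧
    -- the left square
    (∀ (U : Opens X) (D : L'.sec U), φ.envApp U (L'.envι U D) = L.envι U (φ.app U D)) ∧
    -- the middle square, on each step of the canonical filtration
    (∀ (n : ℕ) (U : Opens X) (s : (L'.envFil U).step n),
      (φ.gr.hom.app (op U)).hom (L'.symbol n U s) =
        L.symbol n U ⟨φ.envApp U s, φ.envApp_mem_envFil U n s s.2⟩) := by
  refine ⟨LieAlgebroid.existsUnique_isPBW hL', LieAlgebroid.existsUnique_isPBW hL,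
    fun ψ' ψ hψ' hψ => ?_, LieAlgebroid.envι_injective hL', LieAlgebroid.envι_injective hL,
    fun U D => φ.envApp_envι D, φ.gr_symbol⟩
  have hcomm : ψ'.hom ≫ φ.sym = φ.gr ≫ ψ.hom := by
    -- Passing to inverses turns the square into naturality of the symmetrization map, whichever PBW
    -- isomorphisms are given.
    rw [← Iso.comp_inv_eq, Category.assoc, ← Iso.eq_inv_comp, hψ.inv_eq, hψ'.inv_eq]
    exact φ.sym_comp_symToGrMap
  refine ⟨hcomm, fun U D => ?_⟩
  refine (congrArg (fun f : L'.gr ⟶ L.sym => (f.hom.app (op U)).hom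
    (L'.symbol 1 U ⟨L'.envι U D, L'.envι_mem_envFil D⟩)) hcomm).trans ?_
  refine congrArg (ψ.hom.hom.app (op U)).hom ((φ.gr_symbol 1 U _).trans ?_)
  exact congrArg (L.symbol 1 U) (Subtype.ext (φ.envApp_envι D))
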